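/- Let $n,n_0,p,q\ge 0$ be integers and consider the interconnection $$\dot x=Ax+E_0w_0+E_1w_1,\quad z_0=C_0x+F_{00}w_0+F_{01}w_1,\quad z_1=C_1x+F_{10}w_0+F_{11}w_1,\quad w_0=\Delta z_0,$$ with $x(t)\in\mathbb R^n$, $w_0(t),z_0(t)\in\mathbb R^{n_0}$, $w_1(t)\in\mathbb R^p$, $z_1(t)\in\mathbb R^q$, where $A$ is Metzler (nonnegative off-diagonal entries) and $E_0,E_1,C_0,C_1,F_{00},F_{01},F_{10},F_{11}$ are entrywise nonnegative. Let $\Delta_0\in\mathbb R^{n_0\times n_0}$ be entrywise nonnegative and such that the loop is well posed and positive, i.e. $I-\Delta_0F_{00}$ is invertible with an entrywise nonnegative inverse, and let $\gamma>0$. A stable positive LTI operator $\Delta$ is the convolution $(\Delta z)_i(t)=\sum_j\int_{[0,\infty)} z_j(t-\theta)\,d\mu_{ij}(\theta)$ with a matrix of finite nonnegative measures on $[0,\infty)$; its transfer function is $\widehat\Delta(s)_{ij}=\int e^{-s\theta}d\mu_{ij}(\theta)$ and its static-gain matrix is $\widehat\Delta(0)$. The initial condition of the interconnection consists of $x(0)\in\mathbb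 R^n$ and of a bounded measurable past of $z_0$ on $(-\infty,0)$ (irrelevant if $\Delta$ is constant). The interconnection is asymptotically stable if trajectories exist for all initial conditions and all inputs $w_1\in L_1$, the zero solution for $w_1=0$ is Lyapunov stable, and all trajectories for $w_1=0$ satisfy $x(t)\to0$ and $z_0(t)\to0$ as $t\to\infty$ (smallness and convergence of $z_0$ being understood up to null sets of times). The $L_1$-gain of $w_1\to z_1$ is the supremum of $\|z_1\|_{L_1}$ over inputs with $\|w_1\|_{L_1}=1$ and zero initial condition, where $\|v\|_{L_1}=\int_0^\infty\sum_i|v_i(t)|\,dt$. The following statements are equivalent: (i) The interconnection with constant $\Delta=\Delta_0$ is asymptotically stable and the $L_1$-gain of $w_1\to z_1$ is smaller than $\gamma$. (ii) For every stable positive LTI operator $\Delta$ with $\widehat\Delta(0)=\Delta_0$, the interconnection is asymptotically stable and the $L_1$-gain of $w_1\to z_1$ is smaller than $\gamma$. (ii') For some stable positive LTI operator $\Delta$ with $\widehat\Delta(0)=\Delta_0$, the interconnection is asymptotically stable and the $L_1$-gain of $w_1\to z_1$ is smaller than $\gamma$. (iii) There exist $\lambda\in\mathbb R^n$ with positive entries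 and $\varphi_1,\varphi_2\in\mathbb R^{n_0}$ such that, all inequalities being entrywise and $\mathbb 1_k\in\mathbb R^k$ denoting the vector of ones, $$\lambda^TA+\varphi_1^TC_0+\mathbb 1_q^TC_1<0,$$ $$\lambda^TE_0+\varphi_2^T+\varphi_1^TF_{00}+\mathbb 1_q^TF_{10}<0,$$ $$\lambda^TE_1-\gamma\mathbb 1_p^T+\varphi_1^TF_{01}+\mathbb 1_q^TF_{11}<0,$$ $$\varphi_1^T+\varphi_2^T\Delta_0=0.$$ -/

import Mathlib

open Set Filter Topology MeasureTheory Matrix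

/-- The matrices of a linear fractional representation
`x' = A x + E₀ w₀ + E₁ w₁`, `z₀ = C₀ x + F₀₀ w₀ + F₀₁ w₁`, `z₁ = C₁ x + F₁₀ w₀ + F₁₁ w₁`,
to be closed by a loop `w₀ = Δ z₀`; here `x(t) ∈ ℝⁿ`, `w₀(t), z₀(t) ∈ ℝ^{n₀}`, `w₁(t) ∈ ℝᵖ` and
`z₁(t) ∈ ℝ^q`. -/
structure LFR (n n₀ p q : ℕ) where
  A : Matrix (Fin n) (Fin n) ℝ
  E₀ : Matrix (Fin n) (Fin n₀) ℝ
  E₁ : Matrix (Fin n) (Fin p) ℝ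
  C₀ : Matrix (Fin n₀) (Fin n) ℝ
  C₁ : Matrix (Fin q) (Fin n) ℝ
  F₀₀ : Matrix (Fin n₀) (Fin n₀) ℝ
  F₀₁ : Matrix (Fin n₀) (Fin p) ℝ
  F₁₀ : Matrix (Fin q) (Fin n₀) ℝ
  F₁₁ : Matrix (Fin q) (Fin p) ℝ

/-- Entrywise nonnegativity of a real matrix. -/
def EntrywiseNonneg {m n : ℕ} (M : Matrix (Fin m) (Fin n) ℝ) : Prop := ∀ i j, 0 ≤ M i j

/-- Metzler matrices: nonnegative off-diagonal entries. -/
def IsMetzler {n : ℕ} (A : Matrix (Fin n) (Fin n) ℝ) : Prop := ∀ i j, i ≠ j → 0 ≤ A i j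

/-- Positivity of the nominal system: `A` is Metzler and all other matrices are nonnegative. -/
structure LFR.IsPositive {n n₀ p q : ℕ} (S : LFR n n₀ p q) : Prop where
  metzler : IsMetzler S.A
  E₀ : EntrywiseNonneg S.E₀
  E₁ : EntrywiseNonneg S.E₁
  C₀ : EntrywiseNonneg S.C₀
  C₁ : EntrywiseNonneg S.C₁
  F₀₀ : EntrywiseNonneg S.F₀₀
  F₀₁ : EntrywiseNonneg S.F₀₁
  F₁₀ : EntrywiseNonneg S.F₁₀
  F₁₁ : EntrywiseNonneg S.F₁₁

/-- The algebraic loop `w₀ = Δ₀ (F₀₀ w₀ + v)` is well posed and positive: `I - Δ₀ F₀₀` is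
invertible and its inverse is nonnegative. -/
def LFR.PositiveLoop {n n₀ p q : ℕ} (S : LFR n n₀ p q) (Δ₀ : Matrix (Fin n₀) (Fin n₀) ℝ) : Prop :=
  IsUnit (1 - Δ₀ * S.F₀₀) ∧ EntrywiseNonneg (1 - Δ₀ * S.F₀₀)⁻¹

/-- A stable positive linear time-invariant causal operator on `ℝ^{n₀}`-valued signals, given by
its impulse response: a matrix of finite (nonnegative) measures carried by `[0, ∞)`. -/
structure PositiveLTI (n₀ : ℕ) where
  kernel : Fin n₀ → Fin n₀ → Measure ℝ
  finite : ∀ i j, IsFiniteMeasure (kernel i j)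
  causal : ∀ i j, kernel i j (Iio 0) = 0

/-- The action on signals, by convolution. The values of `z` at negative times are its past. -/
noncomputable def PositiveLTI.apply {n₀ : ℕ} (Δ : PositiveLTI n₀) (z : ℝ → Fin n₀ → ℝ) :
    ℝ → Fin n₀ → ℝ :=
  fun t i => ∑ j, ∫ θ, z (t - θ) j ∂(Δ.kernel i j)

/-- The transfer function: the Laplace transform of the impulse response
(the integrals converge for `0 ≤ re s`). -/
noncomputable def PositiveLTI.transfer {n₀ : ℕ} (Δ : PositiveLTI n₀) (s : ℂ) :
    Matrix (Fin n₀) (Fin n₀) ℂ :=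
  fun i j => ∫ θ : ℝ, Complex.exp (-s * θ) ∂(Δ.kernel i j)

/-- `Δ₀` is the static-gain matrix of `Δ`, i.e. the value of the transfer function at `0`. -/
def PositiveLTI.HasStaticGain {n₀ : ℕ} (Δ : PositiveLTI n₀)
    (Δ₀ : Matrix (Fin n₀) (Fin n₀) ℝ) : Prop :=
  Δ.transfer 0 = Δ₀.map (fun a : ℝ => (a : ℂ))

/-- The memoryless operator `z ↦ Δ₀ z`. -/
def staticOperator {n₀ : ℕ} (Δ₀ : Matrix (Fin n₀) (Fin n₀) ℝ) (z : ℝ → Fin n₀ → ℝ) :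
    ℝ → Fin n₀ → ℝ :=
  fun t => Δ₀ *ᵥ z t

/-- The performance output `z₁`. -/
def LFR.output {n n₀ p q : ℕ} (S : LFR n n₀ p q) (x : ℝ → Fin n → ℝ) (w₀ : ℝ → Fin n₀ → ℝ)
    (w₁ : ℝ → Fin p → ℝ) : ℝ → Fin q → ℝ :=
  fun t => S.C₁ *ᵥ x t + S.F₁₀ *ᵥ w₀ t + S.F₁₁ *ᵥ w₁ t

/-- `(x, w₀, z₀)` is a (Carathéodory) trajectory on `[0, ∞)` of the interconnection of `S` with the
loop operator `G`, for the initial state `x₀`, the past `h` of the loop signal `z₀` on `(-∞, 0)`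
(which is the initial condition of `G`) and the exogenous input `w₁`. -/
structure LFR.IsTrajectory {n n₀ p q : ℕ} (S : LFR n n₀ p q)
    (G : (ℝ → Fin n₀ → ℝ) → ℝ → Fin n₀ → ℝ)
    (x₀ : Fin n → ℝ) (h : ℝ → Fin n₀ → ℝ) (w₁ : ℝ → Fin p → ℝ)
    (x : ℝ → Fin n → ℝ) (w₀ z₀ : ℝ → Fin n₀ → ℝ) : Prop where
  continuousOn : ContinuousOn x (Ici 0)
  integrable_w₀ : LocallyIntegrableOn w₀ (Ici 0)
  integrable_z₀ : LocallyIntegrableOn z₀ (Ici 0)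
  past : ∀ t < 0, z₀ t = h t
  state : ∀ t, 0 ≤ t →
    x t = x₀ + ∫ s in (0 : ℝ)..t, (S.A *ᵥ x s + S.E₀ *ᵥ w₀ s + S.E₁ *ᵥ w₁ s)
  loop_z₀ : ∀ᵐ t ∂volume.restrict (Ici 0),
    z₀ t = S.C₀ *ᵥ x t + S.F₀₀ *ᵥ w₀ t + S.F₀₁ *ᵥ w₁ t
  loop_w₀ : ∀ᵐ t ∂volume.restrict (Ici 0), w₀ t = G z₀ t

/-- Admissible pasts of the loop signal: bounded and measurable. -/
def IsPast {n₀ : ℕ} (h : ℝ → Fin n₀ → ℝ) : Prop :=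
  Measurable h ∧ ∃ M : ℝ, ∀ t < 0, ‖h t‖ ≤ M

/-- Asymptotic stability of the interconnection of `S` with the loop operator `G`: every initial
condition and every integrable input has a trajectory, the zero solution of the unforced
interconnection is Lyapunov stable, and all unforced trajectories converge to zero. As the past of
`z₀` belongs to the state of the interconnection, `z₀` is required to be small and to converge
too (up to null sets of times). -/
structure LFR.AsymptoticallyStable {n n₀ p q : ℕ} (S : LFR n n₀ p q)
    (G : (ℝ → Fin n₀ → ℝ) → ℝ → Fin n₀ → ℝ) : Prop where
  exists_trajectory : ∀ (x₀ : Fin n → ℝ) (h : ℝ → Fin n₀ → ℝ) (w₁ : ℝ → Fin p → ℝ),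
    IsPast h → IntegrableOn w₁ (Ici 0) → ∃ x w₀ z₀, S.IsTrajectory G x₀ h w₁ x w₀ z₀
  lyapunov : ∀ ε > 0, ∃ δ > 0, ∀ (x₀ : Fin n → ℝ) (h : ℝ → Fin n₀ → ℝ) x w₀ z₀,
    ‖x₀‖ ≤ δ → IsPast h → (∀ t < 0, ‖h t‖ ≤ δ) → S.IsTrajectory G x₀ h 0 x w₀ z₀ →
      (∀ t, 0 ≤ t → ‖x t‖ ≤ ε) ∧ ∀ᵐ t ∂volume.restrict (Ici 0), ‖z₀ t‖ ≤ ε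
  attractive : ∀ (x₀ : Fin n → ℝ) (h : ℝ → Fin n₀ → ℝ) x w₀ z₀,
    IsPast h → S.IsTrajectory G x₀ h 0 x w₀ z₀ →
      Tendsto x atTop (𝓝 0) ∧ Tendsto z₀ (atTop ⊓ ae volume) (𝓝 0)

/-- The `L₁`-norm of a signal on `[0, ∞)`: `∫ ∑ᵢ |vᵢ(t)| dt`. -/
noncomputable def L1norm {k : ℕ} (v : ℝ → Fin k → ℝ) : ENNReal :=
  ∫⁻ t in Ici (0 : ℝ), ∑ i, ‖v t i‖ₑ

/-- The `L₁`-gain of the transfer `w₁ → z₁` of the interconnection of `S` with `G`: the supremum of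
the `L₁`-norms of the outputs, for inputs of `L₁`-norm one and zero initial conditions. -/
noncomputable def LFR.L1gain {n n₀ p q : ℕ} (S : LFR n n₀ p q)
    (G : (ℝ → Fin n₀ → ℝ) → ℝ → Fin n₀ → ℝ) : ENNReal :=
  sSup {r : ENNReal | ∃ (w₁ : ℝ → Fin p → ℝ) (x : ℝ → Fin n → ℝ) (w₀ z₀ : ℝ → Fin n₀ → ℝ),
    IntegrableOn w₁ (Ici 0) ∧ L1norm w₁ = 1 ∧ S.IsTrajectory G 0 0 w₁ x w₀ z₀ ∧
      r = L1norm (S.output x w₀ w₁)}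

/-- The interconnection is asymptotically stable with `L₁`-gain smaller than `γ`. -/
def LFR.StableWithGain {n n₀ p q : ℕ} (S : LFR n n₀ p q)
    (G : (ℝ → Fin n₀ → ℝ) → ℝ → Fin n₀ → ℝ) (γ : ℝ) : Prop :=
  S.AsymptoticallyStable G ∧ S.L1gain G < ENNReal.ofReal γ

/-! The operator `Δ` acts positively, so on a finite horizon each convolution increases the integral
of a nonnegative signal at most by the total mass of its kernel, and these masses are the entries of
the static gain `Δ₀`. Linear weights on nonnegative signals therefore see `Δ` only through `Δ₀`;
this is why all operators with the same static gain behave alike. With `ψ = -φ₂` and `φ₁ = ψ ᵥ* Δ₀`,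
condition (iii) says that the weights `l` on the state and `ψ` on the loop input give a strict
dissipation inequality.

Sufficiency. The loop condition forces `ψ ≥ 0`. Integrating the weighted balance (`LFR.balance`) for
the absolute values of the signals bounds the gain (`LFR.IsTrajectory.integral_output_le`). Positive
left vectors of the Metzler block matrix of the interconnection yield positive right vectors
(`LFR.exists_isDecayVector`); these are constant supersolutions, and comparison
(`LFR.IsTrajectory.le_of_supersolution`) gives Lyapunov stability. A bound by a multiple of the
decay vector improves after some time by a fixed factor `s < 1`
(`LFR.IsTrajectory.eventually_abs_le_mul`), which gives convergence. Trajectories exist because the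
interconnection is a renewal system, contractive in an exponentially weighted `L₁`-space
(`LFR.exists_trajectory`).

Necessity. If (iii) fails, the theorem of the alternative supplies nonnegative `v`, `w`, `u` with
`(v, u) ≠ 0` that form a constant subsolution of the interconnection and whose output is at least
`γ` times the input in sum (`LFR.exists_multipliers_or_exists_dual`). Started at `v` with the
matching constant past, a trajectory stays above it, for whichever `Δ` is considered. This
contradicts convergence if `u = 0`, and the gain bound otherwise
(`LFR.StableWithGain.not_exists_dual`). The constant loop is the special case of Dirac kernels. -/

/-! ### Theorem of the alternative -/

/-- Motzkin's theorem of the alternative for a system of strict affine inequalities. -/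
theorem exists_forall_lt_or_exists_dual {E κ : Type*} [AddCommGroup E] [Module ℝ E] [Fintype κ]
    (L : E →ₗ[ℝ] (κ → ℝ)) (b : κ → ℝ) :
    (∃ e, ∀ k, L e k < b k) ∨
      ∃ y : κ → ℝ, (∀ k, 0 ≤ y k) ∧ y ≠ 0 ∧ (∀ e, L e ⬝ᵥ y = 0) ∧ b ⬝ᵥ y ≤ 0 := by
  classical
  by_cases h : ∃ e, ∀ k, L e k < b k
  · exact Or.inl h
  right
  -- Infeasibility means that the open negative orthant misses the affine image of `L - b`.
  -- Hahn–Banach separates the two, and `y` lists the coefficients of the separating functional.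
  let s : Set (κ → ℝ) := {a | ∀ k, a k < 0}
  let t : Set (κ → ℝ) := range fun e => L e - b
  have hs : Convex ℝ s := by
    have : s = Set.pi univ fun _ => Iio 0 := by ext; simp [s]
    rw [this]
    exact convex_pi fun _ _ => convex_Iio 0
  have hso : IsOpen s := by
    have : s = Set.pi univ fun _ => Iio 0 := by ext; simp [s]
    rw [this]
    exact isOpen_set_pi finite_univ fun _ _ => isOpen_Iio
  have ht : Convex ℝ t := by
    rintro _ ⟨e, rfl⟩ _ ⟨e', rfl⟩ α β hα hβ hαβ
    refine ⟨α • e + β • e', ?_⟩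
    obtain rfl : β = 1 - α := by linarith
    ext k
    simp
    ring
  have hst : Disjoint s t := by
    rw [Set.disjoint_left]
    rintro _ ha ⟨e, rfl⟩
    exact h ⟨e, fun k => by simpa using ha k⟩
  obtain ⟨f, u, hfs, hft⟩ := geometric_hahn_banach_open hs hso ht hst
  let y : κ → ℝ := fun k => f (Pi.single k 1)
  have hf : ∀ a, f a = a ⬝ᵥ y := fun a => by
    conv_lhs => rw [← Finset.univ_sum_single a]
    rw [map_sum, dotProduct]
    refine Finset.sum_congr rfl fun k _ => ?_
    have : (Pi.single k (a k) : κ → ℝ) = a k • Pi.single k 1 := by simp [← Pi.single_smul]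
    rw [this, map_smul, smul_eq_mul]
  have hu : 0 ≤ u := by
    have hc : Tendsto (fun ε : ℝ => f (fun _ => -ε)) (𝓝[>] 0) (𝓝 0) := by
      have : Continuous fun ε : ℝ => f (fun _ => -ε) := by fun_prop
      have := (this.tendsto 0).mono_left (nhdsWithin_le_nhds (s := Ioi 0))
      simpa [show (fun _ : κ => (0 : ℝ)) = 0 from rfl] using this
    refine le_of_tendsto hc ?_
    filter_upwards [self_mem_nhdsWithin] with ε hε
    exact (hfs _ fun _ => by simpa using hε).le
  have hlin : ∀ e, L e ⬝ᵥ y = 0 := fun e => by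
    by_contra hne
    -- The multiple of `e` is chosen so that the functional takes the value `u - 1` at a point of
    -- `t`, below its bound `u` there.
    have := hft _ ⟨((u + b ⬝ᵥ y - 1) / (L e ⬝ᵥ y)) • e, rfl⟩
    rw [hf] at this
    simp only [map_smul, sub_dotProduct, smul_dotProduct, smul_eq_mul, div_mul_cancel₀ _ hne] at this
    linarith
  refine ⟨y, fun k => ?_, fun hy => ?_, hlin, ?_⟩
  · by_contra! hk
    -- a large multiple of the negative coordinate direction violates the bound
    have h1 : ∀ r : ℝ, 0 < r → r * (-y k) - ∑ j, y j < u := fun r hr => by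
      have := hfs (-1 - Pi.single k r) fun j => by
        by_cases hj : j = k
        · subst hj
          simp only [Pi.sub_apply, Pi.neg_apply, Pi.one_apply, Pi.single_eq_same]
          linarith
        · simp [hj]
      rw [hf, sub_dotProduct, neg_dotProduct, one_dotProduct, single_dotProduct] at this
      linarith
    have hk' : 0 < -y k := by linarith
    have h2 := h1 ((|u + ∑ j, y j| + 1) / (-y k)) (div_pos (by positivity) hk')
    rw [div_mul_cancel₀ _ hk'.ne'] at h2
    linarith [le_abs_self (u + ∑ j, y j)]
  · have h1 := hfs (fun _ => -1) fun _ => by norm_num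
    have h2 := hft _ ⟨0, rfl⟩
    rw [hf, hy, dotProduct_zero] at h1
    rw [hf, hy, dotProduct_zero] at h2
    linarith
  · have := hft _ ⟨0, rfl⟩
    rw [hf] at this
    simp only [map_zero, zero_sub, neg_dotProduct] at this
    linarith

/-! ### Metzler matrices with a strictly decaying left vector -/

section Metzler

variable {ι : Type*} [Fintype ι]

theorem diag_neg_of_vecMul_neg [DecidableEq ι] {P : Matrix ι ι ℝ} (hP : ∀ i j, i ≠ j → 0 ≤ P i j) {l : ι → ℝ}
    (hl : ∀ i, 0 < l i) (hlP : ∀ i, (l ᵥ* P) i < 0) (i : ι) : P i i < 0 := by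
  have h := hlP i
  rw [vecMul, dotProduct, ← Finset.add_sum_erase _ _ (Finset.mem_univ i)] at h
  have : 0 ≤ ∑ j ∈ Finset.univ.erase i, l j * P j i :=
    Finset.sum_nonneg fun j hj => mul_nonneg (hl j).le (hP j i (Finset.ne_of_mem_erase hj))
  by_contra! h'
  nlinarith [mul_nonneg (hl i).le h']

/-- The pairing `l ⬝ᵥ (P *ᵥ y)` is nonnegative when computed from the right, and a sum of
nonpositive terms `(l ᵥ* P) i * y i` when computed from the left. -/
theorem eq_zero_of_mulVec_nonneg {P : Matrix ι ι ℝ} {l : ι → ℝ} (hl : ∀ i, 0 ≤ l i)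
    (hlP : ∀ i, (l ᵥ* P) i < 0) {y : ι → ℝ} (hy : ∀ i, 0 ≤ y i) (hPy : ∀ i, 0 ≤ (P *ᵥ y) i) :
    y = 0 := by
  have h1 : 0 ≤ l ⬝ᵥ (P *ᵥ y) := Finset.sum_nonneg fun i _ => mul_nonneg (hl i) (hPy i)
  rw [dotProduct_mulVec] at h1
  have h2 : ∀ i ∈ Finset.univ, (l ᵥ* P) i * y i ≤ 0 := fun i _ =>
    mul_nonpos_of_nonpos_of_nonneg (hlP i).le (hy i)
  have h3 := (Finset.sum_eq_zero_iff_of_nonpos h2).1 (le_antisymm (Finset.sum_nonpos h2) h1)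
  ext i
  exact (mul_eq_zero.1 (h3 i (Finset.mem_univ i))).resolve_left (hlP i).ne

/-- A Metzler matrix with a positive left vector `l P < 0` has a positive right vector `P y = -1`. -/
theorem exists_pos_mulVec_eq_neg_one [DecidableEq ι] {P : Matrix ι ι ℝ} (hP : ∀ i j, i ≠ j → 0 ≤ P i j)
    {l : ι → ℝ} (hl : ∀ i, 0 < l i) (hlP : ∀ i, (l ᵥ* P) i < 0) :
    ∃ y : ι → ℝ, (∀ i, 0 < y i) ∧ ∀ i, (P *ᵥ y) i = -1 := by
  have hd := diag_neg_of_vecMul_neg hP hl hlP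
  -- nonnegativity of supersolutions
  have key : ∀ y : ι → ℝ, (∀ i, (P *ᵥ y) i ≤ 0) → ∀ i, 0 ≤ y i := fun y hy => by
    -- The negative part of a supersolution is a nonnegative subsolution, by the Metzler sign
    -- pattern, and hence vanishes.
    have h0 : (fun i => max (-y i) 0) = 0 := by
      refine eq_zero_of_mulVec_nonneg (fun i => (hl i).le) hlP (fun i => le_max_right _ _) fun i => ?_
      rcases le_total (y i) 0 with hi | hi
      · have h1 := hy i
        have h2 : -(P *ᵥ y) i ≤ (P *ᵥ fun i => max (-y i) 0) i := by
          rw [mulVec, dotProduct, mulVec, dotProduct, ← Finset.sum_neg_distrib]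
          refine Finset.sum_le_sum fun j _ => ?_
          by_cases hij : i = j
          · subst hij; rw [max_eq_left (by linarith)]; linarith
          · nlinarith [hP i j hij, le_max_left (-y j) 0]
        linarith
      · refine Finset.sum_nonneg fun j _ => ?_
        by_cases hij : i = j
        · subst hij; simp [hi]
        · exact mul_nonneg (hP i j hij) (le_max_right _ _)
    intro i
    have := congrFun h0 i
    simp only [Pi.zero_apply, max_eq_right_iff] at this
    linarith
  have hinj : Function.Injective P.mulVec := by
    intro a b hab
    have h1 := key (a - b) fun i => by simp [mulVec_sub, hab]
    have h2 := key (b - a) fun i => by simp [mulVec_sub, hab]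
    ext i
    have := h1 i; have := h2 i; simp at *; linarith
  have hsurj : Function.Surjective P.mulVec :=
    LinearMap.surjective_of_injective (f := P.mulVecLin) hinj
  obtain ⟨y, hy⟩ := hsurj fun _ => -1
  have hy' : ∀ i, (P *ᵥ y) i = -1 := fun i => congrFun hy i
  have h0 := key y fun i => by rw [hy']; norm_num
  -- At a zero entry of `y` only nonnegative off-diagonal terms would remain in a row whose value is
  -- `-1`.
  refine ⟨y, fun i => ?_, hy'⟩
  have h := hy' i
  rw [mulVec, dotProduct, ← Finset.add_sum_erase _ _ (Finset.mem_univ i)] at h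
  have : 0 ≤ ∑ j ∈ Finset.univ.erase i, P i j * y j :=
    Finset.sum_nonneg fun j hj => mul_nonneg (hP i j (Finset.ne_of_mem_erase hj).symm) (h0 j)
  refine lt_of_le_of_ne (h0 i) fun h' => ?_
  rw [← h'] at h
  linarith

end Metzler

/-! ### Contraction with a matrix of constants, and positive parts of primitives -/

/-- A fixed point theorem on a product of Banach spaces, with a nonnegative matrix of Lipschitz
constants that contracts a positive vector. -/
theorem exists_fixedPoint_of_lipschitz_matrix {ι B : Type*} [Fintype ι] [NormedAddCommGroup B]
    [CompleteSpace B] (T : (ι → B) → ι → B) (M : Matrix ι ι ℝ) (hM : ∀ i j, 0 ≤ M i j)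
    (hT : ∀ y y' i, ‖T y i - T y' i‖ ≤ ∑ j, M i j * ‖y j - y' j‖) (v : ι → ℝ) (hv : ∀ i, 0 < v i)
    (hMv : ∀ i, (M *ᵥ v) i < v i) : ∃ y, T y = y := by
  -- `r` is the contraction factor for the weighted maximum norm `max ‖y i‖ / v i`.
  obtain ⟨r, hr0, hr1, hr⟩ : ∃ r : ℝ, 0 ≤ r ∧ r < 1 ∧ ∀ i, (M *ᵥ v) i ≤ r * v i := by
    rcases isEmpty_or_nonempty ι with hι | hι
    · exact ⟨0, le_rfl, one_pos, fun i => isEmptyElim i⟩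
    obtain ⟨i₀, hi₀⟩ := Finite.exists_max fun i => (M *ᵥ v) i / v i
    refine ⟨(M *ᵥ v) i₀ / v i₀, div_nonneg (Finset.sum_nonneg fun j _ =>
      mul_nonneg (hM _ _) (hv j).le) (hv _).le, (div_lt_one (hv _)).2 (hMv _), fun i => ?_⟩
    rw [← div_le_iff₀ (hv i)]
    exact hi₀ i
  obtain ⟨c, hc0, hc⟩ : ∃ c : ℝ, 0 ≤ c ∧ ∀ i, ‖T 0 i - (0 : ι → B) i‖ ≤ c * v i := by
    refine ⟨∑ i, ‖T 0 i - (0 : ι → B) i‖ / v i, Finset.sum_nonneg fun i _ =>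
      div_nonneg (norm_nonneg _) (hv i).le, fun i => ?_⟩
    rw [← div_le_iff₀ (hv i)]
    exact Finset.single_le_sum (f := fun i => ‖T 0 i - (0 : ι → B) i‖ / v i)
      (fun i _ => div_nonneg (norm_nonneg _) (hv i).le) (Finset.mem_univ i)
  let Y : ℕ → ι → B := fun k => T^[k] 0
  have hY : ∀ k, Y (k + 1) = T (Y k) := fun k => Function.iterate_succ_apply' T k 0
  have hdist : ∀ k i, ‖Y (k + 1) i - Y k i‖ ≤ c * r ^ k * v i := fun k => by
    induction k with
    | zero => intro i; simpa [hY, Y] using hc i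
    | succ k ih =>
      intro i
      calc ‖Y (k + 1 + 1) i - Y (k + 1) i‖ = ‖T (Y (k + 1)) i - T (Y k) i‖ := by rw [hY (k + 1), hY k]
        _ ≤ ∑ j, M i j * ‖Y (k + 1) j - Y k j‖ := hT _ _ _
        _ ≤ ∑ j, M i j * (c * r ^ k * v j) :=
          Finset.sum_le_sum fun j _ => mul_le_mul_of_nonneg_left (ih j) (hM i j)
        _ = c * r ^ k * (M *ᵥ v) i := by
          rw [mulVec, dotProduct, Finset.mul_sum]
          exact Finset.sum_congr rfl fun j _ => by ring
        _ ≤ c * r ^ k * (r * v i) := mul_le_mul_of_nonneg_left (hr i) (by positivity)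
        _ = _ := by ring
  have hlim : ∀ i, ∃ a, Tendsto (fun k => Y k i) atTop (𝓝 a) := fun i =>
    cauchySeq_tendsto_of_complete <| cauchySeq_of_le_geometric r (c * v i) hr1 fun k => by
      rw [dist_comm, dist_eq_norm]
      exact (hdist k i).trans (le_of_eq (mul_right_comm _ _ _))
  choose y hy using hlim
  refine ⟨y, funext fun i => ?_⟩
  have h1 : Tendsto (fun k => Y (k + 1) i) atTop (𝓝 (y i)) := (tendsto_add_atTop_iff_nat 1).2 (hy i)
  refine tendsto_nhds_unique ?_ h1
  rw [tendsto_iff_norm_sub_tendsto_zero]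
  have h2 : Tendsto (fun k => ∑ j, M i j * ‖Y k j - y j‖) atTop (𝓝 0) := by
    have := tendsto_finsetSum Finset.univ fun j (_ : j ∈ Finset.univ) =>
      (tendsto_iff_norm_sub_tendsto_zero.1 (hy j)).const_mul (M i j)
    simpa using this
  refine squeeze_zero (fun _ => norm_nonneg _) (fun k => ?_) h2
  rw [hY]
  exact hT _ _ _

theorem AbsolutelyContinuousOnInterval.max_zero {f : ℝ → ℝ} {a b : ℝ}
    (hf : AbsolutelyContinuousOnInterval f a b) :
    AbsolutelyContinuousOnInterval (fun t => max (f t) 0) a b := by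
  rw [absolutelyContinuousOnInterval_iff] at hf ⊢
  intro ε hε
  obtain ⟨δ, hδ, h⟩ := hf ε hε
  refine ⟨δ, hδ, fun E hE hE' => (Finset.sum_le_sum fun i _ => ?_).trans_lt (h E hE hE')⟩
  simp only [Real.dist_eq]
  exact abs_max_sub_max_le_abs _ _ _

/-- The chain rule for the positive part of an absolutely continuous function. -/
theorem max_zero_eq_add_integral {f y : ℝ → ℝ} {a b : ℝ} (hab : a ≤ b)
    (hf : IntervalIntegrable f volume a b) (hy : ∀ t ∈ Icc a b, y t = y a + ∫ s in a..t, f s) :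
    IntervalIntegrable (fun s => if 0 < y s then f s else 0) volume a b ∧
      max (y b) 0 = max (y a) 0 + ∫ s in a..b, if 0 < y s then f s else 0 := by
  let Y : ℝ → ℝ := fun t => y a + ∫ s in a..t, f s
  have hYac : AbsolutelyContinuousOnInterval Y a b := by
    have h1 := hf.absolutelyContinuousOnInterval_intervalIntegral (c := a) (by simp)
    have h2 : AbsolutelyContinuousOnInterval (fun _ : ℝ => y a) a b := by
      rw [absolutelyContinuousOnInterval_iff]
      exact fun ε hε => ⟨1, one_pos, fun _ _ _ => by simpa using hε⟩
    exact h2.add h1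
  have hP := hYac.max_zero
  have hderiv : ∀ᵐ t, t ∈ Ioc a b →
      deriv (fun t => max (Y t) 0) t = if 0 < y t then f t else 0 := by
    have hb : ∀ᵐ t : ℝ, t ≠ b := by simp [ae_iff, measure_singleton]
    filter_upwards [hf.ae_hasDerivAt_integral, hP.ae_differentiableAt, hb] with t h1 h2 htb ht
    have htI : t ∈ Icc a b := Ioc_subset_Icc_self ht
    have htu : t ∈ uIcc a b := by rwa [uIcc_of_le hab]
    have hYd : HasDerivAt Y (f t) t := (h1 htu a (by simp)).const_add (y a)
    have hYt : Y t = y t := (hy t htI).symm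
    by_cases hpos : 0 < y t
    · rw [if_pos hpos]
      have hev : (fun t => max (Y t) 0) =ᶠ[𝓝 t] Y := by
        have : ∀ᶠ s in 𝓝 t, 0 < Y s :=
          hYd.continuousAt.eventually (lt_mem_nhds (by rwa [hYt]))
        filter_upwards [this] with s hs using max_eq_left hs.le
      rw [hev.deriv_eq, hYd.deriv]
    · rw [if_neg hpos]
      -- Where `y ≤ 0` the positive part attains its minimum `0`, so its derivative vanishes,
      -- whatever `f` is there.
      refine IsLocalMin.deriv_eq_zero (Eventually.of_forall fun s => ?_)
      change max (Y t) 0 ≤ max (Y s) 0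
      rw [hYt, max_eq_right (not_lt.1 hpos)]
      exact le_max_right _ _
  have hae : ∀ᵐ t ∂volume.restrict (Ioc a b),
      deriv (fun t => max (Y t) 0) t = if 0 < y t then f t else 0 :=
    (ae_restrict_iff' measurableSet_Ioc).2 hderiv
  constructor
  · refine hP.intervalIntegrable_deriv.congr_ae ?_
    rwa [uIoc_of_le hab]
  · have h := hP.integral_deriv_eq_sub
    rw [intervalIntegral.integral_of_le hab, integral_congr_ae hae,
      ← intervalIntegral.integral_of_le hab] at h
    rw [h]
    simp only [Y, intervalIntegral.integral_same, add_zero, ← hy b ⟨hab, le_rfl⟩]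
    ring

/-! ### Causal convolution with finite measures -/

/-- The convolution with a measure carried by `[0, ∞)`, of the restriction of a signal to
`[0, ∞)`. -/
noncomputable def causalConv (μ : Measure ℝ) (f : ℝ → ℝ) (t : ℝ) : ℝ :=
  ∫ θ in Iic t, f (t - θ) ∂μ

theorem causalConv_eq_integral_indicator (μ : Measure ℝ) (f : ℝ → ℝ) (t : ℝ) :
    causalConv μ f t = ∫ θ, (Ici 0).indicator f (t - θ) ∂μ := by
  rw [causalConv, ← integral_indicator measurableSet_Iic]
  congr 1
  ext θ
  simp only [indicator, mem_Iic, mem_Ici, sub_nonneg]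

theorem causalConv_nonneg {μ : Measure ℝ} {f : ℝ → ℝ} (hf : ∀ t, 0 ≤ f t) (t : ℝ) : 0 ≤ causalConv μ f t :=
  integral_nonneg fun _ => hf _

theorem ae_nonneg_of_causal {μ : Measure ℝ} (hμ : μ (Iio 0) = 0) : ∀ᵐ θ ∂μ, 0 ≤ θ := by
  rw [ae_iff]
  simpa [Iio] using hμ

section Convolution

variable {μ : Measure ℝ} [IsFiniteMeasure μ]

theorem integrable_comp_sub_prod {g : ℝ → ℝ} (hg : Integrable g) :
    Integrable (fun p : ℝ × ℝ => g (p.1 - p.2)) (volume.prod μ) :=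
  (measurePreserving_sub_prod volume μ).integrable_comp_of_integrable
    (g := fun p : ℝ × ℝ => g p.1) (hg.comp_fst μ)

theorem integrable_integral_comp_sub {g : ℝ → ℝ} (hg : Integrable g) :
    Integrable fun t => ∫ θ, g (t - θ) ∂μ :=
  (integrable_comp_sub_prod hg).integral_prod_left

theorem ae_integrable_comp_sub {g : ℝ → ℝ} (hg : Integrable g) :
    ∀ᵐ t, Integrable (fun θ => g (t - θ)) μ :=
  (integrable_comp_sub_prod hg).prod_right_ae

theorem integral_integral_comp_sub {g : ℝ → ℝ} (hg : Integrable g) :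
    ∫ t, ∫ θ, g (t - θ) ∂μ = μ.real univ * ∫ t, g t := by
  rw [integral_integral_swap (integrable_comp_sub_prod (μ := μ) hg)]
  simp [integral_sub_right_eq_self g]

theorem ae_comp_sub_eq {g g' : ℝ → ℝ} (h : g =ᵐ[volume] g') :
    ∀ᵐ t, ∀ᵐ θ ∂μ, g (t - θ) = g' (t - θ) :=
  Measure.ae_ae_of_ae_prod ((quasiMeasurePreserving_sub_of_right_invariant volume μ).ae h)

/-- By causality the values after `T` are irrelevant up to time `T`. Cutting off there makes a
locally integrable signal integrable, so that Fubini's theorem applies. -/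
theorem ae_comp_sub_eq_indicator {μ : Measure ℝ} (hμ : μ (Iio 0) = 0) (f : ℝ → ℝ) {T t : ℝ} (ht : t ≤ T) :
    ∀ᵐ θ ∂μ, (Ici 0).indicator f (t - θ) = (Icc 0 T).indicator f (t - θ) := by
  filter_upwards [ae_nonneg_of_causal hμ] with θ hθ
  have : t - θ ≤ T := by linarith
  simp [indicator, this]

theorem MeasureTheory.LocallyIntegrableOn.integrableOn_Icc {E : Type*} [NormedAddCommGroup E] {f : ℝ → E}
    (hf : LocallyIntegrableOn f (Ici 0)) (T : ℝ) : IntegrableOn f (Icc 0 T) :=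
  hf.integrableOn_compact_subset Icc_subset_Ici_self isCompact_Icc

theorem MeasureTheory.LocallyIntegrableOn.intervalIntegrable {E : Type*} [NormedAddCommGroup E] {f : ℝ → E}
    (hf : LocallyIntegrableOn f (Ici 0)) {a b : ℝ} (ha : 0 ≤ a) (hab : a ≤ b) :
    IntervalIntegrable f volume a b :=
  (intervalIntegrable_iff_integrableOn_Icc_of_le hab).2 <|
    hf.integrableOn_compact_subset (fun _ h => ha.trans h.1) isCompact_Icc

theorem ae_restrict_Ici_of_forall_le {P : ℝ → Prop} (h : ∀ T : ℝ, ∀ᵐ t, t ≤ T → 0 ≤ t → P t) :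
    ∀ᵐ t ∂volume.restrict (Ici (0 : ℝ)), P t := by
  rw [ae_restrict_iff' measurableSet_Ici]
  filter_upwards [ae_all_iff.2 fun k : ℕ => h k] with t ht ht0
  obtain ⟨k, hk⟩ := exists_nat_ge t
  exact ht k hk ht0

theorem ae_integrableOn_causal (hμ : μ (Iio 0) = 0) {f : ℝ → ℝ}
    (hf : LocallyIntegrableOn f (Ici 0)) :
    ∀ᵐ t ∂volume.restrict (Ici (0 : ℝ)), IntegrableOn (fun θ => f (t - θ)) (Iic t) μ := by
  refine ae_restrict_Ici_of_forall_le fun T => ?_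
  have hg : Integrable ((Icc 0 T).indicator f) :=
    (hf.integrableOn_Icc T).integrable_indicator measurableSet_Icc
  filter_upwards [ae_integrable_comp_sub (μ := μ) hg] with t ht htT _
  rw [← integrable_indicator_iff measurableSet_Iic]
  refine ht.congr ?_
  filter_upwards [ae_comp_sub_eq_indicator hμ f htT] with θ hθ
  rw [← hθ]
  simp only [indicator, mem_Iic, mem_Ici, sub_nonneg]

theorem causalConv_eq_of_le {μ : Measure ℝ} (hμ : μ (Iio 0) = 0) (f : ℝ → ℝ) {T t : ℝ} (ht : t ≤ T) :
    causalConv μ f t = ∫ θ, (Icc 0 T).indicator f (t - θ) ∂μ := by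
  rw [causalConv_eq_integral_indicator]
  exact integral_congr_ae (ae_comp_sub_eq_indicator hμ f ht)

theorem locallyIntegrableOn_causalConv (hμ : μ (Iio 0) = 0) {f : ℝ → ℝ}
    (hf : LocallyIntegrableOn f (Ici 0)) : LocallyIntegrableOn (causalConv μ f) (Ici 0) := by
  rw [locallyIntegrableOn_iff isClosed_Ici.isLocallyClosed]
  intro k hk hkc
  obtain ⟨T, hT⟩ := hkc.bddAbove
  have hg : Integrable ((Icc 0 T).indicator f) :=
    (hf.integrableOn_Icc T).integrable_indicator measurableSet_Icc
  refine (integrable_integral_comp_sub (μ := μ) hg).integrableOn.congr_fun (fun t ht => ?_)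
    hkc.measurableSet
  exact (causalConv_eq_of_le hμ f (hT ht)).symm

/-- The `L₁`-bound for causal convolutions on a finite horizon. -/
theorem integral_causalConv_le (hμ : μ (Iio 0) = 0) {f : ℝ → ℝ}
    (hf : LocallyIntegrableOn f (Ici 0)) (hf0 : ∀ t, 0 ≤ f t) {T : ℝ} (hT : 0 ≤ T) :
    ∫ t in (0 : ℝ)..T, causalConv μ f t ≤ μ.real univ * ∫ t in (0 : ℝ)..T, f t := by
  have hg : Integrable ((Icc 0 T).indicator f) :=
    (hf.integrableOn_Icc T).integrable_indicator measurableSet_Icc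
  -- Over the whole line Fubini's theorem gives an equality for the truncated signal; discarding the
  -- times outside `[0, T]` leaves the inequality.
  have h1 := integral_integral_comp_sub (μ := μ) hg
  rw [integral_indicator measurableSet_Icc, integral_Icc_eq_integral_Ioc,
    ← intervalIntegral.integral_of_le hT] at h1
  rw [← h1, intervalIntegral.integral_of_le hT,
    setIntegral_congr_fun measurableSet_Ioc fun t ht => causalConv_eq_of_le hμ f ht.2]
  exact setIntegral_le_integral (integrable_integral_comp_sub hg) <|
    Eventually.of_forall fun t => integral_nonneg fun θ => indicator_nonneg (fun s _ => hf0 s) _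

/-- Convolution of a signal with a bounded measurable past. -/
theorem ae_integrable_of_past (hμ : μ (Iio 0) = 0) {f : ℝ → ℝ}
    (hf : LocallyIntegrableOn f (Ici 0)) {h : ℝ → ℝ} (hh : Measurable h) {M : ℝ}
    (hM : ∀ t < 0, |h t| ≤ M) (hfh : ∀ t < 0, f t = h t) :
    ∀ᵐ t ∂volume.restrict (Ici (0 : ℝ)), IntegrableOn (fun θ => f (t - θ)) (Iic t) μ ∧
      IntegrableOn (fun θ => f (t - θ)) (Ioi t) μ ∧ Integrable (fun θ => f (t - θ)) μ ∧
      ∫ θ, f (t - θ) ∂μ = causalConv μ f t + ∫ θ in Ioi t, h (t - θ) ∂μ := by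
  filter_upwards [ae_integrableOn_causal hμ hf] with t ht
  have heq : EqOn (fun θ => h (t - θ)) (fun θ => f (t - θ)) (Ioi t) := fun θ hθ =>
    (hfh _ (by simpa using hθ)).symm
  have h2 : IntegrableOn (fun θ => f (t - θ)) (Ioi t) μ := by
    refine IntegrableOn.congr_fun ?_ heq measurableSet_Ioi
    refine Measure.integrableOn_of_bounded (M := M) (measure_ne_top _ _)
      (hh.comp (measurable_const.sub measurable_id)).aestronglyMeasurable ?_
    filter_upwards [ae_restrict_mem measurableSet_Ioi] with θ hθ
    exact hM _ (by simpa using hθ)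
  have h3 : Integrable (fun θ => f (t - θ)) μ := by
    rw [← integrableOn_univ, ← Iic_union_Ioi (a := t)]
    exact ht.union h2
  refine ⟨ht, h2, h3, ?_⟩
  rw [setIntegral_congr_fun measurableSet_Ioi heq, causalConv, ← compl_Iic,
    integral_add_compl measurableSet_Iic h3]

end Convolution

/-! ### Local integrability of vector signals -/

section Signals

variable {a b : ℕ} {s : Set ℝ}

theorem MeasureTheory.LocallyIntegrableOn.clm_comp {E F : Type*} [NormedAddCommGroup E]
    [NormedSpace ℝ E] [NormedAddCommGroup F] [NormedSpace ℝ F] {f : ℝ → E}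
    (hf : LocallyIntegrableOn f s) (L : E →L[ℝ] F) :
    LocallyIntegrableOn (fun t => L (f t)) s := fun t ht => by
  obtain ⟨u, hu, h⟩ := hf t ht
  exact ⟨u, hu, L.integrable_comp h⟩

theorem MeasureTheory.LocallyIntegrableOn.eval {f : ℝ → Fin a → ℝ}
    (hf : LocallyIntegrableOn f s) (i : Fin a) : LocallyIntegrableOn (fun t => f t i) s :=
  hf.clm_comp (ContinuousLinearMap.proj (R := ℝ) (φ := fun _ : Fin a => ℝ) i)

theorem MeasureTheory.LocallyIntegrableOn.mulVec {f : ℝ → Fin a → ℝ}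
    (hf : LocallyIntegrableOn f s) (M : Matrix (Fin b) (Fin a) ℝ) :
    LocallyIntegrableOn (fun t => M *ᵥ f t) s :=
  hf.clm_comp (LinearMap.toContinuousLinearMap M.mulVecLin)

theorem MeasureTheory.LocallyIntegrableOn.of_eval (hs : IsClosed s) {f : ℝ → Fin a → ℝ}
    (hf : ∀ i, LocallyIntegrableOn (fun t => f t i) s) : LocallyIntegrableOn f s := by
  rw [locallyIntegrableOn_iff hs.isLocallyClosed]
  intro k hk hkc
  exact Integrable.of_eval fun i => (hf i).integrableOn_compact_subset hk hkc

theorem MeasureTheory.LocallyIntegrableOn.max_zero {f : ℝ → ℝ}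
    (hf : LocallyIntegrableOn f s) : LocallyIntegrableOn (fun t => max (f t) 0) s :=
  fun t ht => by
    obtain ⟨u, hu, h⟩ := hf t ht
    exact ⟨u, hu, h.pos_part⟩

theorem MeasureTheory.LocallyIntegrableOn.abs {f : ℝ → ℝ}
    (hf : LocallyIntegrableOn f s) : LocallyIntegrableOn (fun t => |f t|) s :=
  fun t ht => by
    obtain ⟨u, hu, h⟩ := hf t ht
    exact ⟨u, hu, Integrable.abs h⟩

theorem locallyIntegrableOn_Ici_const {E : Type*} [NormedAddCommGroup E] (c : E) :
    LocallyIntegrableOn (fun _ : ℝ => c) (Ici 0) :=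
  continuousOn_const.locallyIntegrableOn measurableSet_Ici

theorem MeasureTheory.LocallyIntegrableOn.finsetSum {ι : Type*} (u : Finset ι) {f : ι → ℝ → ℝ}
    (hf : ∀ i, LocallyIntegrableOn (f i) (Ici 0)) :
    LocallyIntegrableOn (fun t => ∑ i ∈ u, f i t) (Ici 0) := by
  classical
  induction u using Finset.induction_on with
  | empty => simpa using locallyIntegrableOn_Ici_const (0 : ℝ)
  | insert i u hi ih =>
    simp only [Finset.sum_insert hi]
    exact (hf i).add ih

theorem integral_dotProduct {f : ℝ → Fin a → ℝ} (hf : LocallyIntegrableOn f (Ici 0))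
    (c : Fin a → ℝ) {t : ℝ} (ht : 0 ≤ t) :
    ∫ s in (0 : ℝ)..t, c ⬝ᵥ f s = c ⬝ᵥ fun i => ∫ s in (0 : ℝ)..t, f s i := by
  simp only [dotProduct]
  rw [intervalIntegral.integral_finsetSum fun i _ =>
    ((hf.eval i).intervalIntegrable le_rfl ht).const_mul _]
  simp

theorem intervalIntegrable_dotProduct {f : ℝ → Fin a → ℝ} (hf : LocallyIntegrableOn f (Ici 0))
    (c : Fin a → ℝ) {t : ℝ} (ht : 0 ≤ t) :
    IntervalIntegrable (fun s => c ⬝ᵥ f s) volume 0 t := by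
  have := IntervalIntegrable.sum Finset.univ fun i _ =>
    ((hf.eval i).intervalIntegrable le_rfl ht).const_mul (c i)
  exact this.congr fun s _ => by simp [dotProduct]

theorem integral_eval {f : ℝ → Fin a → ℝ} {u t : ℝ} (hf : IntervalIntegrable f volume u t)
    (i : Fin a) : (∫ s in u..t, f s) i = ∫ s in u..t, f s i :=
  ((ContinuousLinearMap.proj (R := ℝ) (φ := fun _ : Fin a => ℝ) i).intervalIntegral_comp_comm
    hf).symm

end Signals

/-! ### Monotonicity of nonnegative and Metzler matrices -/

theorem dotProduct_le_dotProduct {ι : Type*} [Fintype ι] {c a b : ι → ℝ} (hc : ∀ i, 0 ≤ c i)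
    (h : ∀ i, a i ≤ b i) : c ⬝ᵥ a ≤ c ⬝ᵥ b :=
  Finset.sum_le_sum fun i _ => mul_le_mul_of_nonneg_left (h i) (hc i)

theorem mulVec_mono {m n : ℕ} {M : Matrix (Fin m) (Fin n) ℝ} (hM : EntrywiseNonneg M)
    {a b : Fin n → ℝ} (h : ∀ i, a i ≤ b i) (i : Fin m) : (M *ᵥ a) i ≤ (M *ᵥ b) i :=
  dotProduct_le_dotProduct (hM i) h

theorem mulVec_nonneg' {m n : ℕ} {M : Matrix (Fin m) (Fin n) ℝ} (hM : EntrywiseNonneg M)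
    {a : Fin n → ℝ} (h : ∀ i, 0 ≤ a i) (i : Fin m) : 0 ≤ (M *ᵥ a) i :=
  dotProduct_nonneg_of_nonneg (hM i) h

theorem vecMul_nonneg' {m n : ℕ} {M : Matrix (Fin m) (Fin n) ℝ} (hM : EntrywiseNonneg M)
    {a : Fin m → ℝ} (h : ∀ i, 0 ≤ a i) (j : Fin n) : 0 ≤ (a ᵥ* M) j :=
  dotProduct_nonneg_of_nonneg h fun i => hM i j

/-- The diagonal entry of `A` has no sign, so monotonicity of row `i` needs equality in component
`i`; at a contact point this is what comparison arguments provide. -/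
theorem IsMetzler.mulVec_le {n : ℕ} {A : Matrix (Fin n) (Fin n) ℝ} (hA : IsMetzler A)
    {a b : Fin n → ℝ} (h : ∀ j, a j ≤ b j) {i : Fin n} (hi : a i = b i) :
    (A *ᵥ a) i ≤ (A *ᵥ b) i := by
  change ∑ j, A i j * a j ≤ ∑ j, A i j * b j
  refine Finset.sum_le_sum fun j _ => ?_
  by_cases hij : i = j
  · subst hij; rw [hi]
  · exact mul_le_mul_of_nonneg_left (h j) (hA i j hij)

theorem PositiveLTI.HasStaticGain.real_univ {n₀ : ℕ} {Δ : PositiveLTI n₀}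
    {Δ₀ : Matrix (Fin n₀) (Fin n₀) ℝ} (h : Δ.HasStaticGain Δ₀) (i j : Fin n₀) :
    (Δ.kernel i j).real univ = Δ₀ i j := by
  have := congrFun (congrFun h i) j
  simpa [PositiveLTI.transfer] using this

/-! ### Weighted balance and comparison with zero -/

section Balance

variable {n n₀ p q : ℕ} {S : LFR n n₀ p q} {Δ : PositiveLTI n₀}
  {Δ₀ : Matrix (Fin n₀) (Fin n₀) ℝ}

/-- The integral balance of weighted `L₁`-norms of nonnegative signals satisfying the inequalities
of the interconnection. -/
theorem LFR.balance (hΔ : Δ.HasStaticGain Δ₀)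
    {ξ : ℝ → Fin n → ℝ} {ω ζ : ℝ → Fin n₀ → ℝ} {η : ℝ → Fin p → ℝ} {T : ℝ}
    (hξi : LocallyIntegrableOn ξ (Ici 0)) (hωi : LocallyIntegrableOn ω (Ici 0))
    (hζi : LocallyIntegrableOn ζ (Ici 0)) (hηi : LocallyIntegrableOn η (Ici 0))
    (hζ0 : ∀ t i, 0 ≤ ζ t i)
    (hξ : ∀ t ∈ Icc 0 T, ∀ i, ξ t i ≤
      ∫ s in (0 : ℝ)..t, (S.A *ᵥ ξ s + S.E₀ *ᵥ ω s + S.E₁ *ᵥ η s) i)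
    (hζ : ∀ᵐ t ∂volume.restrict (Ici (0 : ℝ)), t ≤ T →
      ∀ i, ζ t i ≤ (S.C₀ *ᵥ ξ t + S.F₀₀ *ᵥ ω t + S.F₀₁ *ᵥ η t) i)
    (hω : ∀ᵐ t ∂volume.restrict (Ici (0 : ℝ)), t ≤ T →
      ∀ i, ω t i ≤ ∑ j, causalConv (Δ.kernel i j) (fun s => ζ s j) t)
    {l : Fin n → ℝ} {ψ : Fin n₀ → ℝ} (hl : ∀ i, 0 ≤ l i) (hψ : ∀ i, 0 ≤ ψ i)
    {t : ℝ} (ht : t ∈ Icc 0 T) :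
    l ⬝ᵥ ξ t + ∫ s in (0 : ℝ)..t, ψ ⬝ᵥ ω s ≤
      ∫ s in (0 : ℝ)..t, (l ⬝ᵥ (S.A *ᵥ ξ s + S.E₀ *ᵥ ω s + S.E₁ *ᵥ η s) +
        ψ ⬝ᵥ (Δ₀ *ᵥ (S.C₀ *ᵥ ξ s + S.F₀₀ *ᵥ ω s + S.F₀₁ *ᵥ η s))) := by
  have hf : LocallyIntegrableOn (fun s => S.A *ᵥ ξ s + S.E₀ *ᵥ ω s + S.E₁ *ᵥ η s) (Ici 0) :=
    ((hξi.mulVec _).add (hωi.mulVec _)).add (hηi.mulVec _)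
  have hg : LocallyIntegrableOn (fun s => S.C₀ *ᵥ ξ s + S.F₀₀ *ᵥ ω s + S.F₀₁ *ᵥ η s) (Ici 0) :=
    ((hξi.mulVec _).add (hωi.mulVec _)).add (hηi.mulVec _)
  have haeT : ∀ {P : ℝ → Prop}, (∀ᵐ t ∂volume.restrict (Ici (0 : ℝ)), t ≤ T → P t) →
      ∀ᵐ s, s ∈ Icc 0 t → P s := fun h => by
    rw [ae_restrict_iff' measurableSet_Ici] at h
    filter_upwards [h] with s hs hst using hs hst.1 (hst.2.trans ht.2)
  have hmono : ∀ {f g : ℝ → ℝ}, LocallyIntegrableOn f (Ici 0) → LocallyIntegrableOn g (Ici 0) →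
      (∀ᵐ s, s ∈ Icc 0 t → f s ≤ g s) →
      ∫ s in (0 : ℝ)..t, f s ≤ ∫ s in (0 : ℝ)..t, g s := fun hf hg h =>
    intervalIntegral.integral_mono_ae_restrict ht.1 (hf.intervalIntegrable le_rfl ht.1)
      (hg.intervalIntegrable le_rfl ht.1) ((ae_restrict_iff' measurableSet_Icc).2 h)
  rw [intervalIntegral.integral_add (intervalIntegrable_dotProduct hf _ ht.1)
    (intervalIntegrable_dotProduct (hg.mulVec _) _ ht.1)]
  refine add_le_add ?_ ?_
  · rw [integral_dotProduct hf _ ht.1]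
    exact dotProduct_le_dotProduct hl (hξ t ht)
  · rw [integral_dotProduct hωi _ ht.1, integral_dotProduct (hg.mulVec _) _ ht.1]
    refine dotProduct_le_dotProduct hψ fun i => ?_
    have hci : ∀ j, LocallyIntegrableOn (causalConv (Δ.kernel i j) fun s => ζ s j) (Ici 0) :=
      fun j => have := Δ.finite i j
        locallyIntegrableOn_causalConv (Δ.causal i j) (hζi.eval j)
    calc ∫ s in (0 : ℝ)..t, ω s i
        ≤ ∫ s in (0 : ℝ)..t, ∑ j, causalConv (Δ.kernel i j) (fun s => ζ s j) s := by
          refine hmono (hωi.eval i) ?_ ?_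
          · exact LocallyIntegrableOn.finsetSum _ hci
          · filter_upwards [haeT hω] with s hs hst using hs hst i
      _ = ∑ j, ∫ s in (0 : ℝ)..t, causalConv (Δ.kernel i j) (fun s => ζ s j) s :=
          intervalIntegral.integral_finsetSum fun j _ =>
            (hci j).intervalIntegrable le_rfl ht.1
      -- Here the kernels are replaced by their total masses; nothing else about `Δ` enters the
      -- balance.
      _ ≤ ∑ j, Δ₀ i j * ∫ s in (0 : ℝ)..t, ζ s j := Finset.sum_le_sum fun j _ => by
          have := Δ.finite i j
          rw [← hΔ.real_univ i j]
          exact integral_causalConv_le (Δ.causal i j) (hζi.eval j) (fun s => hζ0 s j) ht.1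
      _ ≤ ∑ j, Δ₀ i j * ∫ s in (0 : ℝ)..t, (S.C₀ *ᵥ ξ s + S.F₀₀ *ᵥ ω s + S.F₀₁ *ᵥ η s) j := by
          refine Finset.sum_le_sum fun j _ => mul_le_mul_of_nonneg_left ?_ ?_
          · refine hmono (hζi.eval j) (hg.eval j) ?_
            filter_upwards [haeT hζ] with s hs hst using hs hst j
          · rw [← hΔ.real_univ i j]; exact measureReal_nonneg
      _ = _ := (integral_dotProduct hg (Δ₀ i) ht.1).symm

end Balance

/-- The integral form of Grönwall's inequality, for vanishing initial values. -/
theorem eq_zero_of_le_mul_integral {Y : ℝ → ℝ} {σ T : ℝ}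
    (hY : ContinuousOn Y (Ici 0)) (hY0 : ∀ t, 0 ≤ Y t)
    (h : ∀ t ∈ Icc 0 T, Y t ≤ σ * ∫ s in (0 : ℝ)..t, Y s) {t : ℝ} (ht : t ∈ Icc 0 T) : Y t = 0 := by
  -- Freezing `Y` at its initial value for negative times makes it continuous on the line, so that
  -- its primitive `g` is differentiable and the differential form of Grönwall's inequality applies
  -- to `g`.
  let Z : ℝ → ℝ := fun s => Y (max s 0)
  have hZ : Continuous Z :=
    hY.comp_continuous (continuous_id.max continuous_const) fun s => mem_Ici.2 (le_max_right _ _)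
  let g : ℝ → ℝ := fun t => ∫ s in (0 : ℝ)..t, Z s
  have hg : ∀ t, HasDerivAt g (Z t) t := fun t =>
    intervalIntegral.integral_hasDerivAt_right (hZ.intervalIntegrable _ _)
      (hZ.stronglyMeasurableAtFilter _ _) hZ.continuousAt
  have hgY : ∀ t, 0 ≤ t → g t = ∫ s in (0 : ℝ)..t, Y s := fun t ht => by
    refine intervalIntegral.integral_congr fun s hs => ?_
    rw [uIcc_of_le ht] at hs
    simp [Z, hs.1]
  have hg0 : ∀ t, 0 ≤ t → 0 ≤ g t := fun t ht => by
    rw [hgY t ht]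
    exact intervalIntegral.integral_nonneg ht fun s _ => hY0 s
  have hgz : ∀ t ∈ Icc 0 T, g t = 0 := fun t ht => by
    have := norm_le_gronwallBound_of_norm_deriv_right_le (f := g) (f' := Z) (δ := 0) (K := σ)
      (ε := 0) (a := 0) (b := T) (fun s _ => (hg s).continuousAt.continuousWithinAt)
      (fun s _ => (hg s).hasDerivWithinAt) (by simp [g]) (fun s hs => by
        have hs' : s ∈ Icc 0 T := Ico_subset_Icc_self hs
        rw [Real.norm_of_nonneg (hY0 _), Real.norm_of_nonneg (hg0 s hs.1), hgY s hs.1, add_zero]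
        simpa [Z, hs.1] using h s hs') t ht
    rw [gronwallBound_ε0_δ0] at this
    exact norm_le_zero_iff.1 this
  have h1 := h t ht
  rw [← hgY t ht.1, hgz t ht, mul_zero] at h1
  exact le_antisymm h1 (hY0 t)

section PositiveLoop

variable {n n₀ p q : ℕ} {S : LFR n n₀ p q} {Δ₀ : Matrix (Fin n₀) (Fin n₀) ℝ}

theorem LFR.PositiveLoop.exists_vecMul_eq (h : S.PositiveLoop Δ₀) {a : Fin n₀ → ℝ}
    (ha : ∀ i, 0 ≤ a i) : ∃ ψ : Fin n₀ → ℝ, (∀ i, 0 ≤ ψ i) ∧ ψ = a + ψ ᵥ* (Δ₀ * S.F₀₀) := by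
  refine ⟨a ᵥ* (1 - Δ₀ * S.F₀₀)⁻¹, vecMul_nonneg' h.2 ha, ?_⟩
  have h1 : (a ᵥ* (1 - Δ₀ * S.F₀₀)⁻¹) ᵥ* (1 - Δ₀ * S.F₀₀) = a := by
    rw [vecMul_vecMul, nonsing_inv_mul _ ((isUnit_iff_isUnit_det _).1 h.1), vecMul_one]
  rw [vecMul_sub, vecMul_one] at h1
  exact sub_eq_iff_eq_add.1 h1

theorem LFR.PositiveLoop.exists_mulVec_eq (h : S.PositiveLoop Δ₀) {a : Fin n₀ → ℝ}
    (ha : ∀ i, 0 ≤ a i) : ∃ w : Fin n₀ → ℝ, (∀ i, 0 ≤ w i) ∧ w = a + (Δ₀ * S.F₀₀) *ᵥ w := by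
  refine ⟨(1 - Δ₀ * S.F₀₀)⁻¹ *ᵥ a, mulVec_nonneg' h.2 ha, ?_⟩
  have h1 : (1 - Δ₀ * S.F₀₀) *ᵥ ((1 - Δ₀ * S.F₀₀)⁻¹ *ᵥ a) = a := by
    rw [mulVec_mulVec, mul_nonsing_inv _ ((isUnit_iff_isUnit_det _).1 h.1), one_mulVec]
  rw [sub_mulVec, one_mulVec] at h1
  exact sub_eq_iff_eq_add.1 h1

theorem LFR.PositiveLoop.nonneg_of_vecMul_le (h : S.PositiveLoop Δ₀) {ψ : Fin n₀ → ℝ}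
    (hψ : ∀ i, (ψ ᵥ* (Δ₀ * S.F₀₀)) i ≤ ψ i) (i : Fin n₀) : 0 ≤ ψ i := by
  have h1 : (ψ ᵥ* (1 - Δ₀ * S.F₀₀)) ᵥ* (1 - Δ₀ * S.F₀₀)⁻¹ = ψ := by
    rw [vecMul_vecMul, mul_nonsing_inv _ ((isUnit_iff_isUnit_det _).1 h.1), vecMul_one]
  rw [← h1]
  refine vecMul_nonneg' h.2 (fun j => ?_) i
  rw [vecMul_sub, vecMul_one]
  simpa using hψ j

theorem LFR.PositiveLoop.eq_zero_of_mulVec_eq (h : S.PositiveLoop Δ₀) {w : Fin n₀ → ℝ}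
    (hw : (Δ₀ * S.F₀₀) *ᵥ w = w) : w = 0 := by
  have h1 : (1 - Δ₀ * S.F₀₀)⁻¹ *ᵥ ((1 - Δ₀ * S.F₀₀) *ᵥ w) = w := by
    rw [mulVec_mulVec, nonsing_inv_mul _ ((isUnit_iff_isUnit_det _).1 h.1), one_mulVec]
  rw [← h1, sub_mulVec, one_mulVec, hw, sub_self, mulVec_zero]

end PositiveLoop

section Comparison

variable {n n₀ p q : ℕ} {S : LFR n n₀ p q} {Δ : PositiveLTI n₀}
  {Δ₀ : Matrix (Fin n₀) (Fin n₀) ℝ}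

/-- Nonnegative signals that vanish initially and satisfy the inequalities of the unforced
interconnection are zero. -/
theorem LFR.eq_zero_of_inequalities (hS : S.IsPositive)
    (hloop : S.PositiveLoop Δ₀) (hΔ : Δ.HasStaticGain Δ₀)
    {ξ : ℝ → Fin n → ℝ} {ω ζ : ℝ → Fin n₀ → ℝ} {T : ℝ}
    (hξc : ContinuousOn ξ (Ici 0)) (hωi : LocallyIntegrableOn ω (Ici 0))
    (hζi : LocallyIntegrableOn ζ (Ici 0))
    (hξ0 : ∀ t i, 0 ≤ ξ t i) (hω0 : ∀ t i, 0 ≤ ω t i) (hζ0 : ∀ t i, 0 ≤ ζ t i)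
    (hξ : ∀ t ∈ Icc 0 T, ∀ i, ξ t i ≤ ∫ s in (0 : ℝ)..t, (S.A *ᵥ ξ s + S.E₀ *ᵥ ω s) i)
    (hζ : ∀ᵐ t ∂volume.restrict (Ici (0 : ℝ)), t ≤ T →
      ∀ i, ζ t i ≤ (S.C₀ *ᵥ ξ t + S.F₀₀ *ᵥ ω t) i)
    (hω : ∀ᵐ t ∂volume.restrict (Ici (0 : ℝ)), t ≤ T →
      ∀ i, ω t i ≤ ∑ j, causalConv (Δ.kernel i j) (fun s => ζ s j) t) :
    (∀ t ∈ Icc 0 T, ξ t = 0) ∧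
      ∀ᵐ t ∂volume.restrict (Ici (0 : ℝ)), t ≤ T → ω t = 0 ∧ ζ t = 0 := by
  have hξi : LocallyIntegrableOn ξ (Ici 0) := hξc.locallyIntegrableOn measurableSet_Ici
  -- With `ψ = 1 ᵥ* E₀ + 1 + ψ ᵥ* (Δ₀ * F₀₀)`, the term `ψ ⬝ᵥ ω` on the left of the balance absorbs
  -- all terms in `ω` on the right and leaves `1 ⬝ᵥ ω` over. What remains is a Grönwall inequality
  -- for `1 ⬝ᵥ ξ`.
  have ha : ∀ i, 0 ≤ ((1 : Fin n → ℝ) ᵥ* S.E₀ + 1) i := fun i =>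
    add_nonneg (vecMul_nonneg' hS.E₀ (fun _ => zero_le_one) i) zero_le_one
  obtain ⟨ψ, hψ0, hψ⟩ := hloop.exists_vecMul_eq ha
  -- the growth rate
  let c : Fin n → ℝ := 1 ᵥ* S.A + ψ ᵥ* (Δ₀ * S.C₀)
  let σ : ℝ := ∑ i, |c i|
  have hσ : ∀ i, c i ≤ σ := fun i => (le_abs_self _).trans
    (Finset.single_le_sum (f := fun i => |c i|) (fun i _ => abs_nonneg _) (Finset.mem_univ i))
  have hωii := fun t (ht : t ∈ Icc 0 T) => intervalIntegrable_dotProduct hωi (1 : Fin n₀ → ℝ) ht.1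
  have hωψ := fun t (ht : t ∈ Icc 0 T) => intervalIntegrable_dotProduct hωi ψ ht.1
  have hξii := fun t (ht : t ∈ Icc 0 T) => intervalIntegrable_dotProduct hξi (1 : Fin n → ℝ) ht.1
  have key : ∀ t ∈ Icc 0 T, 1 ⬝ᵥ ξ t + ∫ s in (0 : ℝ)..t, 1 ⬝ᵥ ω s ≤
      σ * ∫ s in (0 : ℝ)..t, 1 ⬝ᵥ ξ s := fun t ht => by
    have h1 := S.balance hΔ (η := fun _ => 0) hξi hωi hζi (locallyIntegrableOn_Ici_const 0) hζ0
      (by simpa using hξ) (by simpa using hζ) hω (l := 1) (ψ := ψ) (fun _ => zero_le_one) hψ0 ht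
    have h2 : ∀ s, (1 : Fin n → ℝ) ⬝ᵥ (S.A *ᵥ ξ s + S.E₀ *ᵥ ω s + S.E₁ *ᵥ 0) +
        ψ ⬝ᵥ (Δ₀ *ᵥ (S.C₀ *ᵥ ξ s + S.F₀₀ *ᵥ ω s + S.F₀₁ *ᵥ 0)) ≤
        σ * (1 ⬝ᵥ ξ s) + ψ ⬝ᵥ ω s - 1 ⬝ᵥ ω s := fun s => by
      have h3 : c ⬝ᵥ ξ s ≤ σ * (1 ⬝ᵥ ξ s) := by
        simp only [dotProduct, Finset.mul_sum, Pi.one_apply, one_mul]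
        exact Finset.sum_le_sum fun i _ => mul_le_mul_of_nonneg_right (hσ i) (hξ0 s i)
      have h4 : ψ ⬝ᵥ ω s = (1 ᵥ* S.E₀) ⬝ᵥ ω s + 1 ⬝ᵥ ω s + (ψ ᵥ* (Δ₀ * S.F₀₀)) ⬝ᵥ ω s := by
        conv_lhs => rw [hψ]
        simp only [add_dotProduct]
      simp only [c, add_dotProduct] at h3
      simp only [mulVec_zero, add_zero, mulVec_add, dotProduct_add, mulVec_mulVec,
        dotProduct_mulVec] at *
      linarith
    have hF : LocallyIntegrableOn (fun s => S.A *ᵥ ξ s + S.E₀ *ᵥ ω s + S.E₁ *ᵥ 0) (Ici 0) :=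
      ((hξi.mulVec _).add (hωi.mulVec _)).add (locallyIntegrableOn_Ici_const _)
    have hG : LocallyIntegrableOn (fun s => Δ₀ *ᵥ (S.C₀ *ᵥ ξ s + S.F₀₀ *ᵥ ω s + S.F₀₁ *ᵥ 0))
        (Ici 0) :=
      (((hξi.mulVec _).add (hωi.mulVec _)).add (locallyIntegrableOn_Ici_const _)).mulVec _
    have h5 := intervalIntegral.integral_mono_on (μ := volume) ht.1
      ((intervalIntegrable_dotProduct hF _ ht.1).add (intervalIntegrable_dotProduct hG _ ht.1))
      ((((hξii t ht).const_mul _).add (hωψ t ht)).sub (hωii t ht)) fun s (_ : s ∈ Icc 0 t) => h2 s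
    rw [intervalIntegral.integral_sub (((hξii t ht).const_mul _).add (hωψ t ht)) (hωii t ht),
      intervalIntegral.integral_add ((hξii t ht).const_mul _) (hωψ t ht),
      intervalIntegral.integral_const_mul] at h5
    linarith
  have hnn : ∀ {k : ℕ} {f : Fin k → ℝ}, (∀ i, 0 ≤ f i) → 0 ≤ 1 ⬝ᵥ f := fun hf =>
    dotProduct_nonneg_of_nonneg (fun _ => zero_le_one) hf
  have hz : ∀ {k : ℕ} {f : Fin k → ℝ}, (∀ i, 0 ≤ f i) → 1 ⬝ᵥ f = 0 → f = 0 := fun {k f} hf h => by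
    rw [one_dotProduct, Finset.sum_eq_zero_iff_of_nonneg fun i _ => hf i] at h
    exact funext fun i => h i (Finset.mem_univ i)
  have hωint : ∀ t ∈ Icc 0 T, 0 ≤ ∫ s in (0 : ℝ)..t, 1 ⬝ᵥ ω s := fun t ht =>
    intervalIntegral.integral_nonneg ht.1 fun s _ => hnn (hω0 s)
  have hY : ∀ t ∈ Icc 0 T, (1 : Fin n → ℝ) ⬝ᵥ ξ t = 0 := fun t ht =>
    eq_zero_of_le_mul_integral (Y := fun t => 1 ⬝ᵥ ξ t) (T := T)
      (by simp only [one_dotProduct]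
          exact continuousOn_finsetSum _ fun i _ => (continuous_apply i).comp_continuousOn hξc)
      (fun t => hnn (hξ0 t)) (fun t ht => by linarith [key t ht, hωint t ht]) ht
  have hξz : ∀ t ∈ Icc 0 T, ξ t = 0 := fun t ht => hz (hξ0 t) (hY t ht)
  refine ⟨hξz, ?_⟩
  rcases lt_or_ge T 0 with hT | hT
  · rw [ae_restrict_iff' measurableSet_Ici]
    exact Eventually.of_forall fun t ht htT => absurd (ht.trans htT) (not_le.2 hT)
  have hTm : T ∈ Icc 0 T := ⟨hT, le_rfl⟩
  have h6 : ∫ s in (0 : ℝ)..T, (1 : Fin n₀ → ℝ) ⬝ᵥ ω s = 0 := by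
    refine le_antisymm ?_ (hωint T hTm)
    have h7 : ∫ s in (0 : ℝ)..T, (1 : Fin n → ℝ) ⬝ᵥ ξ s = 0 := by
      rw [intervalIntegral.integral_congr (g := fun _ => 0) fun s hs => hY s ?_]
      · simp
      · rwa [uIcc_of_le hT] at hs
    have := key T hTm
    rw [hY T hTm, h7] at this
    linarith
  rw [intervalIntegral.integral_of_le hT, ← integral_Icc_eq_integral_Ioc,
    integral_eq_zero_iff_of_nonneg (fun s => hnn (hω0 s))
      ((intervalIntegrable_iff_integrableOn_Icc_of_le hT).1 (hωii T hTm)),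
    Filter.EventuallyEq, ae_restrict_iff' measurableSet_Icc] at h6
  rw [ae_restrict_iff' measurableSet_Ici] at hζ ⊢
  filter_upwards [h6, hζ] with t h7 h8 ht htT
  have hωz := hz (hω0 t) (h7 ⟨ht, htT⟩)
  refine ⟨hωz, funext fun i => le_antisymm ?_ (hζ0 t i)⟩
  simpa [hωz, hξz t ⟨ht, htT⟩] using h8 ht htT i

end Comparison

/-! ### Trajectories: comparison, linearity and dissipation -/

section Trajectories

variable {n n₀ p q : ℕ} {S : LFR n n₀ p q} {G : (ℝ → Fin n₀ → ℝ) → ℝ → Fin n₀ → ℝ}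
  {Δ : PositiveLTI n₀} {Δ₀ : Matrix (Fin n₀) (Fin n₀) ℝ}
  {x₀ : Fin n → ℝ} {h : ℝ → Fin n₀ → ℝ} {w₁ : ℝ → Fin p → ℝ} {x : ℝ → Fin n → ℝ}
  {w₀ z₀ : ℝ → Fin n₀ → ℝ}

/-- The right-hand side of the state equation. -/
def LFR.rhs (S : LFR n n₀ p q) (x : ℝ → Fin n → ℝ) (w₀ : ℝ → Fin n₀ → ℝ) (w₁ : ℝ → Fin p → ℝ) :
    ℝ → Fin n → ℝ :=
  fun s => S.A *ᵥ x s + S.E₀ *ᵥ w₀ s + S.E₁ *ᵥ w₁ s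

namespace LFR.IsTrajectory

theorem integrable_x (tr : S.IsTrajectory G x₀ h w₁ x w₀ z₀) : LocallyIntegrableOn x (Ici 0) :=
  tr.continuousOn.locallyIntegrableOn measurableSet_Ici

theorem integrable_rhs (tr : S.IsTrajectory G x₀ h w₁ x w₀ z₀)
    (hw₁ : LocallyIntegrableOn w₁ (Ici 0)) : LocallyIntegrableOn (S.rhs x w₀ w₁) (Ici 0) :=
  ((tr.integrable_x.mulVec _).add (tr.integrable_w₀.mulVec _)).add (hw₁.mulVec _)

theorem state_zero (tr : S.IsTrajectory G x₀ h w₁ x w₀ z₀) : x 0 = x₀ := by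
  simpa using tr.state 0 le_rfl

theorem state_apply (tr : S.IsTrajectory G x₀ h w₁ x w₀ z₀)
    (hw₁ : LocallyIntegrableOn w₁ (Ici 0)) {s t : ℝ} (hs : 0 ≤ s) (hst : s ≤ t) (i : Fin n) :
    x t i = x s i + ∫ r in s..t, S.rhs x w₀ w₁ r i := by
  have hf := tr.integrable_rhs hw₁
  have h1 : ∀ t, 0 ≤ t → x t i = x₀ i + ∫ r in (0 : ℝ)..t, S.rhs x w₀ w₁ r i := fun t ht => by
    rw [tr.state t ht, ← integral_eval (hf.intervalIntegrable le_rfl ht)]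
    rfl
  rw [h1 t (hs.trans hst), h1 s hs, add_assoc, intervalIntegral.integral_add_adjacent_intervals]
  · exact (hf.eval i).intervalIntegrable le_rfl hs
  · exact (hf.eval i).intervalIntegrable hs hst

/-- The chain rule for the positive part of an affine function of a state. -/
theorem max_zero_eq (tr : S.IsTrajectory G x₀ h w₁ x w₀ z₀)
    (hw₁ : LocallyIntegrableOn w₁ (Ici 0)) (c d : ℝ) {s t : ℝ} (hs : 0 ≤ s) (hst : s ≤ t)
    (i : Fin n) :
    IntervalIntegrable (fun r => if 0 < c * x r i - d then c * S.rhs x w₀ w₁ r i else 0)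
        volume s t ∧
      max (c * x t i - d) 0 = max (c * x s i - d) 0 +
        ∫ r in s..t, if 0 < c * x r i - d then c * S.rhs x w₀ w₁ r i else 0 := by
  refine max_zero_eq_add_integral (y := fun r => c * x r i - d)
    (f := fun r => c * S.rhs x w₀ w₁ r i) hst
    ((((tr.integrable_rhs hw₁).eval i).intervalIntegrable hs hst).const_mul c) fun r hr => ?_
  rw [tr.state_apply hw₁ hs hr.1 i, intervalIntegral.integral_const_mul]
  ring

theorem ae_integrable (tr : S.IsTrajectory G x₀ h w₁ x w₀ z₀) (hh : IsPast h) :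
    ∀ᵐ t ∂volume.restrict (Ici (0 : ℝ)), ∀ i j,
      IntegrableOn (fun θ => z₀ (t - θ) j) (Iic t) (Δ.kernel i j) ∧
      IntegrableOn (fun θ => z₀ (t - θ) j) (Ioi t) (Δ.kernel i j) ∧
      Integrable (fun θ => z₀ (t - θ) j) (Δ.kernel i j) ∧
      ∫ θ, z₀ (t - θ) j ∂(Δ.kernel i j) = causalConv (Δ.kernel i j) (fun s => z₀ s j) t +
        ∫ θ in Ioi t, h (t - θ) j ∂(Δ.kernel i j) := by
  obtain ⟨hm, M, hM⟩ := hh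
  refine ae_all_iff.2 fun i => ae_all_iff.2 fun j => ?_
  have := Δ.finite i j
  exact ae_integrable_of_past (Δ.causal i j) (tr.integrable_z₀.eval j)
    (h := fun s => h s j) ((measurable_pi_apply j).comp hm)
    (fun t ht => (norm_le_pi_norm (h t) j).trans (hM t ht))
    fun t ht => congrFun (tr.past t ht) j

/-- Comparison of a trajectory with a constant supersolution. -/
theorem le_of_supersolution (hS : S.IsPositive) (hloop : S.PositiveLoop Δ₀)
    (hΔ : Δ.HasStaticGain Δ₀) (tr : S.IsTrajectory Δ.apply x₀ h w₁ x w₀ z₀)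
    (hw₁ : LocallyIntegrableOn w₁ (Ici 0)) (hh : IsPast h)
    {v : Fin n → ℝ} {w z : Fin n₀ → ℝ} {T : ℝ}
    (hv : ∀ t ∈ Icc 0 T, ∀ i, (S.A *ᵥ v + S.E₀ *ᵥ w + S.E₁ *ᵥ w₁ t) i ≤ 0)
    (hz : ∀ t ∈ Icc 0 T, ∀ i, (S.C₀ *ᵥ v + S.F₀₀ *ᵥ w + S.F₀₁ *ᵥ w₁ t) i ≤ z i)
    (hw : ∀ i, (Δ₀ *ᵥ z) i ≤ w i) (hxv : ∀ i, x₀ i ≤ v i) (hhz : ∀ t < 0, ∀ i, h t i ≤ z i) :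
    (∀ t ∈ Icc 0 T, ∀ i, x t i ≤ v i) ∧ ∀ᵐ t ∂volume.restrict (Ici (0 : ℝ)), t ≤ T →
      (∀ i, w₀ t i ≤ w i) ∧ ∀ i, z₀ t i ≤ z i := by
  -- The positive parts of the excesses over the supersolution vanish initially and satisfy the
  -- inequalities of the unforced interconnection, hence are zero.
  let ξ : ℝ → Fin n → ℝ := fun t i => max (x t i - v i) 0
  let ω : ℝ → Fin n₀ → ℝ := fun t i => max (w₀ t i - w i) 0
  let ζ : ℝ → Fin n₀ → ℝ := fun t i => max (z₀ t i - z i) 0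
  have hξc : ContinuousOn ξ (Ici 0) := continuousOn_pi.2 fun i =>
    (((continuous_apply i).comp_continuousOn tr.continuousOn).sub continuousOn_const).sup
      continuousOn_const
  have hωi : LocallyIntegrableOn ω (Ici 0) := .of_eval isClosed_Ici fun i =>
    ((tr.integrable_w₀.eval i).sub (locallyIntegrableOn_Ici_const _)).max_zero
  have hζi : LocallyIntegrableOn ζ (Ici 0) := .of_eval isClosed_Ici fun i =>
    ((tr.integrable_z₀.eval i).sub (locallyIntegrableOn_Ici_const _)).max_zero
  have hξi : LocallyIntegrableOn ξ (Ici 0) := hξc.locallyIntegrableOn measurableSet_Ici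
  have hdx : ∀ t i, (x t - v) i ≤ ξ t i := fun t i => le_max_left _ _
  have hdw : ∀ t i, (w₀ t - w) i ≤ ω t i := fun t i => le_max_left _ _
  have hξ0 : ∀ t i, 0 ≤ ξ t i := fun t i => le_max_right _ _
  have hω0 : ∀ t i, 0 ≤ ω t i := fun t i => le_max_right _ _
  have hζ0 : ∀ t i, 0 ≤ ζ t i := fun t i => le_max_right _ _
  have hfi : LocallyIntegrableOn (fun s => S.A *ᵥ ξ s + S.E₀ *ᵥ ω s) (Ici 0) :=
    (hξi.mulVec _).add (hωi.mulVec _)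
  have key := S.eq_zero_of_inequalities hS hloop hΔ (T := T) hξc hωi hζi hξ0 hω0 hζ0 ?_ ?_ ?_
  · refine ⟨fun t ht i => ?_, ?_⟩
    · have h1 := congrFun (key.1 t ht) i
      have h2 := hdx t i
      rw [h1] at h2
      simpa using h2
    · filter_upwards [key.2] with t ht htT
      obtain ⟨h1, h2⟩ := ht htT
      refine ⟨fun i => ?_, fun i => ?_⟩
      · have h3 := hdw t i
        rw [h1] at h3
        simpa using h3
      · have h3 : z₀ t i - z i ≤ ζ t i := le_max_left _ _
        rw [h2] at h3
        simpa using h3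
  · intro t ht i
    obtain ⟨h1, h2⟩ := tr.max_zero_eq hw₁ 1 (v i) le_rfl ht.1 i
    simp only [one_mul] at h1 h2
    have h3 : ξ t i = ∫ r in (0 : ℝ)..t, if 0 < x r i - v i then S.rhs x w₀ w₁ r i else 0 := by
      change max _ _ = _
      rw [h2, tr.state_zero, max_eq_right (sub_nonpos.2 (hxv i)), zero_add]
    rw [h3]
    refine intervalIntegral.integral_mono_on ht.1 h1
      ((hfi.eval i).intervalIntegrable le_rfl ht.1) fun s hs => ?_
    have hsT : s ∈ Icc 0 T := ⟨hs.1, hs.2.trans ht.2⟩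
    simp only [Pi.add_apply]
    split_ifs with hpos
    -- Where the excess is positive it agrees with `ξ` in component `i`, as the Metzler comparison
    -- requires. Where it is not, `ξ s i = 0` and the right-hand side is nonnegative by the same
    -- comparison with `0`.
    · have h4 : (x s - v) i = ξ s i := (max_eq_left hpos.le).symm
      have h5 := hS.metzler.mulVec_le (hdx s) h4
      have h6 := mulVec_mono hS.E₀ (hdw s) i
      have h7 := hv s hsT i
      simp only [mulVec_sub, Pi.sub_apply, Pi.add_apply, LFR.rhs] at *
      linarith
    · have h4 : (0 : Fin n → ℝ) i = ξ s i := (max_eq_right (not_lt.1 hpos)).symm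
      have h5 := hS.metzler.mulVec_le (a := 0) (hξ0 s) h4
      have h6 := mulVec_nonneg' hS.E₀ (hω0 s) i
      simp only [mulVec_zero, Pi.zero_apply] at h5
      linarith
  · filter_upwards [tr.loop_z₀, ae_restrict_mem measurableSet_Ici] with t ht ht0 htT i
    have h5 := mulVec_mono hS.C₀ (hdx t) i
    have h6 := mulVec_mono hS.F₀₀ (hdw t) i
    have h7 := hz t ⟨ht0, htT⟩ i
    have h8 := mulVec_nonneg' hS.C₀ (hξ0 t) i
    have h9 := mulVec_nonneg' hS.F₀₀ (hω0 t) i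
    refine max_le ?_ (add_nonneg h8 h9)
    rw [ht]
    simp only [mulVec_sub, Pi.sub_apply, Pi.add_apply] at *
    linarith
  · filter_upwards [tr.loop_w₀, tr.ae_integrable (Δ := Δ) hh, ae_restrict_mem measurableSet_Ici]
      with t ht hint ht0 htT i
    refine max_le ?_ (Finset.sum_nonneg fun j _ => causalConv_nonneg (fun s => hζ0 s j) t)
    have h1 : w₀ t i - w i ≤
        ∑ j, (∫ θ, z₀ (t - θ) j ∂(Δ.kernel i j) - Δ₀ i j * z j) := by
      rw [Finset.sum_sub_distrib, ht]
      exact sub_le_sub le_rfl (hw i)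
    refine h1.trans (Finset.sum_le_sum fun j _ => ?_)
    have := Δ.finite i j
    obtain ⟨h2, -, h3, -⟩ := hint i j
    have h4 : Δ₀ i j * z j = ∫ _, z j ∂(Δ.kernel i j) := by
      rw [integral_const, smul_eq_mul, hΔ.real_univ]
    rw [h4, ← integral_sub h3 (integrable_const _), causalConv,
      ← integral_indicator measurableSet_Iic]
    refine integral_mono (h3.sub (integrable_const _)) ?_ fun θ => ?_
    · have h5 : IntegrableOn (fun θ => ζ (t - θ) j) (Iic t) (Δ.kernel i j) :=
        (h2.sub (integrable_const (z j))).pos_part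
      exact h5.integrable_indicator measurableSet_Iic
    · by_cases hθ : θ ≤ t
      · rw [indicator_of_mem (mem_Iic.2 hθ)]
        exact le_max_left _ _
      -- For `θ > t` the convolution reads the past, which lies below `z` and only lowers the
      -- integral.
      · rw [indicator_of_notMem (by simpa using hθ)]
        have hneg : t - θ < 0 := by linarith [not_le.1 hθ]
        change z₀ (t - θ) j - z j ≤ 0
        rw [tr.past _ hneg]
        linarith [hhz _ hneg j]

theorem smul (tr : S.IsTrajectory Δ.apply x₀ h w₁ x w₀ z₀) (c : ℝ) :
    S.IsTrajectory Δ.apply (c • x₀) (c • h) (c • w₁) (c • x) (c • w₀) (c • z₀) where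
  continuousOn := tr.continuousOn.const_smul c
  integrable_w₀ := tr.integrable_w₀.clm_comp (c • ContinuousLinearMap.id ℝ _)
  integrable_z₀ := tr.integrable_z₀.clm_comp (c • ContinuousLinearMap.id ℝ _)
  past t ht := by simp [tr.past t ht]
  state t ht := by
    simp only [Pi.smul_apply, mulVec_smul, ← smul_add, intervalIntegral.integral_smul]
    rw [← tr.state t ht]
  loop_z₀ := by
    filter_upwards [tr.loop_z₀] with t ht
    simp only [Pi.smul_apply, mulVec_smul, ← smul_add]
    rw [← ht]
  loop_w₀ := by
    filter_upwards [tr.loop_w₀] with t ht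
    ext i
    simp only [Pi.smul_apply, ht, PositiveLTI.apply, smul_eq_mul, integral_const_mul,
      Finset.mul_sum]

theorem add {x₀' : Fin n → ℝ} {h' : ℝ → Fin n₀ → ℝ} {w₁' : ℝ → Fin p → ℝ} {x' : ℝ → Fin n → ℝ}
    {w₀' z₀' : ℝ → Fin n₀ → ℝ} (tr : S.IsTrajectory Δ.apply x₀ h w₁ x w₀ z₀)
    (tr' : S.IsTrajectory Δ.apply x₀' h' w₁' x' w₀' z₀')
    (hw₁ : LocallyIntegrableOn w₁ (Ici 0)) (hw₁' : LocallyIntegrableOn w₁' (Ici 0))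
    (hh : IsPast h) (hh' : IsPast h') :
    S.IsTrajectory Δ.apply (x₀ + x₀') (h + h') (w₁ + w₁') (x + x') (w₀ + w₀') (z₀ + z₀') where
  continuousOn := tr.continuousOn.add tr'.continuousOn
  integrable_w₀ := tr.integrable_w₀.add tr'.integrable_w₀
  integrable_z₀ := tr.integrable_z₀.add tr'.integrable_z₀
  past t ht := by simp [tr.past t ht, tr'.past t ht]
  state t ht := by
    have h1 : ∀ s, S.A *ᵥ (x + x') s + S.E₀ *ᵥ (w₀ + w₀') s + S.E₁ *ᵥ (w₁ + w₁') s =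
        S.rhs x w₀ w₁ s + S.rhs x' w₀' w₁' s := fun s => by
      simp only [Pi.add_apply, mulVec_add, LFR.rhs]
      abel
    simp only [h1]
    rw [intervalIntegral.integral_add ((tr.integrable_rhs hw₁).intervalIntegrable le_rfl ht)
      ((tr'.integrable_rhs hw₁').intervalIntegrable le_rfl ht), Pi.add_apply, tr.state t ht,
      tr'.state t ht]
    simp only [LFR.rhs]
    abel
  loop_z₀ := by
    filter_upwards [tr.loop_z₀, tr'.loop_z₀] with t ht ht'
    simp only [Pi.add_apply, ht, ht', mulVec_add]
    abel
  loop_w₀ := by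
    filter_upwards [tr.loop_w₀, tr'.loop_w₀, tr.ae_integrable (Δ := Δ) hh,
      tr'.ae_integrable (Δ := Δ) hh'] with t ht ht' hi hi'
    ext i
    simp only [Pi.add_apply, ht, ht', PositiveLTI.apply]
    rw [← Finset.sum_add_distrib]
    exact Finset.sum_congr rfl fun j _ => (integral_add (hi i j).2.2.1 (hi' i j).2.2.1).symm

/-- The dissipation inequality bounds the `L₁`-norm of the output on finite horizons. -/
theorem integral_output_le (hS : S.IsPositive) (hΔ : Δ.HasStaticGain Δ₀)
    (tr : S.IsTrajectory Δ.apply 0 0 w₁ x w₀ z₀) (hw₁ : LocallyIntegrableOn w₁ (Ici 0))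
    {l : Fin n → ℝ} {ψ : Fin n₀ → ℝ} {γ : ℝ} (hl : ∀ i, 0 ≤ l i) (hψ : ∀ i, 0 ≤ ψ i)
    (h1 : ∀ i, (l ᵥ* S.A + ψ ᵥ* (Δ₀ * S.C₀) + 1 ᵥ* S.C₁) i ≤ 0)
    (h2 : ∀ i, (l ᵥ* S.E₀ + ψ ᵥ* (Δ₀ * S.F₀₀) + 1 ᵥ* S.F₁₀) i ≤ ψ i)
    (h3 : ∀ i, (l ᵥ* S.E₁ + ψ ᵥ* (Δ₀ * S.F₀₁) + 1 ᵥ* S.F₁₁) i ≤ γ) {T : ℝ} (hT : 0 ≤ T) :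
    ∫ t in (0 : ℝ)..T, ∑ i, |S.output x w₀ w₁ t i| ≤
      γ * ∫ t in (0 : ℝ)..T, ∑ i, |w₁ t i| := by
  let ξ : ℝ → Fin n → ℝ := fun t i => |x t i|
  let ω : ℝ → Fin n₀ → ℝ := fun t i => |w₀ t i|
  let ζ : ℝ → Fin n₀ → ℝ := fun t i => |z₀ t i|
  let η : ℝ → Fin p → ℝ := fun t i => |w₁ t i|
  have hξi : LocallyIntegrableOn ξ (Ici 0) := .of_eval isClosed_Ici fun i =>
    (tr.integrable_x.eval i).abs
  have hωi : LocallyIntegrableOn ω (Ici 0) := .of_eval isClosed_Ici fun i =>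
    (tr.integrable_w₀.eval i).abs
  have hζi : LocallyIntegrableOn ζ (Ici 0) := .of_eval isClosed_Ici fun i =>
    (tr.integrable_z₀.eval i).abs
  have hηi : LocallyIntegrableOn η (Ici 0) := .of_eval isClosed_Ici fun i => (hw₁.eval i).abs
  have habs : ∀ {a b : ℕ} {M : Matrix (Fin a) (Fin b) ℝ}, EntrywiseNonneg M →
      ∀ (u : Fin b → ℝ) i, |(M *ᵥ u) i| ≤ (M *ᵥ fun j => |u j|) i := fun {a b M} hM u i => by
    change |∑ j, M i j * u j| ≤ ∑ j, M i j * |u j|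
    refine (Finset.abs_sum_le_sum_abs _ _).trans (Finset.sum_le_sum fun j _ => ?_)
    rw [abs_mul, abs_of_nonneg (hM i j)]
  have hfi : LocallyIntegrableOn (fun s => S.A *ᵥ ξ s + S.E₀ *ᵥ ω s + S.E₁ *ᵥ η s) (Ici 0) :=
    ((hξi.mulVec _).add (hωi.mulVec _)).add (hηi.mulVec _)
  have hgi : LocallyIntegrableOn (fun s => S.C₀ *ᵥ ξ s + S.F₀₀ *ᵥ ω s + S.F₀₁ *ᵥ η s) (Ici 0) :=
    ((hξi.mulVec _).add (hωi.mulVec _)).add (hηi.mulVec _)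
  have hoi : LocallyIntegrableOn (S.output x w₀ w₁) (Ici 0) :=
    ((tr.integrable_x.mulVec _).add (tr.integrable_w₀.mulVec _)).add (hw₁.mulVec _)
  have hξ : ∀ t ∈ Icc 0 T, ∀ i, ξ t i ≤
      ∫ s in (0 : ℝ)..t, (S.A *ᵥ ξ s + S.E₀ *ᵥ ω s + S.E₁ *ᵥ η s) i := fun t ht i => by
    obtain ⟨h4, h5⟩ := tr.max_zero_eq hw₁ 1 0 le_rfl ht.1 i
    obtain ⟨h6, h7⟩ := tr.max_zero_eq hw₁ (-1) 0 le_rfl ht.1 i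
    simp only [one_mul, sub_zero, neg_mul] at h4 h5 h6 h7
    -- The absolute value is the sum of the positive parts of `x` and `-x`, and each obeys the chain
    -- rule; the sign of `x` decides which derivative is active.
    have h8 : ξ t i = ∫ r in (0 : ℝ)..t, ((if 0 < x r i then S.rhs x w₀ w₁ r i else 0) +
        if 0 < -x r i then -S.rhs x w₀ w₁ r i else 0) := by
      rw [intervalIntegral.integral_add h4 h6]
      have h9 : |x t i| = max (x t i) 0 + max (-x t i) 0 := by
        rcases le_total 0 (x t i) with hx | hx
        · rw [abs_of_nonneg hx, max_eq_left hx, max_eq_right (by linarith), add_zero]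
        · rw [abs_of_nonpos hx, max_eq_right hx, max_eq_left (by linarith), zero_add]
      change |x t i| = _
      rw [h9, h5, h7, tr.state_zero]
      simp
    rw [h8]
    refine intervalIntegral.integral_mono_on ht.1 (h4.add h6)
      ((hfi.eval i).intervalIntegrable le_rfl ht.1) fun s _ => ?_
    have h9 := habs hS.E₀ (w₀ s) i
    have h10 := habs hS.E₁ (w₁ s) i
    rcases lt_trichotomy (x s i) 0 with hx | hx | hx
    · rw [if_neg (by linarith), if_pos (by linarith), zero_add]
      have h11 := hS.metzler.mulVec_le (a := -x s) (b := ξ s) (i := i)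
        (fun j => neg_le_abs _) (abs_of_neg hx).symm
      have := neg_le_abs ((S.E₀ *ᵥ w₀ s) i)
      have := neg_le_abs ((S.E₁ *ᵥ w₁ s) i)
      simp only [LFR.rhs, Pi.add_apply, mulVec_neg, Pi.neg_apply] at *
      linarith
    · rw [if_neg (by linarith), if_neg (by linarith), zero_add]
      have h11 := hS.metzler.mulVec_le (a := 0) (b := ξ s) (i := i)
        (fun j => abs_nonneg _) (by simp [ξ, hx])
      have := abs_nonneg ((S.E₀ *ᵥ w₀ s) i)
      have := abs_nonneg ((S.E₁ *ᵥ w₁ s) i)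
      simp only [Pi.add_apply, mulVec_zero, Pi.zero_apply] at *
      linarith
    · rw [if_pos (by linarith), if_neg (by linarith), add_zero]
      have h11 := hS.metzler.mulVec_le (a := x s) (b := ξ s) (i := i)
        (fun j => le_abs_self _) (abs_of_pos hx).symm
      have := le_abs_self ((S.E₀ *ᵥ w₀ s) i)
      have := le_abs_self ((S.E₁ *ᵥ w₁ s) i)
      simp only [LFR.rhs, Pi.add_apply] at *
      linarith
  have hζ : ∀ᵐ t ∂volume.restrict (Ici (0 : ℝ)), t ≤ T →
      ∀ i, ζ t i ≤ (S.C₀ *ᵥ ξ t + S.F₀₀ *ᵥ ω t + S.F₀₁ *ᵥ η t) i := by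
    filter_upwards [tr.loop_z₀] with t ht _ i
    change |z₀ t i| ≤ _
    rw [ht]
    exact (abs_add_three _ _ _).trans
      (add_le_add_three (habs hS.C₀ _ i) (habs hS.F₀₀ _ i) (habs hS.F₀₁ _ i))
  have hω : ∀ᵐ t ∂volume.restrict (Ici (0 : ℝ)), t ≤ T →
      ∀ i, ω t i ≤ ∑ j, causalConv (Δ.kernel i j) (fun s => ζ s j) t := by
    filter_upwards [tr.loop_w₀, tr.ae_integrable (Δ := Δ)
      ⟨measurable_const, 0, fun t _ => by simp⟩] with t ht hi _ i
    change |w₀ t i| ≤ _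
    rw [ht]
    refine (Finset.abs_sum_le_sum_abs _ _).trans (Finset.sum_le_sum fun j _ => ?_)
    rw [(hi i j).2.2.2]
    simp only [Pi.zero_apply, integral_zero, add_zero]
    exact abs_integral_le_integral_abs
  have key := S.balance hΔ (T := T) hξi hωi hζi hηi (fun t i => abs_nonneg _) hξ hζ hω hl hψ
    ⟨hT, le_rfl⟩
  -- Pointwise, the multiplier inequalities bound the output by the supply `γ * ∑ |w₁|` minus the
  -- integrand of the balance, up to the term `ψ ⬝ᵥ ω` on the left of the balance.
  have hout : ∀ t, ∑ i, |S.output x w₀ w₁ t i| ≤ γ * ∑ i, |w₁ t i| + ψ ⬝ᵥ ω t -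
      (l ⬝ᵥ (S.A *ᵥ ξ t + S.E₀ *ᵥ ω t + S.E₁ *ᵥ η t) +
        ψ ⬝ᵥ (Δ₀ *ᵥ (S.C₀ *ᵥ ξ t + S.F₀₀ *ᵥ ω t + S.F₀₁ *ᵥ η t))) := fun t => by
    have h4 : ∑ i, |S.output x w₀ w₁ t i| ≤
        1 ⬝ᵥ (S.C₁ *ᵥ ξ t + S.F₁₀ *ᵥ ω t + S.F₁₁ *ᵥ η t) := by
      rw [one_dotProduct]
      exact Finset.sum_le_sum fun i _ => (abs_add_three _ _ _).trans
        (add_le_add_three (habs hS.C₁ _ i) (habs hS.F₁₀ _ i) (habs hS.F₁₁ _ i))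
    have h5 : (l ᵥ* S.A + ψ ᵥ* (Δ₀ * S.C₀) + 1 ᵥ* S.C₁) ⬝ᵥ ξ t ≤ 0 :=
      Finset.sum_nonpos fun i _ => mul_nonpos_of_nonpos_of_nonneg (h1 i) (abs_nonneg _)
    have h6 : (l ᵥ* S.E₀ + ψ ᵥ* (Δ₀ * S.F₀₀) + 1 ᵥ* S.F₁₀) ⬝ᵥ ω t ≤ ψ ⬝ᵥ ω t :=
      Finset.sum_le_sum fun i _ => mul_le_mul_of_nonneg_right (h2 i) (abs_nonneg _)
    have h7 : (l ᵥ* S.E₁ + ψ ᵥ* (Δ₀ * S.F₀₁) + 1 ᵥ* S.F₁₁) ⬝ᵥ η t ≤ γ * ∑ i, |w₁ t i| := by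
      rw [Finset.mul_sum]
      exact Finset.sum_le_sum fun i _ => mul_le_mul_of_nonneg_right (h3 i) (abs_nonneg _)
    simp only [add_dotProduct, mulVec_add, dotProduct_add, mulVec_mulVec, dotProduct_mulVec] at *
    linarith
  have hsum : ∀ {k : ℕ} {f : ℝ → Fin k → ℝ}, LocallyIntegrableOn f (Ici 0) →
      IntervalIntegrable (fun t => ∑ i, |f t i|) volume 0 T := fun hf =>
    (LocallyIntegrableOn.finsetSum _ fun i => (hf.eval i).abs).intervalIntegrable le_rfl hT
  have hd1 := intervalIntegrable_dotProduct hfi l hT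
  have hd2 := intervalIntegrable_dotProduct (hgi.mulVec Δ₀) ψ hT
  have hd3 := intervalIntegrable_dotProduct hωi ψ hT
  have hd4 := (hsum hw₁).const_mul γ
  have hlast := intervalIntegral.integral_mono_on hT (hsum hoi) ((hd4.add hd3).sub (hd1.add hd2))
    fun t _ => hout t
  rw [intervalIntegral.integral_sub (hd4.add hd3) (hd1.add hd2),
    intervalIntegral.integral_add hd4 hd3, intervalIntegral.integral_const_mul] at hlast
  -- The final storage is nonnegative and may be dropped.
  have hlξ : 0 ≤ l ⬝ᵥ ξ T := dotProduct_nonneg_of_nonneg hl fun i => abs_nonneg _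
  linarith

end LFR.IsTrajectory

end Trajectories

/-! ### Lyapunov stability and convergence from decay vectors -/

theorem ae_comp_sub {μ : Measure ℝ} [IsFiniteMeasure μ] {P : ℝ → Prop} (h : ∀ᵐ t, P t) :
    ∀ᵐ t, ∀ᵐ θ ∂μ, P (t - θ) :=
  Measure.ae_ae_of_ae_prod ((quasiMeasurePreserving_sub_of_right_invariant volume μ).ae h)

theorem tendsto_measureReal_Ioi_atTop (μ : Measure ℝ) [IsFiniteMeasure μ] :
    Tendsto (fun t => μ.real (Ioi t)) atTop (𝓝 0) := by
  have h1 : Tendsto (fun t => μ (Ioi t)) atTop (𝓝 (μ (⋂ t, Ioi t))) :=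
    tendsto_measure_iInter_atTop (fun t => measurableSet_Ioi.nullMeasurableSet)
      (fun _ _ h => Ioi_subset_Ioi h) ⟨0, measure_ne_top _ _⟩
  have h2 : (⋂ t : ℝ, Ioi t) = ∅ := by
    ext x
    simp only [mem_iInter, mem_Ioi, mem_empty_iff_false, iff_false, not_forall, not_lt]
    exact ⟨x, le_rfl⟩
  rw [h2, measure_empty] at h1
  have h3 := (ENNReal.tendsto_toReal ENNReal.zero_ne_top).comp h1
  rw [ENNReal.toReal_zero] at h3
  exact h3

/-- An essentially bounded signal that is eventually small is mapped to a signal that is eventually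
small. -/
theorem PositiveLTI.eventually_abs_apply_le {n₀ : ℕ} {Δ : PositiveLTI n₀}
    {Δ₀ : Matrix (Fin n₀) (Fin n₀) ℝ} (hΔ : Δ.HasStaticGain Δ₀) {z : ℝ → Fin n₀ → ℝ} {B T : ℝ}
    {b : Fin n₀ → ℝ} (hb : ∀ j, 0 ≤ b j) (hB : ∀ᵐ t, ∀ j, |z t j| ≤ B)
    (hT : ∀ᵐ t, T ≤ t → ∀ j, |z t j| ≤ b j) {δ : ℝ} (hδ : 0 < δ) :
    ∃ T', ∀ᵐ t, T' ≤ t → ∀ i, |Δ.apply z t i| ≤ (Δ₀ *ᵥ b) i + δ := by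
  have hfin := Δ.finite
  have hlim : ∀ i, Tendsto (fun t => ∑ j, (Δ.kernel i j).real (Ioi (t - T)) * B) atTop (𝓝 0) :=
    fun i => by
      have := tendsto_finsetSum Finset.univ fun j (_ : j ∈ Finset.univ) =>
        ((tendsto_measureReal_Ioi_atTop (Δ.kernel i j)).comp
          (tendsto_atTop_add_const_right atTop (-T) tendsto_id)).mul_const B
      simpa [sub_eq_add_neg] using this
  have hev : ∀ᶠ t in atTop, ∀ i, ∑ j, (Δ.kernel i j).real (Ioi (t - T)) * B < δ :=
    eventually_all.2 fun i => (hlim i).eventually (gt_mem_nhds hδ)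
  obtain ⟨T', hT'⟩ := eventually_atTop.1 hev
  have h1 : ∀ᵐ t, ∀ i j, ∀ᵐ θ ∂(Δ.kernel i j), |z (t - θ) j| ≤ B ∧
      (T ≤ t - θ → |z (t - θ) j| ≤ b j) := by
    refine ae_all_iff.2 fun i => ae_all_iff.2 fun j =>
      ae_comp_sub (P := fun s => |z s j| ≤ B ∧ (T ≤ s → |z s j| ≤ b j)) ?_
    filter_upwards [hB, hT] with t h1 h2 using ⟨h1 j, fun h => h2 h j⟩
  refine ⟨T', ?_⟩
  filter_upwards [h1] with t ht htT i
  -- The convolution is split at `θ = t - T`: more recent values are bounded by `b`, older ones by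
  -- `B` times the tail mass of the kernel, which tends to zero as `t` grows.
  calc |Δ.apply z t i| ≤ ∑ j, |∫ θ, z (t - θ) j ∂(Δ.kernel i j)| := Finset.abs_sum_le_sum_abs _ _
    _ ≤ ∑ j, (Δ₀ i j * b j + (Δ.kernel i j).real (Ioi (t - T)) * B) := by
      refine Finset.sum_le_sum fun j _ => ?_
      have h2 : Integrable (fun θ => b j + (Ioi (t - T)).indicator (fun _ => B) θ)
          (Δ.kernel i j) :=
        (integrable_const _).add ((integrable_const _).indicator measurableSet_Ioi)
      calc |∫ θ, z (t - θ) j ∂(Δ.kernel i j)| ≤ ∫ θ, |z (t - θ) j| ∂(Δ.kernel i j) :=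
            abs_integral_le_integral_abs
        _ ≤ ∫ θ, (b j + (Ioi (t - T)).indicator (fun _ => B) θ) ∂(Δ.kernel i j) := by
            refine integral_mono_of_nonneg (Eventually.of_forall fun θ => abs_nonneg _) h2 ?_
            filter_upwards [ht i j] with θ hθ
            by_cases hθT : θ ∈ Ioi (t - T)
            · rw [indicator_of_mem hθT]
              linarith [hθ.1, hb j]
            · rw [indicator_of_notMem hθT, add_zero]
              exact hθ.2 (by simp at hθT; linarith)
        _ = _ := by
            rw [integral_add (integrable_const _) ((integrable_const _).indicator measurableSet_Ioi),
              integral_indicator_const _ measurableSet_Ioi, integral_const, hΔ.real_univ]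
            rfl
    _ ≤ _ := by
      rw [Finset.sum_add_distrib]
      exact add_le_add le_rfl (hT' t htT i).le

section Stability

variable {n n₀ p q : ℕ} {S : LFR n n₀ p q} {Δ : PositiveLTI n₀}
  {Δ₀ : Matrix (Fin n₀) (Fin n₀) ℝ} {x₀ : Fin n → ℝ} {h : ℝ → Fin n₀ → ℝ} {x : ℝ → Fin n → ℝ}
  {w₀ z₀ : ℝ → Fin n₀ → ℝ}

theorem LFR.IsTrajectory.eventually_le_of_rhs_le {G : (ℝ → Fin n₀ → ℝ) → ℝ → Fin n₀ → ℝ}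
    {w₁ : ℝ → Fin p → ℝ} (tr : S.IsTrajectory G x₀ h w₁ x w₀ z₀)
    (hw₁ : LocallyIntegrableOn w₁ (Ici 0)) {c d κ T : ℝ} (hT : 0 ≤ T) (hκ : 0 < κ) {i : Fin n}
    (hrhs : ∀ᵐ t, T ≤ t → 0 < c * x t i - d → c * S.rhs x w₀ w₁ t i ≤ -κ) :
    ∃ T', T ≤ T' ∧ ∀ t, T' ≤ t → c * x t i ≤ d := by
  have hmono : ∀ s t, T ≤ s → s ≤ t → max (c * x t i - d) 0 ≤ max (c * x s i - d) 0 :=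
    fun s t hs hst => by
      obtain ⟨-, h2⟩ := tr.max_zero_eq hw₁ c d (hT.trans hs) hst i
      rw [h2, add_le_iff_nonpos_right, intervalIntegral.integral_of_le hst]
      refine integral_nonpos_of_ae ((ae_restrict_iff' measurableSet_Ioc).2 ?_)
      filter_upwards [hrhs] with r hr hrI
      change ite _ _ _ ≤ 0
      split_ifs with hpos
      · linarith [hr (hs.trans hrI.1.le) hpos]
      · exact le_rfl
  have hex : ∃ T', T ≤ T' ∧ c * x T' i - d ≤ 0 := by
    by_contra! hcon
    -- If the excess stayed positive, decay at rate at least `κ` would bring it down to `-κ` by this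
    -- time.
    let t := T + (max (c * x T i - d) 0) / κ + 1
    have hq : 0 ≤ max (c * x T i - d) 0 / κ := div_nonneg (le_max_right _ _) hκ.le
    have hTt : T ≤ t := by simp only [t]; linarith
    obtain ⟨h1, h2⟩ := tr.max_zero_eq hw₁ c d hT hTt i
    have h3 : ∫ r in T..t, (if 0 < c * x r i - d then c * S.rhs x w₀ w₁ r i else 0) ≤
        ∫ r in T..t, -κ := by
      refine intervalIntegral.integral_mono_ae_restrict hTt h1 intervalIntegrable_const ?_
      refine (ae_restrict_iff' measurableSet_Icc).2 ?_
      filter_upwards [hrhs] with r hr hrI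
      rw [if_pos (hcon r hrI.1)]
      exact hr hrI.1 (hcon r hrI.1)
    rw [intervalIntegral.integral_const, smul_eq_mul] at h3
    have h4 : (t - T) * κ = max (c * x T i - d) 0 + κ := by
      simp only [t]
      field_simp
      ring
    have h5 := le_max_right (c * x t i - d) 0
    have h6 : (t - T) * -κ = -((t - T) * κ) := by ring
    rw [h6, h4] at h3
    linarith
  obtain ⟨T', hTT', hT'⟩ := hex
  refine ⟨T', hTT', fun t ht => ?_⟩
  have h1 := hmono T' t hTT' ht
  rw [max_eq_right hT'] at h1
  linarith [le_max_left (c * x t i - d) 0]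

/-- Positive vectors `v`, `w`, `z` on which the unforced positive interconnection strictly
decays. -/
structure LFR.IsDecayVector (S : LFR n n₀ p q) (Δ₀ : Matrix (Fin n₀) (Fin n₀) ℝ) (v : Fin n → ℝ)
    (w z : Fin n₀ → ℝ) : Prop where
  v_pos : ∀ i, 0 < v i
  w_pos : ∀ i, 0 < w i
  z_pos : ∀ i, 0 < z i
  state : ∀ i, (S.A *ᵥ v + S.E₀ *ᵥ w) i < 0
  loop_z : ∀ i, (S.C₀ *ᵥ v + S.F₀₀ *ᵥ w) i ≤ z i
  loop_w : ∀ i, (Δ₀ *ᵥ z) i < w i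

theorem LFR.IsTrajectory.abs_le_of_isDecayVector (hS : S.IsPositive) (hloop : S.PositiveLoop Δ₀)
    (hΔ : Δ.HasStaticGain Δ₀) {v : Fin n → ℝ} {w z : Fin n₀ → ℝ}
    (hd : S.IsDecayVector Δ₀ v w z) (tr : S.IsTrajectory Δ.apply x₀ h 0 x w₀ z₀) (hh : IsPast h)
    {c : ℝ} (hc : 0 ≤ c) (hx : ∀ i, |x₀ i| ≤ c * v i) (hhz : ∀ t < 0, ∀ i, |h t i| ≤ c * z i) :
    (∀ t, 0 ≤ t → ∀ i, |x t i| ≤ c * v i) ∧ ∀ᵐ t, 0 ≤ t → ∀ i, |z₀ t i| ≤ c * z i := by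
  have key : ∀ {x₀ : Fin n → ℝ} {h : ℝ → Fin n₀ → ℝ} {x : ℝ → Fin n → ℝ}
      {w₀ z₀ : ℝ → Fin n₀ → ℝ}, S.IsTrajectory Δ.apply x₀ h 0 x w₀ z₀ → IsPast h →
      (∀ i, x₀ i ≤ c * v i) → (∀ t < 0, ∀ i, h t i ≤ c * z i) →
      (∀ t, 0 ≤ t → ∀ i, x t i ≤ c * v i) ∧ ∀ᵐ t, 0 ≤ t → ∀ i, z₀ t i ≤ c * z i := by
    intro x₀ h x w₀ z₀ tr hh hx hhz
    have h1 := fun T : ℝ => tr.le_of_supersolution hS hloop hΔ (v := c • v) (w := c • w)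
      (z := c • z) (T := T) (locallyIntegrableOn_Ici_const 0) hh
      (fun t _ i => by
        simp only [mulVec_smul, Pi.zero_apply, mulVec_zero, add_zero, ← smul_add]
        exact mul_nonpos_of_nonneg_of_nonpos hc (hd.state i).le)
      (fun t _ i => by
        simp only [mulVec_smul, Pi.zero_apply, mulVec_zero, add_zero, ← smul_add]
        exact mul_le_mul_of_nonneg_left (hd.loop_z i) hc)
      (fun i => by
        rw [mulVec_smul]
        exact mul_le_mul_of_nonneg_left (hd.loop_w i).le hc) hx hhz
    refine ⟨fun t ht => (h1 t).1 t ⟨ht, le_rfl⟩, ?_⟩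
    refine (ae_restrict_iff' (s := Ici (0 : ℝ)) measurableSet_Ici).1 ?_
    refine ae_restrict_Ici_of_forall_le fun T => ?_
    have := (h1 T).2
    rw [ae_restrict_iff' measurableSet_Ici] at this
    filter_upwards [this] with t ht htT ht0 using (ht ht0 htT).2
  obtain ⟨h1, h2⟩ := key tr hh (fun i => (le_abs_self _).trans (hx i))
    fun t ht i => (le_abs_self _).trans (hhz t ht i)
  have htr' := tr.smul (-1)
  rw [smul_zero] at htr'
  obtain ⟨h3, h4⟩ := key htr' ⟨hh.1.const_smul (-1 : ℝ), hh.2.imp fun M hM t ht => by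
      simpa using hM t ht⟩ (fun i => by simpa using (neg_le_abs _).trans (hx i))
    fun t ht i => by simpa using (neg_le_abs _).trans (hhz t ht i)
  refine ⟨fun t ht i => abs_le.2 ⟨?_, h1 t ht i⟩, ?_⟩
  · have := h3 t ht i
    simp at this
    linarith
  · filter_upwards [h2, h4] with t h5 h6 ht i
    refine abs_le.2 ⟨?_, h5 ht i⟩
    have := h6 ht i
    simp at this
    linarith

/-- The contraction rate of a decay vector. -/
theorem LFR.IsDecayVector.exists_rate {v : Fin n → ℝ} {w z : Fin n₀ → ℝ}
    (hd : S.IsDecayVector Δ₀ v w z) : ∃ s : ℝ, 0 < s ∧ s < 1 ∧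
      (∀ i, (S.A *ᵥ v + S.E₀ *ᵥ w) i + (s - 1) * (S.A i i * v i) < 0) ∧
      ∀ i, (Δ₀ *ᵥ z) i < s * w i := by
  -- The second summand accounts for lowering the component `v i` alone to `s * v i`: even then,
  -- with all other components at their full bounds, component `i` still decays.
  have h1 : ∀ᶠ s : ℝ in 𝓝[<] 1, ∀ i, (S.A *ᵥ v + S.E₀ *ᵥ w) i + (s - 1) * (S.A i i * v i) < 0 :=
    eventually_all.2 fun i => by
      have : Continuous fun s : ℝ => (S.A *ᵥ v + S.E₀ *ᵥ w) i + (s - 1) * (S.A i i * v i) := by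
        fun_prop
      have := (this.tendsto 1).mono_left (nhdsWithin_le_nhds (s := Iio 1))
      exact this.eventually (gt_mem_nhds (by simpa using hd.state i))
  have h2 : ∀ᶠ s : ℝ in 𝓝[<] 1, ∀ i, (Δ₀ *ᵥ z) i < s * w i :=
    eventually_all.2 fun i => by
      have : Continuous fun s : ℝ => s * w i := by fun_prop
      have := (this.tendsto 1).mono_left (nhdsWithin_le_nhds (s := Iio 1))
      exact this.eventually (lt_mem_nhds (by simpa using hd.loop_w i))
  have h3 : ∀ᶠ s : ℝ in 𝓝[<] 1, 0 < s ∧ s < 1 := by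
    filter_upwards [Ioo_mem_nhdsLT (zero_lt_one' ℝ)] with s hs using hs
  obtain ⟨s, hs1, hs2, hs3⟩ := (h1.and (h2.and h3)).exists
  exact ⟨s, hs3.1, hs3.2, hs1, hs2⟩

/-- The improvement travels around the loop: from `z₀` to `w₀` because old values are forgotten,
from `w₀` to `x` because any component above the lower level decreases at a definite rate, and from
both back to `z₀` algebraically. Iteration gives convergence. -/
theorem LFR.IsTrajectory.eventually_abs_le_mul (hS : S.IsPositive)
    (hΔ : Δ.HasStaticGain Δ₀) {v : Fin n → ℝ} {w z : Fin n₀ → ℝ}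
    (hd : S.IsDecayVector Δ₀ v w z) {s : ℝ} (hs0 : 0 < s)
    (hs1 : ∀ i, (S.A *ᵥ v + S.E₀ *ᵥ w) i + (s - 1) * (S.A i i * v i) < 0)
    (hs2 : ∀ i, (Δ₀ *ᵥ z) i < s * w i) (hs3 : s < 1)
    (tr : S.IsTrajectory Δ.apply x₀ h 0 x w₀ z₀) {B : ℝ}
    (hB : ∀ᵐ t, ∀ j, |z₀ t j| ≤ B) {c : ℝ} (hc : 0 < c)
    (hev : ∃ T, 0 ≤ T ∧ (∀ t, T ≤ t → ∀ i, |x t i| ≤ c * v i) ∧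
      ∀ᵐ t, T ≤ t → ∀ i, |z₀ t i| ≤ c * z i) :
    ∃ T, 0 ≤ T ∧ (∀ t, T ≤ t → ∀ i, |x t i| ≤ s * c * v i) ∧
      ∀ᵐ t, T ≤ t → ∀ i, |z₀ t i| ≤ s * c * z i := by
  obtain ⟨T, hT0, hTx, hTz⟩ := hev
  -- The gap between `Δ₀ *ᵥ z` and `s • w` leaves room `δ` for the contribution of the distant past.
  obtain ⟨δ, hδ, hδw⟩ : ∃ δ > 0, ∀ i, c * (Δ₀ *ᵥ z) i + δ ≤ s * c * w i := by
    have : ∀ᶠ δ : ℝ in 𝓝[>] 0, ∀ i, c * (Δ₀ *ᵥ z) i + δ < s * c * w i := eventually_all.2 fun i => by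
      have h1 : Continuous fun δ : ℝ => c * (Δ₀ *ᵥ z) i + δ := by fun_prop
      refine ((h1.tendsto 0).mono_left nhdsWithin_le_nhds).eventually (gt_mem_nhds ?_)
      have := mul_lt_mul_of_pos_left (hs2 i) hc
      linarith
    obtain ⟨δ, h1, h2⟩ := (this.and self_mem_nhdsWithin).exists
    exact ⟨δ, h2, fun i => (h1 i).le⟩
  obtain ⟨T₁, hT₁⟩ := PositiveLTI.eventually_abs_apply_le hΔ (b := c • z)
    (fun j => mul_nonneg hc.le (hd.z_pos j).le) hB hTz hδ
  have hw : ∀ᵐ t, max T T₁ ≤ t → ∀ i, |w₀ t i| ≤ s * c * w i := by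
    have := tr.loop_w₀
    rw [ae_restrict_iff' measurableSet_Ici] at this
    filter_upwards [hT₁, this] with t h1 h2 ht i
    rw [h2 (hT0.trans ((le_max_left _ _).trans ht))]
    refine (h1 ((le_max_right _ _).trans ht) i).trans ?_
    rw [mulVec_smul]
    exact hδw i
  have hT0' : 0 ≤ max T T₁ := hT0.trans (le_max_left _ _)
  -- one-sided bounds of the state components
  have hx : ∀ ε : ℝ, ε = 1 ∨ ε = -1 → ∀ i, ∃ T', max T T₁ ≤ T' ∧
      ∀ t, T' ≤ t → ε * x t i ≤ s * c * v i := fun ε hε i => by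
    have hε' : |ε| = 1 := by rcases hε with rfl | rfl <;> simp
    refine tr.eventually_le_of_rhs_le (locallyIntegrableOn_Ici_const 0) hT0'
      (κ := -(c * ((S.A *ᵥ v + S.E₀ *ᵥ w) i + (s - 1) * (S.A i i * v i))))
      (by linarith [mul_neg_of_pos_of_neg hc (hs1 i)]) ?_
    filter_upwards [hw] with t ht htT hpos
    have hεx : ∀ j, (ε • x t) j ≤ c * v j := fun j => by
      refine (le_abs_self _).trans ?_
      rw [Pi.smul_apply, smul_eq_mul, abs_mul, hε', one_mul]
      exact hTx t ((le_max_left _ _).trans htT) j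
    have hεw : ∀ j, (ε • w₀ t) j ≤ (c • w) j := fun j => by
      refine (le_abs_self _).trans ?_
      rw [Pi.smul_apply, smul_eq_mul, abs_mul, hε', one_mul]
      refine (ht htT j).trans ?_
      rw [mul_assoc]
      exact mul_le_of_le_one_left (mul_nonneg hc.le (hd.w_pos j).le) hs3.le
    have h1 := mulVec_mono hS.E₀ hεw i
    -- The diagonal term is kept exact, so that `A i i ≤ 0` and `ε * x t i > s * c * v i` can be
    -- used in it.
    have h2 : (S.A *ᵥ (ε • x t)) i ≤ (S.A *ᵥ (c • v)) i + S.A i i * (ε * x t i - c * v i) := by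
      change ∑ j, S.A i j * (ε • x t) j ≤ (∑ j, S.A i j * (c • v) j) + _
      rw [← Finset.add_sum_erase _ _ (Finset.mem_univ i),
        ← Finset.add_sum_erase _ (fun j => S.A i j * (c • v) j) (Finset.mem_univ i)]
      have h3 : ∑ j ∈ Finset.univ.erase i, S.A i j * (ε • x t) j ≤
          ∑ j ∈ Finset.univ.erase i, S.A i j * (c • v) j :=
        Finset.sum_le_sum fun j hj => mul_le_mul_of_nonneg_left (hεx j)
          (hS.metzler i j (Finset.ne_of_mem_erase hj).symm)
      simp only [Pi.smul_apply, smul_eq_mul] at *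
      linarith
    have hA : S.A i i ≤ 0 := by
      by_contra! hA
      have h3 : 0 ≤ (S.A *ᵥ v) i := by
        refine dotProduct_nonneg_of_nonneg (fun j => ?_) fun j => (hd.v_pos j).le
        change 0 ≤ S.A i j
        by_cases hij : i = j
        · subst hij; exact hA.le
        · exact hS.metzler i j hij
      have h4 := mulVec_nonneg' hS.E₀ (fun j => (hd.w_pos j).le) i
      have := hd.state i
      simp only [Pi.add_apply] at this
      linarith
    have h5 := mul_le_mul_of_nonpos_left hpos.le hA
    simp only [LFR.rhs, mulVec_smul, Pi.smul_apply, Pi.add_apply, smul_eq_mul, Pi.zero_apply,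
      mulVec_zero, add_zero] at *
    linarith
  choose T₂ hT₂ hT₂' using fun i => hx 1 (Or.inl rfl) i
  choose T₃ hT₃ hT₃' using fun i => hx (-1) (Or.inr rfl) i
  obtain ⟨T₄, hT₄⟩ : ∃ T₄, ∀ i, T₂ i ≤ T₄ ∧ T₃ i ≤ T₄ := by
    obtain ⟨a, ha⟩ := (finite_range T₂).bddAbove
    obtain ⟨b, hb⟩ := (finite_range T₃).bddAbove
    exact ⟨max a b, fun i => ⟨(ha ⟨i, rfl⟩).trans (le_max_left _ _),
      (hb ⟨i, rfl⟩).trans (le_max_right _ _)⟩⟩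
  have hxb : ∀ t, T₄ ≤ t → ∀ i, |x t i| ≤ s * c * v i := fun t ht i => by
    have h1 := hT₂' i t ((hT₄ i).1.trans ht)
    have h2 := hT₃' i t ((hT₄ i).2.trans ht)
    exact abs_le.2 ⟨by linarith, by linarith⟩
  refine ⟨max (max T T₁) T₄, hT0'.trans (le_max_left _ _),
    fun t ht => hxb t ((le_max_right _ _).trans ht), ?_⟩
  have hz := tr.loop_z₀
  rw [ae_restrict_iff' measurableSet_Ici] at hz
  filter_upwards [hw, hz] with t h1 h2 ht i
  have h3 := h1 ((le_max_left _ _).trans ht)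
  have h4 := hxb t ((le_max_right _ _).trans ht)
  have h5 : ∀ {a b : ℕ} {M : Matrix (Fin a) (Fin b) ℝ}, EntrywiseNonneg M →
      ∀ {u r : Fin b → ℝ}, (∀ j, |u j| ≤ s * c * r j) → ∀ i, |(M *ᵥ u) i| ≤ s * c * (M *ᵥ r) i :=
    fun {a b M} hM {u r} hu i => by
      change |∑ j, M i j * u j| ≤ s * c * ∑ j, M i j * r j
      rw [Finset.mul_sum]
      refine (Finset.abs_sum_le_sum_abs _ _).trans (Finset.sum_le_sum fun j _ => ?_)
      rw [abs_mul, abs_of_nonneg (hM i j)]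
      linarith [mul_le_mul_of_nonneg_left (hu j) (hM i j)]
  rw [h2 (hT0'.trans ((le_max_left _ _).trans ht))]
  have h6 := h5 hS.C₀ h4 i
  have h7 := h5 hS.F₀₀ h3 i
  have h8 := mul_le_mul_of_nonneg_left (hd.loop_z i) (mul_pos hs0 hc).le
  simp only [Pi.zero_apply, mulVec_zero, add_zero, Pi.add_apply] at *
  have := abs_add_le ((S.C₀ *ᵥ x t) i) ((S.F₀₀ *ᵥ w₀ t) i)
  linarith

end Stability

theorem exists_pos_forall_mul_lt {ι : Type*} [Finite ι] (a : ι → ℝ) {ε : ℝ} (hε : 0 < ε) :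
    ∃ c : ℝ, 0 < c ∧ ∀ i, c * a i < ε := by
  have : ∀ᶠ c : ℝ in 𝓝[>] 0, ∀ i, c * a i < ε := eventually_all.2 fun i => by
    have h1 : Continuous fun c : ℝ => c * a i := by fun_prop
    exact ((h1.tendsto 0).mono_left nhdsWithin_le_nhds).eventually (gt_mem_nhds (by simpa))
  obtain ⟨c, h1, h2⟩ := (this.and self_mem_nhdsWithin).exists
  exact ⟨c, h2, h1⟩

theorem exists_pos_forall_le_mul {ι : Type*} [Finite ι] {a : ι → ℝ} (ha : ∀ i, 0 < a i) (M : ℝ) :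
    ∃ c₀ : ℝ, ∀ c, c₀ ≤ c → ∀ i, M ≤ c * a i := by
  have : ∀ᶠ c : ℝ in atTop, ∀ i, M ≤ c * a i := eventually_all.2 fun i =>
    (tendsto_id.atTop_mul_const (ha i)).eventually_ge_atTop M
  exact eventually_atTop.1 this

section Stability

variable {n n₀ p q : ℕ} {S : LFR n n₀ p q} {Δ : PositiveLTI n₀}
  {Δ₀ : Matrix (Fin n₀) (Fin n₀) ℝ} {v : Fin n → ℝ} {w z : Fin n₀ → ℝ}

/-- Eliminating `z` turns the unforced interconnection into a Metzler block matrix with decaying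
left vector `(l, ψ)`; its positive right vector is `(v, w)`. -/
theorem LFR.exists_isDecayVector (hS : S.IsPositive) (hΔ₀ : EntrywiseNonneg Δ₀)
    {l : Fin n → ℝ} {ψ : Fin n₀ → ℝ} (hl : ∀ i, 0 < l i) (hψ : ∀ i, 0 ≤ ψ i)
    (h1 : ∀ i, (l ᵥ* S.A + ψ ᵥ* (Δ₀ * S.C₀)) i < 0)
    (h2 : ∀ i, (l ᵥ* S.E₀ + ψ ᵥ* (Δ₀ * S.F₀₀)) i < ψ i) :
    ∃ v w z, S.IsDecayVector Δ₀ v w z := by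
  have hmul : ∀ {b : ℕ} {M : Matrix (Fin n₀) (Fin b) ℝ}, EntrywiseNonneg M →
      EntrywiseNonneg (Δ₀ * M) := fun hM i j => by
    rw [Matrix.mul_apply]
    exact Finset.sum_nonneg fun k _ => mul_nonneg (hΔ₀ i k) (hM k j)
  have hψ' : ∀ i, 0 < ψ i := fun i => lt_of_le_of_lt (add_nonneg
    (vecMul_nonneg' hS.E₀ (fun j => (hl j).le) i) (vecMul_nonneg' (hmul hS.F₀₀) hψ i)) (h2 i)
  let P : Matrix (Fin n ⊕ Fin n₀) (Fin n ⊕ Fin n₀) ℝ :=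
    fromBlocks S.A S.E₀ (Δ₀ * S.C₀) (Δ₀ * S.F₀₀ - 1)
  have hP : ∀ i j, i ≠ j → 0 ≤ P i j := by
    rintro (i | i) (j | j) hij
    · exact hS.metzler i j fun h => hij (congrArg _ h)
    · exact hS.E₀ i j
    · exact hmul hS.C₀ i j
    · have hij' : i ≠ j := fun h => hij (congrArg _ h)
      simpa [P, hij'] using hmul hS.F₀₀ i j
  obtain ⟨y, hy, hPy⟩ := exists_pos_mulVec_eq_neg_one hP (l := Sum.elim l ψ)
    (by rintro (i | i); exacts [hl i, hψ' i]) (by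
      rintro (i | i)
      · simpa [P, vecMul_fromBlocks] using h1 i
      · have := h2 i
        simp only [Pi.add_apply] at this
        simp only [P, vecMul_fromBlocks, Sum.elim_inr, Sum.elim_comp_inl, Sum.elim_comp_inr,
          vecMul_sub, vecMul_one, Pi.add_apply, Pi.sub_apply]
        linarith)
  -- The vector `C₀ *ᵥ v + F₀₀ *ᵥ w` may have zero entries. Adding `η` makes it positive, and `η` is
  -- small enough to use up less than the slack `1` in the rows of `w`.
  obtain ⟨η, hη, hη1⟩ := exists_pos_forall_mul_lt (fun i => (Δ₀ *ᵥ 1) i) one_pos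
  let v : Fin n → ℝ := y ∘ Sum.inl
  let w : Fin n₀ → ℝ := y ∘ Sum.inr
  have hv : ∀ i, 0 < v i := fun i => hy _
  have hw : ∀ i, 0 < w i := fun i => hy _
  have hz : ∀ i, 0 ≤ (S.C₀ *ᵥ v + S.F₀₀ *ᵥ w) i := fun i => add_nonneg
    (mulVec_nonneg' hS.C₀ (fun j => (hv j).le) i) (mulVec_nonneg' hS.F₀₀ (fun j => (hw j).le) i)
  refine ⟨v, w, S.C₀ *ᵥ v + S.F₀₀ *ᵥ w + η • 1, hv, hw, fun i => ?_, fun i => ?_, fun i => ?_,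
    fun i => ?_⟩
  · exact add_pos_of_nonneg_of_pos (hz i) (by simpa using hη)
  · have := hPy (Sum.inl i)
    simp only [P, fromBlocks_mulVec, Sum.elim_inl] at this
    rw [this]
    norm_num
  · rw [Pi.add_apply _ (η • 1)]
    exact le_add_of_nonneg_right (by simpa using hη.le)
  · have := hPy (Sum.inr i)
    have h3 := hη1 i
    simp only [P, fromBlocks_mulVec, Sum.elim_inr, sub_mulVec, one_mulVec, Pi.add_apply,
      Pi.sub_apply] at this
    simp only [mulVec_add, mulVec_mulVec, mulVec_smul, Pi.add_apply, Pi.smul_apply, smul_eq_mul]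
    linarith

theorem LFR.IsDecayVector.lyapunov (hS : S.IsPositive) (hloop : S.PositiveLoop Δ₀)
    (hΔ : Δ.HasStaticGain Δ₀) (hd : S.IsDecayVector Δ₀ v w z) : ∀ ε > 0, ∃ δ > 0,
    ∀ (x₀ : Fin n → ℝ) (h : ℝ → Fin n₀ → ℝ) x w₀ z₀,
    ‖x₀‖ ≤ δ → IsPast h → (∀ t < 0, ‖h t‖ ≤ δ) → S.IsTrajectory Δ.apply x₀ h 0 x w₀ z₀ →
      (∀ t, 0 ≤ t → ‖x t‖ ≤ ε) ∧ ∀ᵐ t ∂volume.restrict (Ici 0), ‖z₀ t‖ ≤ ε := by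
  intro ε hε
  obtain ⟨c, hc, hcε⟩ := exists_pos_forall_mul_lt (Sum.elim v z) hε
  have hpos : ∀ i, 0 < c * Sum.elim v z i := by
    rintro (i | i)
    exacts [mul_pos hc (hd.v_pos i), mul_pos hc (hd.z_pos i)]
  -- `δ` lies below all entries of `c • v` and `c • z`, which themselves lie below `ε`.
  obtain ⟨δ, hδ, hδc⟩ := exists_pos_forall_mul_lt (fun i => (c * Sum.elim v z i)⁻¹) one_pos
  have hδc' : ∀ i, δ ≤ c * Sum.elim v z i := fun i => by
    have := hδc i
    rw [mul_inv_lt_iff₀ (hpos i), one_mul] at this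
    exact this.le
  refine ⟨δ, hδ, fun x₀ h x w₀ z₀ hx hh hhδ tr => ?_⟩
  obtain ⟨h1, h2⟩ := tr.abs_le_of_isDecayVector hS hloop hΔ hd hh hc.le
    (fun i => ((norm_le_pi_norm x₀ i).trans hx).trans (hδc' (Sum.inl i)))
    (fun t ht i => ((norm_le_pi_norm (h t) i).trans (hhδ t ht)).trans (hδc' (Sum.inr i)))
  refine ⟨fun t ht => (pi_norm_le_iff_of_nonneg hε.le).2 fun i =>
    (h1 t ht i).trans (hcε (Sum.inl i)).le, ?_⟩
  refine (ae_restrict_iff' measurableSet_Ici).2 ?_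
  filter_upwards [h2] with t h3 ht
  exact (pi_norm_le_iff_of_nonneg hε.le).2 fun i => (h3 ht i).trans (hcε (Sum.inr i)).le

theorem LFR.IsDecayVector.attractive (hS : S.IsPositive) (hloop : S.PositiveLoop Δ₀)
    (hΔ : Δ.HasStaticGain Δ₀) (hd : S.IsDecayVector Δ₀ v w z)
    (x₀ : Fin n → ℝ) (h : ℝ → Fin n₀ → ℝ) (x : ℝ → Fin n → ℝ) (w₀ z₀ : ℝ → Fin n₀ → ℝ)
    (hh : IsPast h) (tr : S.IsTrajectory Δ.apply x₀ h 0 x w₀ z₀) :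
    Tendsto x atTop (𝓝 0) ∧ Tendsto z₀ (atTop ⊓ ae volume) (𝓝 0) := by
  obtain ⟨-, M, hM⟩ := id hh
  have hvz : ∀ i, 0 < Sum.elim v z i := by
    rintro (i | i)
    exacts [hd.v_pos i, hd.z_pos i]
  -- A multiple of the decay vector large enough to dominate the initial state and the past.
  obtain ⟨c₀, hc₀⟩ := exists_pos_forall_le_mul hvz (max M ‖x₀‖)
  let c := max c₀ 1
  have hc : 0 < c := lt_max_of_lt_right one_pos
  have hcv := hc₀ c (le_max_left _ _)
  have hhz : ∀ t < 0, ∀ i, |h t i| ≤ c * z i := fun t ht i =>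
    ((norm_le_pi_norm (h t) i).trans (hM t ht)).trans
      ((le_max_left _ _).trans (hcv (Sum.inr i)))
  obtain ⟨h1, h2⟩ := tr.abs_le_of_isDecayVector hS hloop hΔ hd hh hc.le
    (fun i => (norm_le_pi_norm x₀ i).trans ((le_max_right _ _).trans (hcv (Sum.inl i)))) hhz
  have hB : ∀ᵐ t, ∀ j, |z₀ t j| ≤ ∑ i, c * z i := by
    filter_upwards [h2] with t h3 j
    refine le_trans ?_ (Finset.single_le_sum (f := fun i => c * z i)
      (fun i _ => mul_nonneg hc.le (hd.z_pos i).le) (Finset.mem_univ j))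
    rcases lt_or_ge t 0 with ht | ht
    · rw [tr.past t ht]
      exact hhz t ht j
    · exact h3 ht j
  obtain ⟨s, hs0, hs1, hs2, hs3⟩ := hd.exists_rate
  have key : ∀ k : ℕ, ∃ T, 0 ≤ T ∧ (∀ t, T ≤ t → ∀ i, |x t i| ≤ s ^ k * c * v i) ∧
      ∀ᵐ t, T ≤ t → ∀ i, |z₀ t i| ≤ s ^ k * c * z i := fun k => by
    induction k with
    | zero => simpa using ⟨0, le_rfl, h1, h2⟩
    | succ k ih =>
      have := tr.eventually_abs_le_mul hS hΔ hd hs0 hs2 hs3 hs1 hB (c := s ^ k * c)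
        (by positivity) ih
      simpa only [pow_succ', mul_assoc] using this
  have hsmall : ∀ ε > 0, ∃ T, (∀ t, T ≤ t → ‖x t‖ < ε) ∧ ∀ᵐ t, T ≤ t → ‖z₀ t‖ < ε := fun ε hε => by
    have : ∀ᶠ k : ℕ in atTop, ∀ i, s ^ k * c * Sum.elim v z i < ε := eventually_all.2 fun i => by
      have h3 := ((tendsto_pow_atTop_nhds_zero_of_lt_one hs0.le hs1).mul_const c).mul_const
        (Sum.elim v z i)
      rw [zero_mul, zero_mul] at h3
      exact h3.eventually (gt_mem_nhds hε)
    obtain ⟨k, hk⟩ := this.exists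
    obtain ⟨T, -, hT1, hT2⟩ := key k
    refine ⟨T, fun t ht => (pi_norm_lt_iff hε).2 fun i => (hT1 t ht i).trans_lt (hk (Sum.inl i)), ?_⟩
    filter_upwards [hT2] with t h3 ht
    exact (pi_norm_lt_iff hε).2 fun i => (h3 ht i).trans_lt (hk (Sum.inr i))
  constructor
  · refine Metric.tendsto_nhds.2 fun ε hε => ?_
    obtain ⟨T, hT, -⟩ := hsmall ε hε
    filter_upwards [eventually_ge_atTop T] with t ht
    simpa using hT t ht
  · refine Metric.tendsto_nhds.2 fun ε hε => ?_
    obtain ⟨T, -, hT⟩ := hsmall ε hε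
    have h3 : ∀ᶠ t in atTop ⊓ ae volume, T ≤ t := (eventually_ge_atTop T).filter_mono inf_le_left
    have h4 : ∀ᶠ t in atTop ⊓ ae volume, T ≤ t → ‖z₀ t‖ < ε := hT.filter_mono inf_le_right
    filter_upwards [h3, h4] with t h5 h6
    simpa using h6 h5

end Stability

/-! ### From finite horizons to the `L₁`-gain -/

section Gain

variable {k : ℕ}

theorem ofReal_integral_eq_lintegral_Icc {f : ℝ → Fin k → ℝ}
    (hf : LocallyIntegrableOn f (Ici 0)) {T : ℝ} (hT : 0 ≤ T) :
    ENNReal.ofReal (∫ t in (0 : ℝ)..T, ∑ i, |f t i|) = ∫⁻ t in Icc 0 T, ∑ i, ‖f t i‖ₑ := by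
  have h1 : LocallyIntegrableOn (fun t => ∑ i, |f t i|) (Ici 0) :=
    LocallyIntegrableOn.finsetSum _ fun i => (hf.eval i).abs
  rw [intervalIntegral.integral_of_le hT, ← integral_Icc_eq_integral_Ioc,
    ofReal_integral_eq_lintegral_ofReal (h1.integrableOn_Icc T)
      (Eventually.of_forall fun t => Finset.sum_nonneg fun i _ => abs_nonneg _)]
  refine lintegral_congr fun t => ?_
  rw [ENNReal.ofReal_sum_of_nonneg fun i _ => abs_nonneg _]
  refine Finset.sum_congr rfl fun i _ => ?_
  rw [← Real.norm_eq_abs, ofReal_norm]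

theorem ofReal_integral_le_L1norm {f : ℝ → Fin k → ℝ} (hf : LocallyIntegrableOn f (Ici 0)) {T : ℝ}
    (hT : 0 ≤ T) : ENNReal.ofReal (∫ t in (0 : ℝ)..T, ∑ i, |f t i|) ≤ L1norm f := by
  rw [ofReal_integral_eq_lintegral_Icc hf hT]
  exact lintegral_mono_set Icc_subset_Ici_self

theorem L1norm_le_of_forall_integral_le {f : ℝ → Fin k → ℝ} (hf : LocallyIntegrableOn f (Ici 0))
    {C : ENNReal}
    (hC : ∀ T : ℝ, 0 ≤ T → ENNReal.ofReal (∫ t in (0 : ℝ)..T, ∑ i, |f t i|) ≤ C) :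
    L1norm f ≤ C := by
  have h1 : Ici (0 : ℝ) = ⋃ m : ℕ, Icc (0 : ℝ) m := by
    ext t
    simp only [mem_Ici, mem_iUnion, mem_Icc, exists_and_left]
    exact ⟨fun h => ⟨h, exists_nat_ge t⟩, fun h => h.1⟩
  rw [L1norm, h1, setLIntegral_iUnion_of_directed _ ((monotone_nat_of_le_succ fun m =>
    Icc_subset_Icc_right (by push_cast; linarith)).directed_le)]
  refine iSup_le fun m => ?_
  rw [← ofReal_integral_eq_lintegral_Icc hf m.cast_nonneg]
  exact hC m m.cast_nonneg

theorem LFR.L1gain_le {n n₀ p q : ℕ} {S : LFR n n₀ p q} {Δ : PositiveLTI n₀}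
    {Δ₀ : Matrix (Fin n₀) (Fin n₀) ℝ} (hS : S.IsPositive) (hΔ : Δ.HasStaticGain Δ₀)
    {l : Fin n → ℝ} {ψ : Fin n₀ → ℝ} {γ : ℝ} (hγ : 0 ≤ γ) (hl : ∀ i, 0 ≤ l i) (hψ : ∀ i, 0 ≤ ψ i)
    (h1 : ∀ i, (l ᵥ* S.A + ψ ᵥ* (Δ₀ * S.C₀) + 1 ᵥ* S.C₁) i ≤ 0)
    (h2 : ∀ i, (l ᵥ* S.E₀ + ψ ᵥ* (Δ₀ * S.F₀₀) + 1 ᵥ* S.F₁₀) i ≤ ψ i)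
    (h3 : ∀ i, (l ᵥ* S.E₁ + ψ ᵥ* (Δ₀ * S.F₀₁) + 1 ᵥ* S.F₁₁) i ≤ γ) :
    S.L1gain Δ.apply ≤ ENNReal.ofReal γ := by
  refine sSup_le ?_
  rintro r ⟨w₁, x, w₀, z₀, hw₁, hnorm, tr, rfl⟩
  have hw₁' : LocallyIntegrableOn w₁ (Ici 0) := hw₁.locallyIntegrableOn
  refine L1norm_le_of_forall_integral_le
    (((tr.integrable_x.mulVec _).add (tr.integrable_w₀.mulVec _)).add (hw₁'.mulVec _))
    fun T hT => ?_
  have h4 := tr.integral_output_le hS hΔ hw₁' hl hψ h1 h2 h3 hT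
  refine (ENNReal.ofReal_le_ofReal h4).trans ?_
  rw [ENNReal.ofReal_mul hγ]
  calc _ ≤ ENNReal.ofReal γ * L1norm w₁ := by
        gcongr
        exact ofReal_integral_le_L1norm hw₁' hT
    _ = _ := by rw [hnorm, mul_one]

end Gain

/-! ### Renewal equations in weighted `L₁`-spaces -/

theorem causalConv_congr_ae {κ : Measure ℝ} [IsFiniteMeasure κ] {f g : ℝ → ℝ}
    (h : ∀ᵐ t, 0 ≤ t → f t = g t) : ∀ᵐ t, causalConv κ f t = causalConv κ g t := by
  have h1 : (Ici 0).indicator f =ᵐ[volume] (Ici 0).indicator g := by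
    filter_upwards [h] with t ht
    by_cases h0 : t ∈ Ici (0 : ℝ)
    · rw [indicator_of_mem h0, indicator_of_mem h0, ht h0]
    · rw [indicator_of_notMem h0, indicator_of_notMem h0]
  filter_upwards [ae_comp_sub_eq (μ := κ) h1] with t ht
  rw [causalConv_eq_integral_indicator, causalConv_eq_integral_indicator]
  exact integral_congr_ae ht

theorem integrable_causalConv (κ : Measure ℝ) [IsFiniteMeasure κ] {f : ℝ → ℝ}
    (hf : Integrable f) : Integrable (causalConv κ f) := by
  have h1 : causalConv κ f = fun t => ∫ θ, (Ici 0).indicator f (t - θ) ∂κ :=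
    funext fun t => causalConv_eq_integral_indicator κ f t
  rw [h1]
  exact integrable_integral_comp_sub (hf.indicator measurableSet_Ici)

/-- Causal convolution as an operator on `L₁(ℝ)`. -/
noncomputable def causalConvL1 (κ : Measure ℝ) [IsFiniteMeasure κ] :
    (ℝ →₁[volume] ℝ) →L[ℝ] (ℝ →₁[volume] ℝ) :=
  LinearMap.mkContinuous
    { toFun := fun f => (integrable_causalConv κ (L1.integrable_coeFn f)).toL1 _
      map_add' := fun f g => by
        rw [← Integrable.toL1_add, Integrable.toL1_eq_toL1_iff]
        have h1 := (L1.integrable_coeFn f).indicator (measurableSet_Ici (a := (0 : ℝ)))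
        have h2 := (L1.integrable_coeFn g).indicator (measurableSet_Ici (a := (0 : ℝ)))
        filter_upwards [causalConv_congr_ae (κ := κ) (g := fun t => f t + g t)
          ((Lp.coeFn_add f g).mono fun t ht _ => ht), ae_integrable_comp_sub (μ := κ) h1,
          ae_integrable_comp_sub (μ := κ) h2] with t ht hi1 hi2
        rw [ht, Pi.add_apply]
        simp only [causalConv_eq_integral_indicator]
        rw [← integral_add hi1 hi2]
        refine integral_congr_ae (Eventually.of_forall fun θ => ?_)
        exact congrFun (indicator_add (Ici 0) (⇑f) (⇑g)) (t - θ)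
      map_smul' := fun c f => by
        rw [RingHom.id_apply, ← Integrable.toL1_smul, Integrable.toL1_eq_toL1_iff]
        filter_upwards [causalConv_congr_ae (κ := κ) (g := fun t => c * f t)
          ((Lp.coeFn_smul c f).mono fun t ht _ => ht)] with t ht
        rw [ht, smul_eq_mul, causalConv, causalConv, integral_const_mul] }
    (κ.real univ) fun f => by
      have hi := (L1.integrable_coeFn f).norm.indicator (measurableSet_Ici (a := (0 : ℝ)))
      simp only [LinearMap.coe_mk, AddHom.coe_mk]
      rw [L1.norm_of_fun_eq_integral_norm, L1.norm_eq_integral_norm]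
      calc ∫ t, ‖causalConv κ f t‖
          ≤ ∫ t, ∫ θ, (Ici 0).indicator (fun s => ‖f s‖) (t - θ) ∂κ := by
            refine integral_mono (integrable_causalConv κ (L1.integrable_coeFn f)).norm
              (integrable_integral_comp_sub hi) fun t => ?_
            change ‖causalConv κ f t‖ ≤ _
            rw [causalConv_eq_integral_indicator]
            refine (norm_integral_le_integral_norm _).trans (le_of_eq ?_)
            simp only [norm_indicator_eq_indicator_norm]
        _ = κ.real univ * ∫ t, (Ici 0).indicator (fun s => ‖f s‖) t :=
            integral_integral_comp_sub hi
        _ ≤ κ.real univ * ∫ t, ‖f t‖ := by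
            refine mul_le_mul_of_nonneg_left ?_ measureReal_nonneg
            refine integral_mono hi (L1.integrable_coeFn f).norm fun t => ?_
            exact indicator_le_self' (fun _ _ => norm_nonneg _) t

theorem coeFn_causalConvL1 (κ : Measure ℝ) [IsFiniteMeasure κ] (f : ℝ →₁[volume] ℝ) :
    causalConvL1 κ f =ᵐ[volume] causalConv κ f :=
  (integrable_causalConv κ (L1.integrable_coeFn f)).coeFn_toL1

theorem norm_causalConvL1_apply_le (κ : Measure ℝ) [IsFiniteMeasure κ] (f : ℝ →₁[volume] ℝ) :
    ‖causalConvL1 κ f‖ ≤ κ.real univ * ‖f‖ :=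
  (causalConvL1 κ).le_of_opNorm_le (LinearMap.mkContinuous_norm_le _ measureReal_nonneg _) f

section Renewal

variable {ι : Type*} [Fintype ι]

/-- Solvability in `L₁` of a system of renewal equations with small kernels. -/
theorem exists_integrable_renewal_solution (κ : ι → ι → Measure ℝ)
    (hfin : ∀ i j, IsFiniteMeasure (κ i j)) (H : Matrix ι ι ℝ) {d g : ι → ℝ → ℝ}
    (hd : ∀ i, Integrable (d i)) (hg : ∀ i, Integrable (g i)) {v : ι → ℝ} (hv : ∀ i, 0 < v i)
    (hκv : ∀ i, ∑ j, (κ i j).real univ * ∑ k, |H j k| * v k < v i) :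
    ∃ y : ι → ℝ → ℝ, (∀ i, Integrable (y i)) ∧ ∀ i, ∀ᵐ t, y i t =
      g i t + ∑ j, causalConv (κ i j) (fun s => ∑ k, H j k * y k s + d j s) t := by
  -- The fixed points of `T` are the solutions. Its Lipschitz constants are the kernel masses
  -- multiplied by `|H|`, so the hypothesis on `v` is the contraction condition.
  let T : (ι → (ℝ →₁[volume] ℝ)) → ι → (ℝ →₁[volume] ℝ) := fun y i =>
    (hg i).toL1 + ∑ j, causalConvL1 (κ i j) (∑ k, H j k • y k + (hd j).toL1)
  obtain ⟨y, hy⟩ := exists_fixedPoint_of_lipschitz_matrix T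
    (fun i k => ∑ j, (κ i j).real univ * |H j k|)
    (fun i k => Finset.sum_nonneg fun j _ => mul_nonneg measureReal_nonneg (abs_nonneg _))
    (fun y y' i => by
      have h1 : T y i - T y' i = ∑ j, causalConvL1 (κ i j) (∑ k, H j k • (y k - y' k)) := by
        simp only [T, add_sub_add_left_eq_sub, ← Finset.sum_sub_distrib, ← map_sub,
          add_sub_add_right_eq_sub, smul_sub]
      rw [h1]
      calc _ ≤ ∑ j, (κ i j).real univ * ∑ k, |H j k| * ‖y k - y' k‖ := by
            refine (norm_sum_le _ _).trans (Finset.sum_le_sum fun j _ => ?_)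
            refine (norm_causalConvL1_apply_le _ _).trans
              (mul_le_mul_of_nonneg_left ?_ measureReal_nonneg)
            refine (norm_sum_le _ _).trans (Finset.sum_le_sum fun k _ => ?_)
            rw [norm_smul, Real.norm_eq_abs]
        _ = _ := by
            simp only [Finset.mul_sum, Finset.sum_mul]
            rw [Finset.sum_comm]
            exact Finset.sum_congr rfl fun k _ => Finset.sum_congr rfl fun j _ => by ring)
    v hv (fun i => by
      refine lt_of_eq_of_lt ?_ (hκv i)
      simp only [mulVec, dotProduct, Finset.mul_sum, Finset.sum_mul]
      rw [Finset.sum_comm]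
      exact Finset.sum_congr rfl fun k _ => Finset.sum_congr rfl fun j _ => by ring)
  refine ⟨fun i => y i, fun i => L1.integrable_coeFn _, fun i => ?_⟩
  have hu : ∀ j, ∀ᵐ t, 0 ≤ t → (∑ k, H j k • y k + (hd j).toL1 : ℝ →₁[volume] ℝ) t =
      ∑ k, H j k * y k t + d j t := fun j => by
    have h2 : ∀ᵐ t, ∀ k, (H j k • y k : ℝ →₁[volume] ℝ) t = H j k * y k t :=
      ae_all_iff.2 fun k => Lp.coeFn_smul _ _
    filter_upwards [Lp.coeFn_add (∑ k, H j k • y k) (hd j).toL1, (hd j).coeFn_toL1,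
      Lp.coeFn_finsetSum Finset.univ fun k => H j k • y k, h2] with t h3 h4 h5 h6 _
    rw [h3, Pi.add_apply, h4, h5, Finset.sum_apply]
    simp only [h6]
  have h7 : ∀ᵐ t, ∀ j, causalConvL1 (κ i j) (∑ k, H j k • y k + (hd j).toL1) t =
      causalConv (κ i j) (fun s => ∑ k, H j k * y k s + d j s) t := ae_all_iff.2 fun j => by
    filter_upwards [coeFn_causalConvL1 (κ i j) (∑ k, H j k • y k + (hd j).toL1),
      causalConv_congr_ae (κ := κ i j) (hu j)] with t h8 h9
    rw [h8, h9]
  have h8 := Lp.coeFn_add (hg i).toL1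
    (∑ j, causalConvL1 (κ i j) (∑ k, H j k • y k + (hd j).toL1))
  have h9 : (y i : ℝ → ℝ) = T y i := by rw [hy]
  filter_upwards [h7, h8, (hg i).coeFn_toL1, Lp.coeFn_finsetSum Finset.univ fun j =>
    causalConvL1 (κ i j) (∑ k, H j k • y k + (hd j).toL1)] with t h10 h11 h12 h13
  rw [h9]
  simp only [T]
  rw [h11, Pi.add_apply, h12, h13, Finset.sum_apply]
  simp only [h10]

/-- The kernel `e^{-σθ} κ(dθ)`. -/
noncomputable def expWeighted (σ : ℝ) (κ : Measure ℝ) : Measure ℝ :=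
  κ.withDensity fun θ => ENNReal.ofReal (Real.exp (-σ * θ))

theorem isFiniteMeasure_expWeighted {σ : ℝ} {κ : Measure ℝ}
    (h : Integrable (fun θ => Real.exp (-σ * θ)) κ) : IsFiniteMeasure (expWeighted σ κ) :=
  isFiniteMeasure_withDensity_ofReal h.2

theorem setIntegral_expWeighted (σ : ℝ) (κ : Measure ℝ) (f : ℝ → ℝ) {s : Set ℝ}
    (hs : MeasurableSet s) :
    ∫ θ in s, f θ ∂(expWeighted σ κ) = ∫ θ in s, Real.exp (-σ * θ) * f θ ∂κ := by
  rw [expWeighted, setIntegral_withDensity_eq_setIntegral_toReal_smul (by fun_prop)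
    (Eventually.of_forall fun _ => ENNReal.ofReal_lt_top) _ hs]
  simp only [ENNReal.toReal_ofReal (Real.exp_pos _).le, smul_eq_mul]

theorem expWeighted_real_univ (σ : ℝ) (κ : Measure ℝ) :
    (expWeighted σ κ).real univ = ∫ θ, Real.exp (-σ * θ) ∂κ := by
  have := setIntegral_expWeighted σ κ (fun _ => 1) MeasurableSet.univ
  simpa using this

theorem causalConv_expWeighted (σ : ℝ) (κ : Measure ℝ) (f : ℝ → ℝ) (t : ℝ) :
    causalConv (expWeighted σ κ) (fun s => Real.exp (-σ * s) * f s) t =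
      Real.exp (-σ * t) * causalConv κ f t := by
  rw [causalConv, setIntegral_expWeighted σ κ _ measurableSet_Iic, causalConv,
    ← integral_const_mul]
  refine integral_congr_ae (Eventually.of_forall fun θ => ?_)
  change Real.exp (-σ * θ) * (Real.exp (-σ * (t - θ)) * f (t - θ)) = _
  rw [← mul_assoc, ← Real.exp_add]
  congr 2
  ring

/-- Solvability of a system of renewal equations in an exponentially weighted `L₁`-space. -/
theorem exists_renewal_solution (κ : ι → ι → Measure ℝ) (σ : ℝ)
    (hκ : ∀ i j, Integrable (fun θ => Real.exp (-σ * θ)) (κ i j)) (H : Matrix ι ι ℝ)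
    {d g : ι → ℝ → ℝ} (hd : ∀ i, Integrable fun t => Real.exp (-σ * t) * d i t)
    (hg : ∀ i, Integrable fun t => Real.exp (-σ * t) * g i t) {v : ι → ℝ} (hv : ∀ i, 0 < v i)
    (hκv : ∀ i, ∑ j, (∫ θ, Real.exp (-σ * θ) ∂(κ i j)) * ∑ k, |H j k| * v k < v i) :
    ∃ y : ι → ℝ → ℝ, (∀ i, LocallyIntegrable (y i)) ∧ ∀ i, ∀ᵐ t, y i t =
      g i t + ∑ j, causalConv (κ i j) (fun s => ∑ k, H j k * y k s + d j s) t := by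
  -- The substitution `Y = exp (-σ t) y` turns the equation into one of the same form with kernels
  -- `exp (-σ θ) κ(dθ)`, whose masses can be made small by the choice of `σ`.
  obtain ⟨Y, hYi, hY⟩ := exists_integrable_renewal_solution (fun i j => expWeighted σ (κ i j))
    (fun i j => isFiniteMeasure_expWeighted (hκ i j)) H hd hg hv
    (by simpa only [expWeighted_real_univ] using hκv)
  have hexp : ∀ t, Real.exp (σ * t) * Real.exp (-σ * t) = 1 := fun t => by
    rw [← Real.exp_add]; simp
  refine ⟨fun i t => Real.exp (σ * t) * Y i t, fun i => ?_, fun i => ?_⟩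
  · have h1 : ContinuousOn (fun t => Real.exp (σ * t)) univ := by fun_prop
    exact locallyIntegrableOn_univ.1 <| LocallyIntegrableOn.continuousOn_mul
      ((hYi i).locallyIntegrable.locallyIntegrableOn univ) h1 isOpen_univ.isLocallyClosed
  · filter_upwards [hY i] with t ht
    have h2 : ∀ j, (fun s => ∑ k, H j k * Y k s + Real.exp (-σ * s) * d j s) = fun s =>
        Real.exp (-σ * s) * (∑ k, H j k * (Real.exp (σ * s) * Y k s) + d j s) := fun j =>
      funext fun s => by
        rw [mul_add, Finset.mul_sum]
        congr 1
        refine Finset.sum_congr rfl fun k _ => ?_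
        have := hexp s
        linear_combination (-(H j k * Y k s)) * this
    simp only [h2, causalConv_expWeighted] at ht
    rw [ht, ← Finset.mul_sum, ← mul_add, ← mul_assoc, hexp, one_mul]

end Renewal

theorem integrable_exp_mul_indicator {f : ℝ → ℝ} (hf : IntegrableOn f (Ici 0)) {σ : ℝ}
    (hσ : 0 ≤ σ) : Integrable fun t => Real.exp (-σ * t) * (Ici 0).indicator f t := by
  have h1 : (fun t => Real.exp (-σ * t) * (Ici 0).indicator f t) =
      (Ici 0).indicator fun t => Real.exp (-σ * t) * f t := by
    ext t
    by_cases ht : t ∈ Ici (0 : ℝ) <;> simp [indicator, ht]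
  rw [h1, integrable_indicator_iff measurableSet_Ici]
  refine Integrable.bdd_mul (c := 1) hf (by fun_prop) ?_
  filter_upwards [ae_restrict_mem measurableSet_Ici] with t ht
  rw [Real.norm_eq_abs, Real.abs_exp, Real.exp_le_one_iff, neg_mul, neg_nonpos]
  exact mul_nonneg hσ ht

theorem integrable_exp_mul_indicator_of_bounded {f : ℝ → ℝ} (hf : Measurable f) {M : ℝ}
    (hM : ∀ t, |f t| ≤ M) {σ : ℝ} (hσ : 0 < σ) :
    Integrable fun t => Real.exp (-σ * t) * (Ici 0).indicator f t := by
  have h1 : (fun t => Real.exp (-σ * t) * (Ici 0).indicator f t) =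
      (Ici 0).indicator fun t => f t * Real.exp (-σ * t) := by
    ext t
    by_cases ht : t ∈ Ici (0 : ℝ) <;> simp [indicator, ht, mul_comm]
  rw [h1, integrable_indicator_iff measurableSet_Ici]
  refine Integrable.bdd_mul (c := M) ?_ hf.aestronglyMeasurable (Eventually.of_forall hM)
  exact (integrableOn_Ici_iff_integrableOn_Ioi (by simp)).2 (integrableOn_exp_mul_Ioi (neg_lt_zero.2 hσ) 0)

theorem causalConv_zero_measure (f : ℝ → ℝ) (t : ℝ) : causalConv 0 f t = 0 := by
  simp [causalConv]

theorem causalConv_volume_Ioi (f : ℝ → ℝ) {t : ℝ} (ht : 0 ≤ t) :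
    causalConv (volume.restrict (Ioi 0)) f t = ∫ s in (0 : ℝ)..t, f s := by
  rw [causalConv, Measure.restrict_restrict measurableSet_Iic, inter_comm, Ioi_inter_Iic,
    ← intervalIntegral.integral_of_le ht]
  simp

theorem measurable_integral_past {κ : Measure ℝ} [IsFiniteMeasure κ] {h : ℝ → ℝ}
    (hh : Measurable h) {M : ℝ} (hM : ∀ t < 0, |h t| ≤ M) :
    Measurable (fun t => ∫ θ in Ioi t, h (t - θ) ∂κ) ∧
      ∀ t, |∫ θ in Ioi t, h (t - θ) ∂κ| ≤ |M| * κ.real univ := by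
  constructor
  · have h1 : (fun t => ∫ θ in Ioi t, h (t - θ) ∂κ) =
        fun t => ∫ θ, (Iio 0).indicator h (t - θ) ∂κ := by
      ext t
      rw [← integral_indicator measurableSet_Ioi]
      congr 1
      ext θ
      simp only [indicator, mem_Ioi, mem_Iio, sub_neg]
    rw [h1]
    have h2 : Measurable fun p : ℝ × ℝ => (Iio 0).indicator h (p.1 - p.2) :=
      (hh.indicator measurableSet_Iio).comp (measurable_fst.sub measurable_snd)
    exact (h2.stronglyMeasurable.integral_prod_right' (ν := κ)).measurable
  · intro t
    have h1 : ∀ θ ∈ Ioi t, ‖h (t - θ)‖ ≤ |M| := fun θ hθ =>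
      (hM (t - θ) (sub_neg.2 hθ)).trans (le_abs_self M)
    refine (norm_setIntegral_le_of_norm_le_const (measure_lt_top κ (Ioi t)) h1).trans ?_
    exact mul_le_mul_of_nonneg_left (measureReal_mono (subset_univ _)) (abs_nonneg _)

/-! ### Existence of trajectories -/

section Existence

variable {n n₀ p q : ℕ} {S : LFR n n₀ p q} {Δ : PositiveLTI n₀}
  {Δ₀ : Matrix (Fin n₀) (Fin n₀) ℝ}

/-- The kernels of the renewal equations for the state and the loop input. -/
noncomputable def PositiveLTI.renewalKernel (n : ℕ) {n₀ : ℕ} (Δ : PositiveLTI n₀) :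
    Fin n ⊕ Fin n₀ → Fin n ⊕ Fin n₀ → Measure ℝ
  -- Integration from `0` is convolution with Lebesgue measure on `(0, ∞)`; its weighted mass is
  -- `σ⁻¹`.
  | Sum.inl i, Sum.inl j => if i = j then volume.restrict (Ioi 0) else 0
  | Sum.inr i, Sum.inr j => Δ.kernel i j
  | _, _ => 0

theorem PositiveLTI.integrable_exp (Δ : PositiveLTI n₀) {σ : ℝ} (hσ : 0 ≤ σ) (i j : Fin n₀) :
    Integrable (fun θ => Real.exp (-σ * θ)) (Δ.kernel i j) := by
  have := Δ.finite i j
  refine Integrable.of_bound (C := 1) (by fun_prop) ?_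
  filter_upwards [ae_nonneg_of_causal (Δ.causal i j)] with θ hθ
  rw [Real.norm_eq_abs, Real.abs_exp, Real.exp_le_one_iff, neg_mul, neg_nonpos]
  exact mul_nonneg hσ hθ

theorem PositiveLTI.HasStaticGain.integral_exp_le (hΔ : Δ.HasStaticGain Δ₀) {σ : ℝ} (hσ : 0 ≤ σ)
    (i j : Fin n₀) : ∫ θ, Real.exp (-σ * θ) ∂(Δ.kernel i j) ≤ Δ₀ i j := by
  have := Δ.finite i j
  calc _ ≤ ∫ _, (1 : ℝ) ∂(Δ.kernel i j) := by
        refine integral_mono_ae (Δ.integrable_exp hσ i j) (integrable_const _) ?_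
        filter_upwards [ae_nonneg_of_causal (Δ.causal i j)] with θ hθ
        rw [Real.exp_le_one_iff, neg_mul, neg_nonpos]
        exact mul_nonneg hσ hθ
    _ = Δ₀ i j := by simp [hΔ.real_univ]

theorem integral_exp_volume_Ioi {σ : ℝ} (hσ : 0 < σ) :
    ∫ θ in Ioi (0 : ℝ), Real.exp (-σ * θ) = σ⁻¹ := by
  rw [integral_exp_mul_Ioi (neg_lt_zero.2 hσ)]
  simp [neg_div_neg_eq]

/-- Existence of a growth rate and of weights for which the renewal equations are contractive. -/
theorem LFR.exists_contraction_weights (hS : S.IsPositive) (hΔ₀ : EntrywiseNonneg Δ₀)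
    (hloop : S.PositiveLoop Δ₀) (hΔ : Δ.HasStaticGain Δ₀) :
    ∃ (σ : ℝ) (v : Fin n ⊕ Fin n₀ → ℝ), 0 < σ ∧ (∀ i, 0 < v i) ∧
      ∀ i, ∑ j, (∫ θ, Real.exp (-σ * θ) ∂(Δ.renewalKernel n i j)) *
        ∑ k, |fromBlocks S.A S.E₀ S.C₀ S.F₀₀ j k| * v k < v i := by
  -- The weights are fixed in this order: `w = 1 + Δ₀ F₀₀ w` leaves slack `1` in the loop rows, the
  -- constant state weight `a` is small enough for `a Δ₀ C₀ 1 < 1`, and finally `σ = c⁻¹` is so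
  -- large that the integrators contract.
  obtain ⟨w, hw0, hw⟩ := hloop.exists_mulVec_eq (a := 1) fun _ => zero_le_one
  have hw1 : ∀ i, 0 < w i := fun i => by
    rw [hw]
    have : 0 ≤ ((Δ₀ * S.F₀₀) *ᵥ w) i := mulVec_nonneg' (fun i j => by
      rw [Matrix.mul_apply]
      exact Finset.sum_nonneg fun k _ => mul_nonneg (hΔ₀ i k) (hS.F₀₀ k j)) hw0 i
    simp only [Pi.add_apply, Pi.one_apply]
    linarith
  obtain ⟨a, ha, ha1⟩ := exists_pos_forall_mul_lt (fun i => ((Δ₀ * S.C₀) *ᵥ 1) i) one_pos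
  let v : Fin n ⊕ Fin n₀ → ℝ := Sum.elim (fun _ => a) w
  have hv : ∀ i, 0 < v i := by
    rintro (i | i)
    exacts [ha, hw1 i]
  let H := fromBlocks S.A S.E₀ S.C₀ S.F₀₀
  obtain ⟨c, hc, hc1⟩ := exists_pos_forall_mul_lt
    (fun i : Fin n => ∑ k, |H (Sum.inl i) k| * v k) ha
  refine ⟨c⁻¹, v, inv_pos.2 hc, hv, ?_⟩
  rintro (i | i)
  · rw [Fintype.sum_sum_type]
    have h1 : ∀ j, ∫ θ, Real.exp (-c⁻¹ * θ) ∂(Δ.renewalKernel n (Sum.inl i) (Sum.inl j)) =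
        if i = j then c else 0 := fun j => by
      by_cases hij : i = j
      · simp only [PositiveLTI.renewalKernel, if_pos hij]
        rw [integral_exp_volume_Ioi (inv_pos.2 hc), inv_inv]
      · simp [PositiveLTI.renewalKernel, if_neg hij]
    have h2 : ∀ j, ∫ θ, Real.exp (-c⁻¹ * θ) ∂(Δ.renewalKernel n (Sum.inl i) (Sum.inr j)) = 0 :=
      fun j => by simp [PositiveLTI.renewalKernel]
    simp only [h1, h2, zero_mul, Finset.sum_const_zero, add_zero, ite_mul, Finset.sum_ite_eq,
      Finset.mem_univ, if_true]
    exact hc1 i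
  · rw [Fintype.sum_sum_type]
    have h1 : ∀ j, ∫ θ, Real.exp (-c⁻¹ * θ) ∂(Δ.renewalKernel n (Sum.inr i) (Sum.inl j)) = 0 :=
      fun j => by simp [PositiveLTI.renewalKernel]
    simp only [h1, zero_mul, Finset.sum_const_zero, zero_add]
    have h2 : ∀ j, ∑ k, |H (Sum.inr j) k| * v k = (S.C₀ *ᵥ (a • 1) + S.F₀₀ *ᵥ w) j := fun j => by
      rw [Fintype.sum_sum_type, Pi.add_apply]
      simp only [H, fromBlocks_apply₂₁, fromBlocks_apply₂₂, abs_of_nonneg (hS.C₀ _ _),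
        abs_of_nonneg (hS.F₀₀ _ _), v, Sum.elim_inl, Sum.elim_inr, mulVec, dotProduct,
        Pi.smul_apply, Pi.one_apply, smul_eq_mul, mul_one]
    calc _ ≤ ∑ j, Δ₀ i j * (S.C₀ *ᵥ (a • 1) + S.F₀₀ *ᵥ w) j := by
          refine Finset.sum_le_sum fun j _ => ?_
          rw [← h2]
          exact mul_le_mul_of_nonneg_right (hΔ.integral_exp_le (inv_pos.2 hc).le i j)
            (Finset.sum_nonneg fun k _ => mul_nonneg (abs_nonneg _) (hv k).le)
      _ = a * ((Δ₀ * S.C₀) *ᵥ 1) i + ((Δ₀ * S.F₀₀) *ᵥ w) i := by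
          change (Δ₀ *ᵥ (S.C₀ *ᵥ (a • 1) + S.F₀₀ *ᵥ w)) i = _
          simp only [mulVec_add, mulVec_smul, mulVec_mulVec, Pi.add_apply, Pi.smul_apply,
            smul_eq_mul]
      _ < w i := by
          have h3 := congrFun hw i
          simp only [Pi.add_apply, Pi.one_apply] at h3
          linarith [ha1 i]

theorem LFR.exists_trajectory (hS : S.IsPositive) (hΔ₀ : EntrywiseNonneg Δ₀)
    (hloop : S.PositiveLoop Δ₀) (hΔ : Δ.HasStaticGain Δ₀) (x₀ : Fin n → ℝ)
    (h : ℝ → Fin n₀ → ℝ) (w₁ : ℝ → Fin p → ℝ) (hh : IsPast h) (hw₁ : IntegrableOn w₁ (Ici 0)) :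
    ∃ x w₀ z₀, S.IsTrajectory Δ.apply x₀ h w₁ x w₀ z₀ := by
  obtain ⟨σ, v, hσ, hv, hκv⟩ := S.exists_contraction_weights hS hΔ₀ hloop hΔ
  obtain ⟨hhm, M, hM⟩ := id hh
  have hfin := Δ.finite
  have hM' : ∀ j, ∀ t < 0, |h t j| ≤ M := fun j t ht => (norm_le_pi_norm (h t) j).trans (hM t ht)
  let w₁' : ℝ → Fin p → ℝ := (Ici 0).indicator w₁
  let d : Fin n ⊕ Fin n₀ → ℝ → ℝ :=
    Sum.elim (fun i => (Ici 0).indicator fun t => (S.E₁ *ᵥ w₁ t) i)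
      (fun i => (Ici 0).indicator fun t => (S.F₀₁ *ᵥ w₁ t) i)
  let g : Fin n ⊕ Fin n₀ → ℝ → ℝ :=
    Sum.elim (fun i => (Ici 0).indicator fun _ => x₀ i) (fun i => (Ici 0).indicator fun t =>
      ∑ j, ∫ θ in Ioi t, h (t - θ) j ∂(Δ.kernel i j))
  have hmv : ∀ {b : ℕ} (N : Matrix (Fin b) (Fin p) ℝ) i,
      IntegrableOn (fun t => (N *ᵥ w₁ t) i) (Ici 0) := fun N i =>
    ((ContinuousLinearMap.proj (R := ℝ) (φ := fun _ => ℝ) i).comp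
      (LinearMap.toContinuousLinearMap N.mulVecLin)).integrable_comp hw₁
  have hd : ∀ i, Integrable fun t => Real.exp (-σ * t) * d i t := by
    rintro (i | i)
    exacts [integrable_exp_mul_indicator (hmv _ i) hσ.le,
      integrable_exp_mul_indicator (hmv _ i) hσ.le]
  have hg : ∀ i, Integrable fun t => Real.exp (-σ * t) * g i t := by
    rintro (i | i)
    · exact integrable_exp_mul_indicator_of_bounded measurable_const (fun _ => le_rfl) hσ
    · have h1 := fun j => measurable_integral_past (κ := Δ.kernel i j) (h := fun s => h s j)
        ((measurable_pi_apply j).comp hhm) (hM' j)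
      exact integrable_exp_mul_indicator_of_bounded
        (Finset.measurable_fun_sum _ fun j _ => (h1 j).1)
        (fun t => (Finset.abs_sum_le_sum_abs _ _).trans
          (Finset.sum_le_sum fun j _ => (h1 j).2 t)) hσ
  have hκ : ∀ i j, Integrable (fun θ => Real.exp (-σ * θ)) (Δ.renewalKernel n i j) := by
    rintro (i | i) (j | j)
    · by_cases hij : i = j
      · simp only [PositiveLTI.renewalKernel, if_pos hij]
        exact integrableOn_exp_mul_Ioi (neg_lt_zero.2 hσ) 0
      · simp only [PositiveLTI.renewalKernel, if_neg hij]
        exact integrable_zero_measure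
    · exact integrable_zero_measure
    · exact integrable_zero_measure
    · exact Δ.integrable_exp hσ.le i j
  -- The unknown is `y = (x, w₀)`. The block matrix and `d` produce the signals that enter the
  -- kernels, namely the state derivative and `z₀`; `g` carries the initial state and the effect of
  -- the past.
  obtain ⟨y, hyi, hy⟩ := exists_renewal_solution (Δ.renewalKernel n) σ hκ
    (fromBlocks S.A S.E₀ S.C₀ S.F₀₀) hd hg hv hκv
  let yx : ℝ → Fin n → ℝ := fun t i => y (Sum.inl i) t
  let w₀ : ℝ → Fin n₀ → ℝ := fun t i => y (Sum.inr i) t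
  have hli : ∀ {b : ℕ} {f : ℝ → Fin b → ℝ}, (∀ i, LocallyIntegrable fun t => f t i) →
      LocallyIntegrableOn f univ := fun hf =>
    .of_eval isClosed_univ fun i => (hf i).locallyIntegrableOn univ
  have hyx : LocallyIntegrableOn yx univ := hli fun i => hyi _
  have hw₀ : LocallyIntegrableOn w₀ univ := hli fun i => hyi _
  have hw₁' : LocallyIntegrableOn w₁' univ :=
    (hw₁.integrable_indicator measurableSet_Ici).locallyIntegrable.locallyIntegrableOn univ
  let U : ℝ → Fin n → ℝ := fun s => S.A *ᵥ yx s + S.E₀ *ᵥ w₀ s + S.E₁ *ᵥ w₁' s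
  let V : ℝ → Fin n₀ → ℝ := fun s => S.C₀ *ᵥ yx s + S.F₀₀ *ᵥ w₀ s + S.F₀₁ *ᵥ w₁' s
  have hU : LocallyIntegrableOn U univ :=
    ((hyx.mulVec _).add (hw₀.mulVec _)).add (hw₁'.mulVec _)
  have hV : LocallyIntegrableOn V univ :=
    ((hyx.mulVec _).add (hw₀.mulVec _)).add (hw₁'.mulVec _)
  have hUi : ∀ a b, IntervalIntegrable U volume a b := fun a b =>
    (hU.integrableOn_compact_subset (subset_univ (uIcc a b)) isCompact_uIcc).intervalIntegrable
  have hind : ∀ {b : ℕ} (N : Matrix (Fin b) (Fin p) ℝ) i s,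
      (Ici 0).indicator (fun t => (N *ᵥ w₁ t) i) s = (N *ᵥ w₁' s) i := fun N i s => by
    by_cases hs : s ∈ Ici (0 : ℝ)
    · simp only [w₁', indicator_of_mem hs]
    · simp only [w₁', indicator_of_notMem hs, mulVec_zero, Pi.zero_apply]
  have hsU : ∀ i s, ∑ k, fromBlocks S.A S.E₀ S.C₀ S.F₀₀ (Sum.inl i) k * y k s +
      d (Sum.inl i) s = U s i := fun i s => by
    rw [Fintype.sum_sum_type]
    simp only [d, Sum.elim_inl, hind]
    rfl
  have hsV : ∀ i s, ∑ k, fromBlocks S.A S.E₀ S.C₀ S.F₀₀ (Sum.inr i) k * y k s +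
      d (Sum.inr i) s = V s i := fun i s => by
    rw [Fintype.sum_sum_type]
    simp only [d, Sum.elim_inr, hind]
    rfl
  -- The fixed point is determined only almost everywhere; the primitive is its continuous
  -- representative on `[0, ∞)`.
  let x : ℝ → Fin n → ℝ := fun t => x₀ + ∫ s in (0 : ℝ)..t, U s
  have hxc : Continuous x := continuous_const.add (intervalIntegral.continuous_primitive hUi 0)
  have hxy : ∀ᵐ t, 0 ≤ t → yx t = x t := by
    filter_upwards [ae_all_iff.2 fun i => hy (Sum.inl i)] with t ht ht0
    ext i
    have h1 := ht i
    rw [Fintype.sum_sum_type] at h1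
    simp only [hsU, hsV, PositiveLTI.renewalKernel, causalConv_zero_measure,
      Finset.sum_const_zero, add_zero] at h1
    rw [Finset.sum_eq_single i (fun j _ hj => by rw [if_neg hj.symm, causalConv_zero_measure])
      (fun hi => absurd (Finset.mem_univ i) hi), if_pos rfl, causalConv_volume_Ioi _ ht0] at h1
    simp only [yx, h1, x, Pi.add_apply, g, Sum.elim_inl, integral_eval (hUi 0 t) i]
    rw [indicator_of_mem (mem_Ici.2 ht0)]
  let z₀ : ℝ → Fin n₀ → ℝ := fun t => if t < 0 then h t else V t
  have hz₀i : LocallyIntegrableOn z₀ (Ici 0) := by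
    rw [locallyIntegrableOn_iff isClosed_Ici.isLocallyClosed]
    intro k hk hkc
    exact (hV.integrableOn_compact_subset (subset_univ k) hkc).congr_fun
      (fun s hs => (if_neg (not_lt.2 (hk hs))).symm) hkc.measurableSet
  refine ⟨x, w₀, z₀, hxc.continuousOn, hw₀.mono_set (subset_univ _), hz₀i,
    fun t ht => if_pos ht, fun t ht => ?_, ?_, ?_⟩
  · change x₀ + _ = _
    congr 1
    refine intervalIntegral.integral_congr_ae ?_
    filter_upwards [hxy] with s hs hst
    rw [uIoc_of_le ht] at hst
    have hs0 : s ∈ Ici (0 : ℝ) := hst.1.le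
    simp only [U, hs hs0, w₁', indicator_of_mem hs0]
  · refine (ae_restrict_iff' measurableSet_Ici).2 ?_
    filter_upwards [hxy] with t ht ht0
    simp only [z₀, if_neg (not_lt.2 (mem_Ici.1 ht0)), V, ht ht0, w₁', indicator_of_mem ht0]
  · have h1 : ∀ i j, ∀ᵐ t, causalConv (Δ.kernel i j) (fun s => z₀ s j) t =
        causalConv (Δ.kernel i j) (fun s => V s j) t := fun i j =>
      causalConv_congr_ae (Eventually.of_forall fun t ht => by simp only [z₀, if_neg (not_lt.2 ht)])
    have h2 : ∀ᵐ t ∂volume.restrict (Ici (0 : ℝ)), ∀ i j, ∫ θ, z₀ (t - θ) j ∂(Δ.kernel i j) =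
        causalConv (Δ.kernel i j) (fun s => z₀ s j) t +
          ∫ θ in Ioi t, h (t - θ) j ∂(Δ.kernel i j) :=
      ae_all_iff.2 fun i => ae_all_iff.2 fun j => by
        filter_upwards [ae_integrable_of_past (Δ.causal i j) (hz₀i.eval j) (h := fun s => h s j)
          ((measurable_pi_apply j).comp hhm) (hM' j) fun t ht => by simp only [z₀, if_pos ht]]
          with t ht using ht.2.2.2
    filter_upwards [ae_restrict_of_ae (ae_all_iff.2 fun i => ae_all_iff.2 (h1 i)), h2,
      ae_restrict_of_ae (ae_all_iff.2 fun i => hy (Sum.inr i)), ae_restrict_mem measurableSet_Ici]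
      with t h3 h4 h5 ht0
    ext i
    have h6 := h5 i
    rw [Fintype.sum_sum_type] at h6
    simp only [hsU, hsV, PositiveLTI.renewalKernel, causalConv_zero_measure,
      Finset.sum_const_zero, zero_add, g, Sum.elim_inr, indicator_of_mem ht0] at h6
    simp only [w₀, PositiveLTI.apply, h6, h4, h3, Finset.sum_add_distrib]
    ring

end Existence

/-! ### Necessity: constant subsolutions -/

section Converse

variable {n n₀ p q : ℕ} {S : LFR n n₀ p q} {Δ : PositiveLTI n₀}
  {Δ₀ : Matrix (Fin n₀) (Fin n₀) ℝ}

/-- Either the linear copositive dissipation inequalities are solvable, or there is a nonnegative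
equilibrium-like direction that violates stability or the gain bound. -/
theorem LFR.exists_multipliers_or_exists_dual (hloop : S.PositiveLoop Δ₀) (γ : ℝ) :
    (∃ (l : Fin n → ℝ) (ψ : Fin n₀ → ℝ), (∀ i, 0 < l i) ∧
      (∀ i, (l ᵥ* S.A + ψ ᵥ* (Δ₀ * S.C₀) + 1 ᵥ* S.C₁) i < 0) ∧
      (∀ i, (l ᵥ* S.E₀ + ψ ᵥ* (Δ₀ * S.F₀₀) + 1 ᵥ* S.F₁₀) i < ψ i) ∧
      ∀ i, (l ᵥ* S.E₁ + ψ ᵥ* (Δ₀ * S.F₀₁) + 1 ᵥ* S.F₁₁) i < γ) ∨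
    ∃ (v : Fin n → ℝ) (w : Fin n₀ → ℝ) (u : Fin p → ℝ), (∀ i, 0 ≤ v i) ∧ (∀ i, 0 ≤ w i) ∧
      (∀ i, 0 ≤ u i) ∧ ¬(v = 0 ∧ u = 0) ∧ (∀ i, 0 ≤ (S.A *ᵥ v + S.E₀ *ᵥ w + S.E₁ *ᵥ u) i) ∧
      Δ₀ *ᵥ (S.C₀ *ᵥ v + S.F₀₀ *ᵥ w + S.F₀₁ *ᵥ u) = w ∧
      γ * (1 ⬝ᵥ u) ≤ 1 ⬝ᵥ (S.C₁ *ᵥ v + S.F₁₀ *ᵥ w + S.F₁₁ *ᵥ u) := by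
  -- The four blocks of rows express `l > 0` and the three multiplier inequalities; their dual
  -- variables are `s`, `v`, `w` and `u`. Since `ψ` is free, the loop relation for `w` comes out as
  -- an equality, while `s ≥ 0` is the right-hand side of the state equation.
  let L : ((Fin n → ℝ) × (Fin n₀ → ℝ)) →ₗ[ℝ] (Fin n ⊕ (Fin n ⊕ (Fin n₀ ⊕ Fin p)) → ℝ) :=
    { toFun := fun e => Sum.elim (-e.1) (Sum.elim (e.1 ᵥ* S.A + e.2 ᵥ* (Δ₀ * S.C₀))
        (Sum.elim (e.1 ᵥ* S.E₀ + e.2 ᵥ* (Δ₀ * S.F₀₀) - e.2)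
          (e.1 ᵥ* S.E₁ + e.2 ᵥ* (Δ₀ * S.F₀₁))))
      map_add' := fun e e' => by
        ext (i | i | i | i) <;> simp [add_vecMul] <;> ring
      map_smul' := fun c e => by
        ext (i | i | i | i) <;> simp [smul_vecMul] <;> ring }
  let b : Fin n ⊕ (Fin n ⊕ (Fin n₀ ⊕ Fin p)) → ℝ := Sum.elim 0 (Sum.elim (-(1 ᵥ* S.C₁))
    (Sum.elim (-(1 ᵥ* S.F₁₀)) (γ • 1 - 1 ᵥ* S.F₁₁)))
  rcases exists_forall_lt_or_exists_dual L b with ⟨⟨l, ψ⟩, h⟩ | ⟨y, hy0, hy, hLy, hby⟩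
  · left
    refine ⟨l, ψ, fun i => ?_, fun i => ?_, fun i => ?_, fun i => ?_⟩
    · have := h (Sum.inl i)
      simpa [L, b] using this
    · have := h (Sum.inr (Sum.inl i))
      simp only [L, b, LinearMap.coe_mk, AddHom.coe_mk, Sum.elim_inr, Sum.elim_inl, Pi.add_apply,
        Pi.neg_apply] at this
      simp only [Pi.add_apply]
      linarith
    · have := h (Sum.inr (Sum.inr (Sum.inl i)))
      simp only [L, b, LinearMap.coe_mk, AddHom.coe_mk, Sum.elim_inr, Sum.elim_inl, Pi.add_apply,
        Pi.neg_apply, Pi.sub_apply] at this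
      simp only [Pi.add_apply]
      linarith
    · have := h (Sum.inr (Sum.inr (Sum.inr i)))
      simp only [L, b, LinearMap.coe_mk, AddHom.coe_mk, Sum.elim_inr, Pi.add_apply,
        Pi.sub_apply, Pi.smul_apply, Pi.one_apply, smul_eq_mul, mul_one] at this
      simp only [Pi.add_apply]
      linarith
  · right
    obtain ⟨s, v, w, u, rfl⟩ : ∃ (s v : Fin n → ℝ) (w : Fin n₀ → ℝ) (u : Fin p → ℝ),
        y = Sum.elim s (Sum.elim v (Sum.elim w u)) :=
      ⟨fun i => y (Sum.inl i), fun i => y (Sum.inr (Sum.inl i)),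
        fun i => y (Sum.inr (Sum.inr (Sum.inl i))), fun i => y (Sum.inr (Sum.inr (Sum.inr i))),
        by ext (i | i | i | i) <;> rfl⟩
    have hL : ∀ l ψ, l ⬝ᵥ (S.A *ᵥ v + S.E₀ *ᵥ w + S.E₁ *ᵥ u - s) +
        ψ ⬝ᵥ (Δ₀ *ᵥ (S.C₀ *ᵥ v + S.F₀₀ *ᵥ w + S.F₀₁ *ᵥ u) - w) = 0 := fun l ψ => by
      have := hLy (l, ψ)
      simp only [L, LinearMap.coe_mk, AddHom.coe_mk, sumElim_dotProduct_sumElim, neg_dotProduct,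
        add_dotProduct, sub_dotProduct] at this
      simp only [dotProduct_add, dotProduct_sub, mulVec_add, mulVec_mulVec, dotProduct_mulVec]
      linarith
    have h1 : S.A *ᵥ v + S.E₀ *ᵥ w + S.E₁ *ᵥ u = s := by
      refine sub_eq_zero.1 (dotProduct_eq_zero _ fun l => ?_)
      have := hL l 0
      rw [zero_dotProduct, add_zero] at this
      rw [dotProduct_comm, this]
    have h2 : Δ₀ *ᵥ (S.C₀ *ᵥ v + S.F₀₀ *ᵥ w + S.F₀₁ *ᵥ u) = w := by
      refine sub_eq_zero.1 (dotProduct_eq_zero _ fun ψ => ?_)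
      have := hL 0 ψ
      rw [zero_dotProduct, zero_add] at this
      rw [dotProduct_comm, this]
    refine ⟨v, w, u, fun i => hy0 (Sum.inr (Sum.inl i)),
      fun i => hy0 (Sum.inr (Sum.inr (Sum.inl i))), fun i => hy0 (Sum.inr (Sum.inr (Sum.inr i))),
      ?_, fun i => ?_, h2, ?_⟩
    -- If `v` and `u` vanish, then `w = Δ₀ F₀₀ w`, so `w = 0` by well-posedness; then `s = 0` as
    -- well, and the dual vector would be zero.
    · rintro ⟨rfl, rfl⟩
      have hw : w = 0 := hloop.eq_zero_of_mulVec_eq (by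
        simpa [mulVec_mulVec] using h2)
      subst hw
      refine hy ?_
      rw [← h1]
      ext (i | i | i | i) <;> simp
    · rw [h1]
      exact hy0 (Sum.inl i)
    · simp only [b, sumElim_dotProduct_sumElim, zero_dotProduct, neg_dotProduct, sub_dotProduct,
        smul_dotProduct, smul_eq_mul] at hby
      simp only [dotProduct_add, dotProduct_mulVec]
      linarith

theorem isPast_const (z : Fin n₀ → ℝ) : IsPast fun _ => z :=
  ⟨measurable_const, ‖z‖, fun _ _ => le_rfl⟩

/-- Comparison of a trajectory with a constant subsolution. -/
theorem LFR.IsTrajectory.ge_of_subsolution (hS : S.IsPositive) (hloop : S.PositiveLoop Δ₀)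
    (hΔ : Δ.HasStaticGain Δ₀) {v : Fin n → ℝ} {w z : Fin n₀ → ℝ} {u : Fin p → ℝ}
    {w₁ : ℝ → Fin p → ℝ} {x : ℝ → Fin n → ℝ} {w₀ z₀ : ℝ → Fin n₀ → ℝ}
    (tr : S.IsTrajectory Δ.apply v (fun _ => z) w₁ x w₀ z₀)
    (hw₁ : LocallyIntegrableOn w₁ (Ici 0)) {T : ℝ} (hu : ∀ t ∈ Icc 0 T, w₁ t = u)
    (hv : ∀ i, 0 ≤ (S.A *ᵥ v + S.E₀ *ᵥ w + S.E₁ *ᵥ u) i)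
    (hz : S.C₀ *ᵥ v + S.F₀₀ *ᵥ w + S.F₀₁ *ᵥ u = z) (hw : Δ₀ *ᵥ z = w) :
    (∀ t ∈ Icc 0 T, ∀ i, v i ≤ x t i) ∧
      ∀ᵐ t ∂volume.restrict (Ici (0 : ℝ)), t ≤ T → ∀ i, w i ≤ w₀ t i := by
  -- By linearity, negation turns the subsolution into a supersolution.
  obtain ⟨h1, h2⟩ := (tr.smul (-1)).le_of_supersolution hS hloop hΔ (v := -v) (w := -w) (z := -z)
    (T := T) (hw₁.clm_comp ((-1 : ℝ) • ContinuousLinearMap.id ℝ _)) (by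
      exact isPast_const ((-1 : ℝ) • z))
    (fun t ht i => by
      have := hv i
      simp only [Pi.smul_apply, hu t ht, mulVec_neg, mulVec_smul, Pi.add_apply, Pi.neg_apply,
        smul_eq_mul] at this ⊢
      linarith)
    (fun t ht i => by
      have := congrFun hz i
      simp only [Pi.smul_apply, hu t ht, mulVec_neg, mulVec_smul, Pi.add_apply, Pi.neg_apply,
        smul_eq_mul] at this ⊢
      linarith)
    (fun i => by rw [mulVec_neg, hw]) (fun i => by simp) (fun t _ i => by simp)
  refine ⟨fun t ht i => ?_, ?_⟩
  · have := h1 t ht i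
    simpa using this
  · filter_upwards [h2] with t ht htT i
    have := (ht htT).1 i
    simpa using this

/-- Convergence alone leaves `z₀` uncontrolled on bounded intervals. By linearity the initial
condition can be scaled into the `δ`-ball for `ε = 1`, which gives a global bound. -/
theorem LFR.AsymptoticallyStable.ae_bounded (hst : S.AsymptoticallyStable Δ.apply)
    {x₀ : Fin n → ℝ} {h : ℝ → Fin n₀ → ℝ} {x : ℝ → Fin n → ℝ} {w₀ z₀ : ℝ → Fin n₀ → ℝ}
    (hh : IsPast h) (tr : S.IsTrajectory Δ.apply x₀ h 0 x w₀ z₀) :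
    ∃ B, ∀ᵐ t, ∀ j, |z₀ t j| ≤ B := by
  obtain ⟨hm, M, hM⟩ := id hh
  obtain ⟨δ, hδ, hδ'⟩ := hst.lyapunov 1 one_pos
  let c : ℝ := δ / (‖x₀‖ + |M| + 1)
  have hpos : 0 < ‖x₀‖ + |M| + 1 := by positivity
  have hc : 0 < c := div_pos hδ hpos
  have hcle : ∀ r, r ≤ ‖x₀‖ + |M| → c * r ≤ δ := fun r hr => by
    calc c * r ≤ c * (‖x₀‖ + |M| + 1) := mul_le_mul_of_nonneg_left (by linarith) hc.le
      _ = δ := div_mul_cancel₀ _ hpos.ne'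
  have htr := tr.smul c
  rw [smul_zero] at htr
  obtain ⟨-, h2⟩ := hδ' (c • x₀) (c • h) _ _ _
    (by rw [norm_smul, Real.norm_of_nonneg hc.le]; exact hcle _ (by linarith [abs_nonneg M]))
    ⟨hm.const_smul c, c * M, fun t ht => by
      rw [Pi.smul_apply, norm_smul, Real.norm_of_nonneg hc.le]
      exact mul_le_mul_of_nonneg_left (hM t ht) hc.le⟩
    (fun t ht => by
      rw [Pi.smul_apply, norm_smul, Real.norm_of_nonneg hc.le]
      exact hcle _ ((hM t ht).trans (by linarith [le_abs_self M, norm_nonneg x₀]))) htr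
  rw [ae_restrict_iff' measurableSet_Ici] at h2
  refine ⟨max M c⁻¹, ?_⟩
  filter_upwards [h2] with t ht j
  refine (norm_le_pi_norm (z₀ t) j).trans ?_
  rcases lt_or_ge t 0 with ht0 | ht0
  · rw [tr.past t ht0]
    exact (hM t ht0).trans (le_max_left _ _)
  · have h3 := ht ht0
    rw [Pi.smul_apply, norm_smul, Real.norm_of_nonneg hc.le] at h3
    refine le_trans ?_ (le_max_right _ _)
    rw [← one_div, le_div_iff₀ hc]
    linarith

/-- Smallness of `w₀` is not part of the definition of stability; it follows because `Δ` maps a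
bounded, eventually small `z₀` to an eventually small signal. -/
theorem LFR.AsymptoticallyStable.eventually_abs_le (hst : S.AsymptoticallyStable Δ.apply)
    (hΔ : Δ.HasStaticGain Δ₀)
    {x₀ : Fin n → ℝ} {h : ℝ → Fin n₀ → ℝ} {x : ℝ → Fin n → ℝ} {w₀ z₀ : ℝ → Fin n₀ → ℝ}
    (hh : IsPast h) (tr : S.IsTrajectory Δ.apply x₀ h 0 x w₀ z₀) {ε : ℝ} (hε : 0 < ε) :
    ∃ T, 0 ≤ T ∧ ∀ᵐ t, T ≤ t → (∀ i, |x t i| ≤ ε) ∧ ∀ i, |w₀ t i| ≤ ε := by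
  obtain ⟨B, hB⟩ := hst.ae_bounded hh tr
  obtain ⟨hx, hz⟩ := hst.attractive _ _ _ _ _ hh tr
  obtain ⟨c, hc, hcε⟩ := exists_pos_forall_mul_lt (fun i => (Δ₀ *ᵥ 1) i) (half_pos hε)
  have hz' := Metric.tendsto_nhds.1 hz c hc
  obtain ⟨s, hs, s', hs', hss⟩ := eventually_inf.1 hz'
  obtain ⟨T₁, hT₁⟩ := mem_atTop_sets.1 hs
  obtain ⟨T₂, hT₂⟩ := PositiveLTI.eventually_abs_apply_le hΔ (z := z₀) (b := fun _ => c) (T := T₁)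
    (fun _ => hc.le) hB (by
      filter_upwards [hs'] with t ht htT j
      have := hss t ⟨hT₁ t htT, ht⟩
      rw [dist_zero_right] at this
      exact (norm_le_pi_norm (z₀ t) j).trans this.le) (half_pos hε)
  obtain ⟨T₃, hT₃⟩ := eventually_atTop.1 (Metric.tendsto_nhds.1 hx ε hε)
  have hw := tr.loop_w₀
  rw [ae_restrict_iff' measurableSet_Ici] at hw
  refine ⟨max 0 (max T₂ T₃), le_max_left _ _, ?_⟩
  filter_upwards [hT₂, hw] with t h1 h2 ht
  have ht0 : 0 ≤ t := (le_max_left _ _).trans ht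
  have ht2 : T₂ ≤ t := ((le_max_left _ _).trans (le_max_right _ _)).trans ht
  have ht3 : T₃ ≤ t := ((le_max_right _ _).trans (le_max_right _ _)).trans ht
  refine ⟨fun i => ?_, fun i => ?_⟩
  · have := hT₃ t ht3
    rw [dist_zero_right] at this
    exact (norm_le_pi_norm (x t) i).trans this.le
  · rw [h2 ht0]
    refine (h1 ht2 i).trans ?_
    have h3 : (fun _ : Fin n₀ => c) = c • 1 := by ext; simp
    have h4 := hcε i
    rw [h3, mulVec_smul, Pi.smul_apply, smul_eq_mul]
    linarith

theorem L1norm_smul {k : ℕ} (c : ℝ) (f : ℝ → Fin k → ℝ) : L1norm (c • f) = ‖c‖ₑ * L1norm f := by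
  rw [L1norm, L1norm, ← lintegral_const_mul' _ _ enorm_ne_top]
  refine lintegral_congr fun t => ?_
  rw [Finset.mul_sum]
  exact Finset.sum_congr rfl fun i _ => enorm_mul _ _

/-- The gain bounds the output of every trajectory with vanishing initial condition. -/
theorem LFR.L1norm_output_le {w₁ : ℝ → Fin p → ℝ} {x : ℝ → Fin n → ℝ} {w₀ z₀ : ℝ → Fin n₀ → ℝ}
    (tr : S.IsTrajectory Δ.apply 0 0 w₁ x w₀ z₀) (hw₁ : IntegrableOn w₁ (Ici 0)) {r : ℝ}
    (hr : 0 < r) (hw₁r : L1norm w₁ = ENNReal.ofReal r) :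
    L1norm (S.output x w₀ w₁) ≤ S.L1gain Δ.apply * ENNReal.ofReal r := by
  have htr := tr.smul r⁻¹
  rw [smul_zero, smul_zero] at htr
  have hr' : ‖r⁻¹‖ₑ = (ENNReal.ofReal r)⁻¹ := by
    rw [← ENNReal.ofReal_inv_of_pos hr, Real.enorm_of_nonneg (inv_nonneg.2 hr.le)]
  have h0 : ENNReal.ofReal r ≠ 0 := by simpa using hr
  have h1 : L1norm (r⁻¹ • w₁) = 1 := by
    rw [L1norm_smul, hr', hw₁r, ENNReal.inv_mul_cancel h0 ENNReal.ofReal_ne_top]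
  have h2 : L1norm (S.output (r⁻¹ • x) (r⁻¹ • w₀) (r⁻¹ • w₁)) ≤ S.L1gain Δ.apply :=
    le_sSup ⟨_, _, _, _, hw₁.smul r⁻¹, h1, htr, rfl⟩
  have h3 : S.output (r⁻¹ • x) (r⁻¹ • w₀) (r⁻¹ • w₁) = r⁻¹ • S.output x w₀ w₁ := by
    ext t : 1
    simp only [LFR.output, Pi.smul_apply, mulVec_smul, smul_add]
  rw [h3, L1norm_smul, hr', mul_comm, ← div_eq_mul_inv] at h2
  exact (ENNReal.div_le_iff_le_mul (Or.inl h0) (Or.inl ENNReal.ofReal_ne_top)).1 h2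

theorem LFR.StableWithGain.not_exists_dual (hS : S.IsPositive) (hloop : S.PositiveLoop Δ₀)
    (hΔ : Δ.HasStaticGain Δ₀) {γ : ℝ} (hst : S.StableWithGain Δ.apply γ)
    {v : Fin n → ℝ} {w : Fin n₀ → ℝ} {u : Fin p → ℝ} (hv : ∀ i, 0 ≤ v i)
    (hu : ∀ i, 0 ≤ u i) (hvu : ¬(v = 0 ∧ u = 0))
    (hA : ∀ i, 0 ≤ (S.A *ᵥ v + S.E₀ *ᵥ w + S.E₁ *ᵥ u) i)
    (hw : Δ₀ *ᵥ (S.C₀ *ᵥ v + S.F₀₀ *ᵥ w + S.F₀₁ *ᵥ u) = w)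
    (hγ : γ * (1 ⬝ᵥ u) ≤ 1 ⬝ᵥ (S.C₁ *ᵥ v + S.F₁₀ *ᵥ w + S.F₁₁ *ᵥ u)) : False := by
  obtain ⟨hst, hgain⟩ := hst
  set z := S.C₀ *ᵥ v + S.F₀₀ *ᵥ w + S.F₀₁ *ᵥ u with hz
  obtain ⟨x, w₀, z₀, tr⟩ := hst.exists_trajectory v (fun _ => z) 0 (isPast_const z)
    integrableOn_zero
  by_cases hu0 : u = 0
  · subst hu0
    -- Without input the trajectory stays above `v ≥ 0` and tends to zero, so `v = 0`.
    refine hvu ⟨funext fun i => le_antisymm ?_ (hv i), rfl⟩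
    have h1 := ((continuous_apply i).tendsto _).comp
      (hst.attractive _ _ _ _ _ (isPast_const z) tr).1
    refine ge_of_tendsto h1 ?_
    filter_upwards [eventually_ge_atTop 0] with t ht
    exact (tr.ge_of_subsolution hS hloop hΔ (T := t) (locallyIntegrableOn_Ici_const 0)
      (fun _ _ => rfl) hA hz.symm hw).1 t ⟨ht, le_rfl⟩ i
  have hU : 0 < 1 ⬝ᵥ u := by
    refine lt_of_le_of_ne (dotProduct_nonneg_of_nonneg (fun _ => zero_le_one) hu) fun h => hu0 ?_
    rw [one_dotProduct, eq_comm, Finset.sum_eq_zero_iff_of_nonneg fun i _ => hu i] at h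
    exact funext fun i => h i (Finset.mem_univ i)
  obtain ⟨g, hg0, hg, hgγ⟩ : ∃ g : ℝ, 0 ≤ g ∧ S.L1gain Δ.apply = ENNReal.ofReal g ∧ g < γ := by
    have htop : S.L1gain Δ.apply ≠ ⊤ := hgain.ne_top
    refine ⟨_, ENNReal.toReal_nonneg, (ENNReal.ofReal_toReal htop).symm, ?_⟩
    exact (ENNReal.lt_ofReal_iff_toReal_lt htop).1 hgain
  -- `β` is the summed output of the free trajectory from `v`. Adding the zero-state response to the
  -- input `u` on `[0, T]` gives a trajectory above the subsolution, so the zero-state output sums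
  -- to at least `γ * (1 ⬝ᵥ u) - β`. The gain `g < γ` then makes the integral of `β` grow at least
  -- linearly in `T`.
  let β : ℝ → ℝ := fun t => 1 ⬝ᵥ (S.C₁ *ᵥ x t + S.F₁₀ *ᵥ w₀ t)
  have hoi : LocallyIntegrableOn (fun t => S.C₁ *ᵥ x t + S.F₁₀ *ᵥ w₀ t) (Ici 0) :=
    (tr.integrable_x.mulVec _).add (tr.integrable_w₀.mulVec _)
  have hβi : ∀ a b, 0 ≤ a → a ≤ b → IntervalIntegrable β volume a b := fun a b ha hab =>
    (intervalIntegrable_dotProduct hoi 1 (ha.trans hab)).mono_set (by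
      rw [uIcc_of_le hab, uIcc_of_le (ha.trans hab)]
      exact Icc_subset_Icc_left ha)
  -- the response to a constant input switched off at time `T`
  have key : ∀ T : ℝ, 0 < T → (γ - g) * (1 ⬝ᵥ u) * T ≤ ∫ t in (0 : ℝ)..T, β t := fun T hT => by
    let w₁ : ℝ → Fin p → ℝ := (Icc 0 T).indicator fun _ => u
    have hw₁ : Integrable w₁ :=
      (integrable_indicator_iff measurableSet_Icc).2
        (continuousOn_const.integrableOn_compact isCompact_Icc)
    have hw₁l : LocallyIntegrableOn w₁ (Ici 0) := hw₁.integrableOn.locallyIntegrableOn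
    have hpast0 : IsPast (0 : ℝ → Fin n₀ → ℝ) := isPast_const 0
    obtain ⟨x', w₀', z₀', tr'⟩ := hst.exists_trajectory 0 0 w₁ hpast0 hw₁.integrableOn
    have htr := tr.add tr' (locallyIntegrableOn_Ici_const 0) hw₁l (isPast_const z) hpast0
    rw [add_zero, add_zero, zero_add] at htr
    obtain ⟨h1, h2⟩ := htr.ge_of_subsolution hS hloop hΔ (T := T) hw₁l
      (fun t ht => indicator_of_mem ht _) hA hz.symm hw
    have hout : LocallyIntegrableOn (S.output x' w₀' w₁) (Ici 0) :=
      ((tr'.integrable_x.mulVec _).add (tr'.integrable_w₀.mulVec _)).add (hw₁l.mulVec _)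
    have hnorm : L1norm w₁ = ENNReal.ofReal (T * (1 ⬝ᵥ u)) := by
      have h3 : ∀ t, ∑ i, ‖w₁ t i‖ₑ = (Icc 0 T).indicator (fun _ => ENNReal.ofReal (1 ⬝ᵥ u)) t :=
        fun t => by
          by_cases ht : t ∈ Icc 0 T
          · simp only [w₁, indicator_of_mem ht, one_dotProduct]
            rw [ENNReal.ofReal_sum_of_nonneg fun i _ => hu i]
            exact Finset.sum_congr rfl fun i _ => Real.enorm_of_nonneg (hu i)
          · simp only [w₁, indicator_of_notMem ht, Pi.zero_apply, enorm_zero,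
              Finset.sum_const_zero]
      rw [L1norm]
      simp only [h3]
      rw [setLIntegral_indicator measurableSet_Icc, inter_eq_left.2 Icc_subset_Ici_self,
        setLIntegral_const, Real.volume_Icc, sub_zero, mul_comm, ENNReal.ofReal_mul hT.le]
    have h4 := (ofReal_integral_le_L1norm hout hT.le).trans
      (S.L1norm_output_le tr' hw₁.integrableOn (mul_pos hT hU) hnorm)
    rw [hg, ← ENNReal.ofReal_mul hg0, ENNReal.ofReal_le_ofReal_iff
      (mul_nonneg hg0 (mul_pos hT hU).le)] at h4
    have h5 : ∫ t in (0 : ℝ)..T, (γ * (1 ⬝ᵥ u) - β t) ≤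
        ∫ t in (0 : ℝ)..T, ∑ i, |S.output x' w₀' w₁ t i| := by
      refine intervalIntegral.integral_mono_ae_restrict hT.le
        (intervalIntegrable_const.sub (hβi 0 T le_rfl hT.le))
        ((LocallyIntegrableOn.finsetSum _ fun i => (hout.eval i).abs).intervalIntegrable le_rfl
          hT.le) ?_
      rw [ae_restrict_iff' measurableSet_Ici] at h2
      refine (ae_restrict_iff' measurableSet_Icc).2 ?_
      filter_upwards [h2] with t h2 ht
      have h6 : 1 ⬝ᵥ S.output x' w₀' w₁ t ≤ ∑ i, |S.output x' w₀' w₁ t i| := by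
        rw [one_dotProduct]
        exact Finset.sum_le_sum fun i _ => le_abs_self _
      have h7 : 1 ⬝ᵥ (S.C₁ *ᵥ v) ≤ 1 ⬝ᵥ (S.C₁ *ᵥ (x + x') t) :=
        dotProduct_le_dotProduct (fun _ => zero_le_one) (mulVec_mono hS.C₁ (h1 t ht))
      have h8 : 1 ⬝ᵥ (S.F₁₀ *ᵥ w) ≤ 1 ⬝ᵥ (S.F₁₀ *ᵥ (w₀ + w₀') t) :=
        dotProduct_le_dotProduct (fun _ => zero_le_one) (mulVec_mono hS.F₁₀ (h2 ht.1 ht.2))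
      have h9 : w₁ t = u := indicator_of_mem ht _
      refine le_trans ?_ h6
      simp only [β, LFR.output, h9, Pi.add_apply, mulVec_add, dotProduct_add] at *
      linarith
    rw [intervalIntegral.integral_sub intervalIntegrable_const (hβi 0 T le_rfl hT.le),
      intervalIntegral.integral_const, smul_eq_mul, sub_zero] at h5
    linarith
  have hκ : 0 < (γ - g) * (1 ⬝ᵥ u) := mul_pos (sub_pos.2 hgγ) hU
  -- As the free trajectory decays, `β` eventually stays below half of the linear rate just
  -- obtained.
  obtain ⟨ε, hε, hεκ⟩ := exists_pos_forall_mul_lt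
    (fun _ : Unit => (1 : Fin q → ℝ) ⬝ᵥ (S.C₁ *ᵥ 1 + S.F₁₀ *ᵥ 1)) (half_pos hκ)
  obtain ⟨T, hT, hsmall⟩ := hst.eventually_abs_le hΔ (isPast_const z) tr hε
  have htail : ∀ t, T ≤ t → ∫ s in T..t, β s ≤ (t - T) * ((γ - g) * (1 ⬝ᵥ u) / 2) := fun t ht => by
    rw [← smul_eq_mul, ← intervalIntegral.integral_const]
    refine intervalIntegral.integral_mono_ae_restrict ht (hβi T t hT ht)
      intervalIntegrable_const ?_
    refine (ae_restrict_iff' measurableSet_Icc).2 ?_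
    filter_upwards [hsmall] with s hs hsI
    obtain ⟨h1, h2⟩ := hs hsI.1
    have h3 : 1 ⬝ᵥ (S.C₁ *ᵥ x s) ≤ 1 ⬝ᵥ (S.C₁ *ᵥ (ε • 1)) :=
      dotProduct_le_dotProduct (fun _ => zero_le_one) (mulVec_mono hS.C₁ fun i => by
        simpa using (le_abs_self _).trans (h1 i))
    have h4 : 1 ⬝ᵥ (S.F₁₀ *ᵥ w₀ s) ≤ 1 ⬝ᵥ (S.F₁₀ *ᵥ (ε • 1)) :=
      dotProduct_le_dotProduct (fun _ => zero_le_one) (mulVec_mono hS.F₁₀ fun i => by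
        simpa using (le_abs_self _).trans (h2 i))
    have h5 := hεκ ()
    simp only [β, dotProduct_add, mulVec_smul, dotProduct_smul, smul_eq_mul, mul_add] at *
    linarith
  let I := ∫ t in (0 : ℝ)..T, β t
  -- At this time the remaining half rate over `[T, t]` has accumulated more than `|I|`, the largest
  -- possible contribution of `[0, T]`.
  let t := T + 2 * |I| / ((γ - g) * (1 ⬝ᵥ u)) + 1
  have hIt : 0 ≤ 2 * |I| / ((γ - g) * (1 ⬝ᵥ u)) := by positivity
  have hTt : T ≤ t := by simp only [t]; linarith
  have h1 := key t (by linarith)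
  rw [← intervalIntegral.integral_add_adjacent_intervals (hβi 0 T le_rfl hT) (hβi T t hT hTt)] at h1
  have h2 := htail t hTt
  have h3 : (t - T) * ((γ - g) * (1 ⬝ᵥ u)) = 2 * |I| + (γ - g) * (1 ⬝ᵥ u) := by
    have := div_mul_cancel₀ (2 * |I|) hκ.ne'
    simp only [t]
    linear_combination this
  have h4 : 0 ≤ T * ((γ - g) * (1 ⬝ᵥ u)) := by positivity
  have h5 := le_abs_self I
  change _ ≤ I + _ at h1
  linarith

end Converse

/-! ### The constant loop as a convolution -/

section StaticOperator

variable {n₀ : ℕ} (Δ₀ : Matrix (Fin n₀) (Fin n₀) ℝ)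

/-- The memoryless operator with gain `Δ₀`, as a convolution with multiples of the Dirac measure
at `0`. -/
noncomputable def PositiveLTI.static : PositiveLTI n₀ where
  kernel i j := ENNReal.ofReal (Δ₀ i j) • Measure.dirac 0
  finite i j := Measure.smul_finite _ ENNReal.ofReal_ne_top
  causal i j := by simp

variable {Δ₀}

theorem PositiveLTI.apply_static (hΔ₀ : EntrywiseNonneg Δ₀) :
    (PositiveLTI.static Δ₀).apply = staticOperator Δ₀ := by
  funext z t
  ext i
  simp [PositiveLTI.apply, PositiveLTI.static, staticOperator, mulVec, dotProduct,
    integral_smul_measure, ENNReal.toReal_ofReal (hΔ₀ _ _)]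

theorem PositiveLTI.hasStaticGain_static (hΔ₀ : EntrywiseNonneg Δ₀) :
    (PositiveLTI.static Δ₀).HasStaticGain Δ₀ := by
  ext i j
  simp [PositiveLTI.transfer, PositiveLTI.static, measureReal_def,
    ENNReal.toReal_ofReal (hΔ₀ _ _)]

end StaticOperator

/-! ### Sufficiency and the equivalence -/

section Equivalence

variable {n n₀ p q : ℕ} {S : LFR n n₀ p q} {Δ₀ : Matrix (Fin n₀) (Fin n₀) ℝ}

theorem LFR.stableWithGain_of_multipliers (hS : S.IsPositive) (hΔ₀ : EntrywiseNonneg Δ₀)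
    (hloop : S.PositiveLoop Δ₀) {γ : ℝ} (hγ : 0 < γ) {l : Fin n → ℝ} {ψ : Fin n₀ → ℝ}
    (hl : ∀ i, 0 < l i)
    (h1 : ∀ i, (l ᵥ* S.A + ψ ᵥ* (Δ₀ * S.C₀) + 1 ᵥ* S.C₁) i < 0)
    (h2 : ∀ i, (l ᵥ* S.E₀ + ψ ᵥ* (Δ₀ * S.F₀₀) + 1 ᵥ* S.F₁₀) i < ψ i)
    (h3 : ∀ i, (l ᵥ* S.E₁ + ψ ᵥ* (Δ₀ * S.F₀₁) + 1 ᵥ* S.F₁₁) i < γ)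
    {Δ : PositiveLTI n₀} (hΔ : Δ.HasStaticGain Δ₀) : S.StableWithGain Δ.apply γ := by
  have hE : ∀ i, 0 ≤ (l ᵥ* S.E₀) i := vecMul_nonneg' hS.E₀ fun i => (hl i).le
  have hF : ∀ i, 0 ≤ ((1 : Fin q → ℝ) ᵥ* S.F₁₀) i := vecMul_nonneg' hS.F₁₀ fun _ => zero_le_one
  have hC : ∀ i, 0 ≤ ((1 : Fin q → ℝ) ᵥ* S.C₁) i := vecMul_nonneg' hS.C₁ fun _ => zero_le_one
  simp only [Pi.add_apply] at h1 h2
  -- The sign of the multiplier is not imposed; it follows from the second inequality and the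
  -- nonnegative inverse of `1 - Δ₀ * F₀₀`.
  have hψ : ∀ i, 0 ≤ ψ i := hloop.nonneg_of_vecMul_le fun i => by
    linarith [h2 i, hE i, hF i]
  obtain ⟨v, w, z, hd⟩ := LFR.exists_isDecayVector hS hΔ₀ hl hψ
    (fun i => by simp only [Pi.add_apply]; linarith [h1 i, hC i])
    (fun i => by simp only [Pi.add_apply]; linarith [h2 i, hF i])
  refine ⟨⟨fun x₀ h w₁ hh hw₁ => LFR.exists_trajectory hS hΔ₀ hloop hΔ x₀ h w₁ hh hw₁,
    hd.lyapunov hS hloop hΔ, hd.attractive hS hloop hΔ⟩, ?_⟩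
  -- The finitely many strict inequalities survive for some `g < γ`, which makes the gain bound
  -- strict.
  have hev : ∀ᶠ g in 𝓝[<] γ,
      0 ≤ g ∧ ∀ i, (l ᵥ* S.E₁ + ψ ᵥ* (Δ₀ * S.F₀₁) + 1 ᵥ* S.F₁₁) i ≤ g :=
    nhdsWithin_le_nhds ((eventually_ge_nhds hγ).and
      (eventually_all.2 fun i => eventually_ge_nhds (h3 i)))
  obtain ⟨g, ⟨hg0, hg⟩, hgγ⟩ := (hev.and self_mem_nhdsWithin).exists
  exact (LFR.L1gain_le hS hΔ hg0 (fun i => (hl i).le) hψ (fun i => (h1 i).le)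
    (fun i => (h2 i).le) hg).trans_lt ((ENNReal.ofReal_lt_ofReal_iff hγ).2 hgγ)

end Equivalence

theorem theorem3 {n n₀ p q : ℕ} (S : LFR n n₀ p q) (hS : S.IsPositive)
    (Δ₀ : Matrix (Fin n₀) (Fin n₀) ℝ) (hΔ₀ : EntrywiseNonneg Δ₀) (hloop : S.PositiveLoop Δ₀)
    (γ : ℝ) (hγ : 0 < γ) :
    List.TFAE [
      S.StableWithGain (staticOperator Δ₀) γ,
      ∀ Δ : PositiveLTI n₀, Δ.HasStaticGain Δ₀ → S.StableWithGain Δ.apply γ,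
      ∃ Δ : PositiveLTI n₀, Δ.HasStaticGain Δ₀ ∧ S.StableWithGain Δ.apply γ,
      ∃ (lam : Fin n → ℝ) (φ₁ φ₂ : Fin n₀ → ℝ),
        (∀ i, 0 < lam i) ∧
        (∀ i, (lam ᵥ* S.A + φ₁ ᵥ* S.C₀ + 1 ᵥ* S.C₁) i < 0) ∧
        (∀ i, (lam ᵥ* S.E₀ + φ₂ + φ₁ ᵥ* S.F₀₀ + 1 ᵥ* S.F₁₀) i < 0) ∧
        (∀ i, (lam ᵥ* S.E₁ - γ • 1 + φ₁ ᵥ* S.F₀₁ + 1 ᵥ* S.F₁₁) i < 0) ∧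
        φ₁ + φ₂ ᵥ* Δ₀ = 0 ] := by
  have hstat := PositiveLTI.hasStaticGain_static hΔ₀
  tfae_have 2 → 1 := fun h => PositiveLTI.apply_static hΔ₀ ▸ h _ hstat
  tfae_have 1 → 3 := fun h => ⟨_, hstat, (PositiveLTI.apply_static hΔ₀).symm ▸ h⟩
  tfae_have 3 → 4 := by
    rintro ⟨Δ, hΔ, hst⟩
    rcases S.exists_multipliers_or_exists_dual hloop γ with
      ⟨l, ψ, hl, h1, h2, h3⟩ | ⟨v, w, u, hv, -, hu, hvu, hA, hw, hg⟩
    -- The equation `φ₁ + φ₂ ᵥ* Δ₀ = 0` leaves one free multiplier `ψ = -φ₂`.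
    · refine ⟨l, ψ ᵥ* Δ₀, -ψ, hl, fun i => ?_, fun i => ?_, fun i => ?_, ?_⟩
      · simpa [vecMul_vecMul] using h1 i
      · have := h2 i
        simp only [vecMul_vecMul, Pi.add_apply, Pi.neg_apply] at this ⊢
        linarith
      · have := h3 i
        simp only [vecMul_vecMul, Pi.add_apply, Pi.sub_apply, Pi.smul_apply, Pi.one_apply,
          smul_eq_mul, mul_one] at this ⊢
        linarith
      · rw [neg_vecMul, add_neg_cancel]
    · exact (hst.not_exists_dual hS hloop hΔ hv hu hvu hA hw hg).elim
  tfae_have 4 → 2 := by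
    rintro ⟨l, φ₁, φ₂, hl, h1, h2, h3, h4⟩ Δ hΔ
    obtain rfl : φ₁ = (-φ₂) ᵥ* Δ₀ := by rw [neg_vecMul]; exact eq_neg_of_add_eq_zero_left h4
    refine LFR.stableWithGain_of_multipliers hS hΔ₀ hloop hγ (ψ := -φ₂) hl (fun i => ?_)
      (fun i => ?_) (fun i => ?_) hΔ
    · simpa [vecMul_vecMul] using h1 i
    · have := h2 i
      simp only [vecMul_vecMul, Pi.add_apply, Pi.neg_apply] at this ⊢
      linarith
    · have := h3 i
      simp only [vecMul_vecMul, Pi.add_apply, Pi.sub_apply, Pi.smul_apply, Pi.one_apply,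
        smul_eq_mul, mul_one] at this ⊢
      linarith
  tfae_finish
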